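/- **Setting.** Let $\Omega\subset\mathbb R^2$ be a bounded polygonal domain (connected, without cracks) and $\mathcal T_h$ a proper (face-to-face) triangulation of it. Let $\partial\Omega=\Gamma_D\cup\Gamma_N$ be a disjoint union, where up to the assignment of edge endpoints $\Gamma_D$ and $\Gamma_N$ consist of boundary edges of $\mathcal T_h$, and every point of $\Gamma_D$ lies on a closed boundary edge whose relative interior is contained in $\Gamma_D$. Let $f\in L^2(\Omega)$, let $g_D$ be linear on each boundary edge in $\Gamma_D$, and let $g_N$ be constant on each boundary edge in $\Gamma_N$. Norms $\|\cdot\|_A$ are $L^2(A)$ norms, and $(\cdot,\cdot)$ is the $L^2(\Omega)$ inner product. Let $V=\{v\in H^1(\Omega): v=g_D\text{ on }\Gamma_D\}$ and $V_0=\{v\in H^1(\Omega): v=0\text{ on }\Gamma_D\}$ (in the sense of traces); if $\Gamma_D=\emptyset$, let $V=V_0=\{v\in H^1(\Omega):\int_\Omega v\,dx=0\}$. Let $V_h$, $V_{h,0}$ be the spaces of continuous functions, linear on each $K\in\mathcal T_h$, with the boundary (or mean value) conditions of $V$, $V_0$. Let $u\in V$ and $u_h\in V_h$ satisfy $$(\nabla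 u,\nabla v)=(f,v)+\int_{\Gamma_N}g_Nv\,ds\quad\forall v\in V_0,\qquad (\nabla u_h,\nabla v_h)=(f,v_h)+\int_{\Gamma_N}g_Nv_h\,ds\quad\forall v_h\in V_{h,0}.$$ Let $X_h$ be the space of functions constant on each $K\in\mathcal T_h$ (with $\int_\Omega v_h\,dx=0$ required in addition if $\Gamma_D=\emptyset$), let $\pi_h:L^2(\Omega)\to X_h$ be the $L^2$-orthogonal projection, let $RT_h$ be the space of $\mathbf p_h\in H(\mathrm{div};\Omega)$ of the form $(a_K+c_Kx,\,b_K+c_Ky)$ on each $K$, with constants $a_K,b_K,c_K$, and let $RT_{h,0}=\{\mathbf q_h\in RT_h:\mathbf q_h\cdot\mathbf n=0\text{ on }\Gamma_N\}$, where $\mathbf n$ is the unit outer normal. Let $h$ be the largest edge length in $\mathcal T_h$. For each $K$ let $C_0(K)$ be a constant such that $\|v-\frac1{|K|}\int_Kv\,dx\|_K\le C_0(K)\|\nabla v\|_K$ for all $v\in H^1(K)$, and set $$C_0=\max_{K\in\mathcal T_h}\frac{C_0(K)}h,\qquad \kappa_h=\max_{0\ne f_h\in X_h}\ \min_{\substack{v_h\in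 V_{h,0},\ \mathbf q_h\in RT_{h,0}\\ \mathrm{div}\,\mathbf q_h+f_h=0}}\frac{\|\nabla v_h-\mathbf q_h\|_\Omega}{\|f_h\|_\Omega},\qquad C(h)=\sqrt{\kappa_h^2+(C_0h)^2}$$ ($\kappa_h=0$ if $X_h=\{0\}$). Let $S\subset\Omega$ be a subdomain (any measurable subset is allowed), $\varepsilon>0$, and $\Omega'=\{x\in\Omega:\mathrm{dist}(x,S)<\varepsilon\}$. Let $\alpha\in W^{1,\infty}(\Omega)$, identified with its continuous representative on $\overline\Omega$, satisfy $\alpha=1$ on $S$, $\alpha=0$ on $\Omega\setminus\Omega'$ and $0\le\alpha\le1$. Put $\|\mathbf q\|_\alpha=\left(\int_{\Omega'}\alpha|\mathbf q|^2dx\right)^{1/2}$ and $\|\nabla\alpha\|_{L^\infty(\Omega)}=\max_{i=1,2}\|\partial_i\alpha\|_{L^\infty(\Omega)}$. **Theorem.** For every $\mathbf p_h\in RT_h$ satisfying $\mathrm{div}\,\mathbf p_h+\pi_hf=0$ in $\Omega$ and $\mathbf p_h\cdot\mathbf n=g_N$ on $\Gamma_N$, $$\|\nabla u-\nabla u_h\|_S\le\sqrt{E_1^2+E_2^2}+2C_0h\|f-\pi_hf\|_\Omega,$$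 where $$E_1=\|\nabla u_h-\mathbf p_h\|_\alpha+C_0h\|f-\pi_hf\|_\Omega,\qquad E_2=\left\{2\sqrt2\,C(h)\,\|\nabla\alpha\|_{L^\infty(\Omega)}\right\}^{1/2}\|\nabla u_h-\mathbf p_h\|_\Omega .$$ -/

import Mathlib

open MeasureTheory Filter Topology

noncomputable section

namespace LocalFEM

/-- The plane with its Euclidean norm. -/
abbrev Plane : Type := EuclideanSpace ℝ (Fin 2)

/-! ### Norms and weak derivatives -/

/-- The `L²(A)` norm of a scalar or vector valued function. -/
def l2norm {F : Type*} [NormedAddCommGroup F] (A : Set Plane) (g : Plane → F) : ℝ :=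
  Real.sqrt (∫ x in A, ‖g x‖ ^ 2)

/-- The weighted norm `(∫_A α |g|²)^{1/2}`. -/
def weightedNorm {F : Type*} [NormedAddCommGroup F] (A : Set Plane) (α : Plane → ℝ)
    (g : Plane → F) : ℝ :=
  Real.sqrt (∫ x in A, α x * ‖g x‖ ^ 2)

/-- Test functions: smooth functions with compact support inside `U`. -/
def IsTestFunction (U : Set Plane) (φ : Plane → ℝ) : Prop :=
  ContDiff ℝ ((⊤ : ℕ∞) : WithTop ℕ∞) φ ∧ HasCompactSupport φ ∧ tsupport φ ⊆ U

/-- `G` is the weak gradient of `v` in `U`. -/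
def HasWeakGrad (U : Set Plane) (v : Plane → ℝ) (G : Plane → Plane) : Prop :=
  ∀ φ : Plane → ℝ, IsTestFunction U φ → ∀ e : Plane,
    ∫ x in U, v x * fderiv ℝ φ x e = - ∫ x in U, inner ℝ (G x) e * φ x

/-- `d` is the weak divergence of `p` in `U`: `∫ p · ∇φ = - ∫ d φ` for test functions `φ`. -/
def HasWeakDiv (U : Set Plane) (p : Plane → Plane) (d : Plane → ℝ) : Prop :=
  ∀ φ : Plane → ℝ, IsTestFunction U φ →
    ∫ x in U, fderiv ℝ φ x (p x) = - ∫ x in U, d x * φ x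

/-- A representative of an element of the Sobolev space `H¹(U)`, together with a representative
of its weak gradient. -/
structure H1 (U : Set Plane) where
  toFun : Plane → ℝ
  grad : Plane → Plane
  memLp_toFun : MemLp toFun 2 (volume.restrict U)
  memLp_grad : MemLp grad 2 (volume.restrict U)
  hasWeakGrad : HasWeakGrad U toFun grad

/-- Membership in `H(div; U)`. -/
def MemHdiv (U : Set Plane) (p : Plane → Plane) : Prop :=
  MemLp p 2 (volume.restrict U) ∧
    ∃ d : Plane → ℝ, MemLp d 2 (volume.restrict U) ∧ HasWeakDiv U p d

/-- Arc length on the boundary of `Ω`. -/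
def arcLength (Γ : Set Plane) : Measure Plane :=
  (Measure.hausdorffMeasure 1 : Measure Plane).restrict Γ

/-- `τ ∈ L²(∂Ω)` is the trace of `v ∈ H¹(Ω)`: the trace operator is the continuous extension of
the restriction `φ ↦ φ|_{∂Ω}`, defined for `φ ∈ H¹(Ω) ∩ C(closure Ω)`. -/
def HasTrace (Ω : Set Plane) (v : H1 Ω) (τ : Plane → ℝ) : Prop :=
  MemLp τ 2 (arcLength (frontier Ω)) ∧
    ∃ φ : ℕ → H1 Ω,
      (∀ n, ContinuousOn (φ n).toFun (closure Ω)) ∧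
      Tendsto (fun n => l2norm Ω (fun x => (φ n).toFun x - v.toFun x)) atTop (𝓝 0) ∧
      Tendsto (fun n => l2norm Ω (fun x => (φ n).grad x - v.grad x)) atTop (𝓝 0) ∧
      Tendsto (fun n => eLpNorm (fun x => (φ n).toFun x - τ x) 2 (arcLength (frontier Ω)))
        atTop (𝓝 0)

/-! ### Polygonal domains and triangulations -/

/-- The triangles of a two-dimensional simplicial complex, given by their vertex sets. -/
def triangles (T : Geometry.SimplicialComplex ℝ Plane) : Set (Finset Plane) :=
  {K | K ∈ T.faces ∧ K.card = 3}

/-- `T` is a (proper, i.e. face-to-face) triangulation of `Ω`. -/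
structure IsTriangulation (Ω : Set Plane) (T : Geometry.SimplicialComplex ℝ Plane) : Prop where
  finite : T.faces.Finite
  pure : ∀ s ∈ T.faces, ∃ K ∈ triangles T, s ⊆ K
  space_eq : T.space = closure Ω

/-- Bounded polygonal domains (with no cracks), i.e. domains that can be triangulated. -/
structure IsPolygonalDomain (Ω : Set Plane) : Prop where
  isOpen : IsOpen Ω
  isConnected : IsConnected Ω
  interior_closure : interior (closure Ω) = Ω
  triangulable : ∃ T : Geometry.SimplicialComplex ℝ Plane, IsTriangulation Ω T

/-- The open triangle with vertex set `K`. -/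
def openTriangle (K : Finset Plane) : Set Plane := interior (convexHull ℝ (K : Set Plane))

/-- The boundary edges of the triangulation, given by their endpoints. -/
def boundaryEdges (Ω : Set Plane) (T : Geometry.SimplicialComplex ℝ Plane) :
    Set (Finset Plane) :=
  {e | e ∈ T.faces ∧ e.card = 2 ∧ convexHull ℝ (e : Set Plane) ⊆ frontier Ω}

/-- An edge without its two endpoints. -/
def openEdge (e : Finset Plane) : Set Plane := convexHull ℝ (e : Set Plane) \ (e : Set Plane)

/-- `∂Ω` is the disjoint union of `ΓD` and `ΓN`, each of which consists of boundary edges of the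
mesh (an endpoint of an edge may be assigned to either part, but `ΓD` has no isolated points). -/
structure IsBoundaryPartition (Ω : Set Plane) (T : Geometry.SimplicialComplex ℝ Plane)
    (ΓD ΓN : Set Plane) : Prop where
  disjoint : Disjoint ΓD ΓN
  union_eq : ΓD ∪ ΓN = frontier Ω
  resolved : ∀ e ∈ boundaryEdges Ω T, openEdge e ⊆ ΓD ∨ openEdge e ⊆ ΓN
  no_isolated : ∀ x ∈ ΓD, ∃ e ∈ boundaryEdges Ω T,
    x ∈ convexHull ℝ (e : Set Plane) ∧ openEdge e ⊆ ΓD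

/-- `g` is linear (affine) on each boundary edge belonging to `ΓD`. -/
def IsPiecewiseLinearOn (Ω : Set Plane) (T : Geometry.SimplicialComplex ℝ Plane)
    (ΓD : Set Plane) (g : Plane → ℝ) : Prop :=
  ∀ e ∈ boundaryEdges Ω T, openEdge e ⊆ ΓD →
    ∃ (a : Plane) (b : ℝ), ∀ x ∈ convexHull ℝ (e : Set Plane) ∩ ΓD, g x = inner ℝ a x + b

/-- `g` is constant on each boundary edge belonging to `ΓN`. -/
def IsPiecewiseConstantOn (Ω : Set Plane) (T : Geometry.SimplicialComplex ℝ Plane)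
    (ΓN : Set Plane) (g : Plane → ℝ) : Prop :=
  ∀ e ∈ boundaryEdges Ω T, openEdge e ⊆ ΓN → ∃ c : ℝ, ∀ x ∈ openEdge e, g x = c

/-! ### The boundary value problem and its discretization -/

/-- The space `V` of trial functions: `v = gD` on `ΓD` in the sense of traces, or `∫_Ω v = 0` in
case `ΓD` is empty. With `gD = 0` this is the space `V₀` of test functions. -/
def MemV (Ω ΓD : Set Plane) (gD : Plane → ℝ) (v : H1 Ω) : Prop :=
  ∃ τ : Plane → ℝ, HasTrace Ω v τ ∧ (ΓD.Nonempty → τ =ᵐ[arcLength ΓD] gD) ∧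
    (ΓD = ∅ → ∫ x in Ω, v.toFun x = 0)

/-- `u` is the weak solution of `-Δu = f` in `Ω`, `∂u/∂n = gN` on `ΓN`, `u = gD` on `ΓD`. -/
def IsWeakSolution (Ω ΓD ΓN : Set Plane) (f gD gN : Plane → ℝ) (u : H1 Ω) : Prop :=
  MemV Ω ΓD gD u ∧
    ∀ v : H1 Ω, MemV Ω ΓD 0 v → ∀ τ : Plane → ℝ, HasTrace Ω v τ →
      ∫ x in Ω, inner ℝ (u.grad x) (v.grad x) =
        (∫ x in Ω, f x * v.toFun x) + ∫ x, gN x * τ x ∂(arcLength ΓN)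

/-- The space `V_h` of continuous piecewise linear functions with the boundary condition of `V`.
With `gD = 0` this is `V_{h,0}`. -/
def MemVh (Ω : Set Plane) (T : Geometry.SimplicialComplex ℝ Plane) (ΓD : Set Plane)
    (gD : Plane → ℝ) (v : H1 Ω) : Prop :=
  ContinuousOn v.toFun (closure Ω) ∧
    (∀ K ∈ triangles T, ∃ (a : Plane) (b : ℝ),
      ∀ x ∈ convexHull ℝ (K : Set Plane), v.toFun x = inner ℝ a x + b) ∧
    (∀ x ∈ ΓD, v.toFun x = gD x) ∧
    (ΓD = ∅ → ∫ x in Ω, v.toFun x = 0)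

/-- `u_h` is the conforming finite element solution. -/
def IsFEMSolution (Ω : Set Plane) (T : Geometry.SimplicialComplex ℝ Plane) (ΓD ΓN : Set Plane)
    (f gD gN : Plane → ℝ) (uh : H1 Ω) : Prop :=
  MemVh Ω T ΓD gD uh ∧
    ∀ v : H1 Ω, MemVh Ω T ΓD 0 v →
      ∫ x in Ω, inner ℝ (uh.grad x) (v.grad x) =
        (∫ x in Ω, f x * v.toFun x) + ∫ x, gN x * v.toFun x ∂(arcLength ΓN)

/-- The space `X_h` of piecewise constant functions (with mean value zero if `ΓD` is empty). -/
def MemXh (Ω : Set Plane) (T : Geometry.SimplicialComplex ℝ Plane) (ΓD : Set Plane)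
    (g : Plane → ℝ) : Prop :=
  (∀ K ∈ triangles T, ∃ c : ℝ, ∀ x ∈ openTriangle K, g x = c) ∧
    (ΓD = ∅ → ∫ x in Ω, g x = 0)

/-- `πf = π_h f`, the `L²(Ω)` projection of `f` to `X_h`. -/
def IsProjection (Ω : Set Plane) (T : Geometry.SimplicialComplex ℝ Plane) (ΓD : Set Plane)
    (f πf : Plane → ℝ) : Prop :=
  MemXh Ω T ΓD πf ∧
    ∀ η : Plane → ℝ, MemXh Ω T ΓD η → ∫ x in Ω, (f x - πf x) * η x = 0

/-- The lowest order Raviart--Thomas space `RT_h`. -/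
def MemRT (Ω : Set Plane) (T : Geometry.SimplicialComplex ℝ Plane) (p : Plane → Plane) : Prop :=
  MemHdiv Ω p ∧
    ∀ K ∈ triangles T, ∃ (a : Plane) (c : ℝ), ∀ x ∈ openTriangle K, p x = a + c • x

/-- `n` is the unit normal to the edge `e` of the triangle `K` pointing out of `K`. -/
def IsOuterNormal (K e : Finset Plane) (n : Plane) : Prop :=
  ‖n‖ = 1 ∧ (∀ x ∈ e, ∀ y ∈ e, inner ℝ n (x - y) = 0) ∧
    (∀ x ∈ e, ∀ y ∈ K, inner ℝ n (y - x) ≤ 0)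

/-- `p · n = g` on `ΓN`, for piecewise polynomial `p`; the boundary values of `p` are its limits
from inside the adjacent triangle. -/
def HasNormalTrace (Ω : Set Plane) (T : Geometry.SimplicialComplex ℝ Plane) (ΓN : Set Plane)
    (p : Plane → Plane) (g : Plane → ℝ) : Prop :=
  ∀ K ∈ triangles T, ∀ e ∈ boundaryEdges Ω T, e ⊆ K → openEdge e ⊆ ΓN →
    ∀ n : Plane, IsOuterNormal K e n → ∀ x ∈ openEdge e,
      Tendsto (fun y => inner ℝ (p y) n) (𝓝[openTriangle K] x) (𝓝 (g x))

/-! ### The constants of the estimate -/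

/-- The mesh size `h`: the largest length of an edge of a triangle. -/
def meshSize (T : Geometry.SimplicialComplex ℝ Plane) : ℝ :=
  sSup ((fun K : Finset Plane => Metric.diam (K : Set Plane)) '' triangles T)

/-- `c` is an admissible constant `C₀(K)` for the projection onto constants on the triangle `K`:
`‖v - π v‖_K ≤ c |v|_{H¹(K)}` for all `v ∈ H¹(K)`, where `π v` is the mean value of `v`. -/
def IsProjectionConstant (K : Finset Plane) (c : ℝ) : Prop :=
  ∀ v : H1 (openTriangle K),
    l2norm (openTriangle K) (fun x => v.toFun x - ⨍ y in openTriangle K, v.toFun y) ≤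
      c * l2norm (openTriangle K) v.grad

/-- `C₀ = max_K C₀(K) / h`. -/
def globalC0 (T : Geometry.SimplicialComplex ℝ Plane) (C0K : Finset Plane → ℝ) : ℝ :=
  sSup ((fun K => C0K K / meshSize T) '' triangles T)

/-- `κ_h`: the maximum over `f_h ∈ X_h`, `f_h ≠ 0`, of the minimum of
`‖∇v_h - q_h‖ / ‖f_h‖` over `v_h ∈ V_{h,0}` and `q_h ∈ RT_{h,0}` with `div q_h + f_h = 0`. -/
def kappa (Ω : Set Plane) (T : Geometry.SimplicialComplex ℝ Plane) (ΓD ΓN : Set Plane) : ℝ :=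
  sSup {r : ℝ | ∃ fh : Plane → ℝ, MemXh Ω T ΓD fh ∧ l2norm Ω fh ≠ 0 ∧
    r = sInf {s : ℝ | ∃ (v : H1 Ω) (q : Plane → Plane),
      MemVh Ω T ΓD 0 v ∧ MemRT Ω T q ∧ HasNormalTrace Ω T ΓN q 0 ∧
      HasWeakDiv Ω q (fun x => - fh x) ∧
      s = l2norm Ω (fun x => v.grad x - q x) / l2norm Ω fh}}

/-- `C(h) = √(κ_h² + (C₀ h)²)`. -/
def constC (Ω : Set Plane) (T : Geometry.SimplicialComplex ℝ Plane) (ΓD ΓN : Set Plane)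
    (C0K : Finset Plane → ℝ) : ℝ :=
  Real.sqrt (kappa Ω T ΓD ΓN ^ 2 + (globalC0 T C0K * meshSize T) ^ 2)

/-! ### The weight function -/

/-- The part `Ω'` of `Ω` at distance less than `ε` from `S`. -/
def extendedDomain (Ω S : Set Plane) (ε : ℝ) : Set Plane := Ω ∩ Metric.thickening ε S

/-- The weight function `α ∈ W^{1,∞}(Ω)` (its continuous representative), with its weak
gradient: `α = 1` on `S`, `α = 0` outside `Ω'`, and `0 ≤ α ≤ 1`. -/
structure WeightFunction (Ω S : Set Plane) (ε : ℝ) where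
  toFun : Plane → ℝ
  grad : Plane → Plane
  continuousOn : ContinuousOn toFun (closure Ω)
  memLp_grad : MemLp grad ⊤ (volume.restrict Ω)
  hasWeakGrad : HasWeakGrad Ω toFun grad
  eq_one : ∀ x ∈ S, toFun x = 1
  eq_zero : ∀ x ∈ Ω \ extendedDomain Ω S ε, toFun x = 0
  nonneg : ∀ x ∈ Ω, 0 ≤ toFun x
  le_one : ∀ x ∈ Ω, toFun x ≤ 1

/-- `‖∇α‖_{L^∞(Ω)} = max (‖∂₁α‖_{L^∞(Ω)}, ‖∂₂α‖_{L^∞(Ω)})`. -/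
def WeightFunction.gradSup {Ω S : Set Plane} {ε : ℝ} (α : WeightFunction Ω S ε) : ℝ :=
  max (eLpNorm (fun x => α.grad x 0) ⊤ (volume.restrict Ω)).toReal
    (eLpNorm (fun x => α.grad x 1) ⊤ (volume.restrict Ω)).toReal

/-! ### The error quantities -/

/-- `E₁ = ‖∇u_h - p_h‖_α + C₀ h ‖f - π_h f‖_Ω`. -/
def errorE1 {Ω S : Set Plane} {ε : ℝ} (T : Geometry.SimplicialComplex ℝ Plane)
    (C0K : Finset Plane → ℝ) (α : WeightFunction Ω S ε) (f πf : Plane → ℝ) (uh : H1 Ω)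
    (ph : Plane → Plane) : ℝ :=
  weightedNorm (extendedDomain Ω S ε) α.toFun (fun x => uh.grad x - ph x) +
    globalC0 T C0K * meshSize T * l2norm Ω (fun x => f x - πf x)

/-- `E₂ = (2√2 C(h) ‖∇α‖_{L^∞(Ω)})^{1/2} ‖∇u_h - p_h‖_Ω`. -/
def errorE2 {Ω S : Set Plane} {ε : ℝ} (T : Geometry.SimplicialComplex ℝ Plane)
    (ΓD ΓN : Set Plane) (C0K : Finset Plane → ℝ) (α : WeightFunction Ω S ε) (uh : H1 Ω)
    (ph : Plane → Plane) : ℝ :=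
  Real.sqrt (2 * Real.sqrt 2 * constC Ω T ΓD ΓN C0K * α.gradSup) *
    l2norm Ω (fun x => uh.grad x - ph x)

end LocalFEM

end

open LocalFEM

/-! Write F = f − π_h f and c = C₀h. Let G be the space of gradients of (limits of) test functions,
and split ∇u − p_h = r + q with r in G and q orthogonal to G. Green's formula for p_h gives (∇u −
p_h, ∇v) = (F, v). Since F is orthogonal to X_h, v may be replaced there by v minus its cell
averages, so ‖r‖ ≤ c‖F‖. Thus r is the correction to ∇u caused by replacing the load f by π_h f. Let
r_h be the projection of r onto a space of test gradients that contains the discrete ones and is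
orthogonal to ∇u − ∇u_h. Put d = ∇u − ∇u_h − r and g = d + r_h; then g = ∇v is the error for the
projected load.

Three facts carry the estimate. (1) Prager–Synge: q is orthogonal to d and q − d = ∇u_h − p_h, so
‖q‖² + ‖d‖² = ‖∇u_h − p_h‖². (2) Duality (`norm_le_of_orthogonal`): as g is orthogonal to the
discrete gradients, ‖v‖ ≤ C(h)‖g‖ ≤ C(h)‖d‖. Here the projection of v onto X_h is tested through a
Raviart–Thomas flux that differs from a discrete gradient by an amount controlled by κ_h, and the
remainder of v costs c. (3) Commutator (`WeightFunction.abs_inner_le`): αv is again a test function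
up to a constant, so (αq, ∇v) = −(q, v∇α), which is at most √2‖∇α‖_∞‖q‖‖v‖.

Since q − g = ∇u_h − r_h − p_h, expanding ‖q − g‖_α² yields ‖g‖_α² ≤ E₁² + E₂². The difference ∇u −
∇u_h − g = r − r_h costs at most 2c‖F‖. This Hilbert space argument is `local_estimate`.

The remaining work supplies its hypotheses. Green's formula (`MemRT.green`) is built from the weak
definitions, triangle by triangle, and reaches H¹ through the approximation that defines traces. The
divergence has a bounded right inverse on X_h (`exists_bounded_isRTFlux`); this makes κ_h finite and
yields the Poincaré inequality by which G is closed. The product rule for αv (`HasWeakGrad.mul`)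
comes from mollification. -/

namespace LocalFEM

/-! ### Barycentric coordinates in the plane -/

/-- The determinant of two vectors in the plane. -/
def cross (u v : Plane) : ℝ := u 0 * v 1 - u 1 * v 0

/-- The barycentric coordinate belonging to the vertex `A` of the triangle `ABC`. -/
noncomputable def bary (A B C x : Plane) : ℝ := cross (B - x) (C - x) / cross (B - A) (C - A)

/-- The gradient of the barycentric coordinate belonging to `A`. -/
noncomputable def gradBary (A B C : Plane) : Plane :=
  (cross (B - A) (C - A))⁻¹ • !₂[B 1 - C 1, C 0 - B 0]

theorem inner_plane (u v : Plane) : inner ℝ u v = u 0 * v 0 + u 1 * v 1 := by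
  simp [PiLp.inner_apply, Fin.sum_univ_two, mul_comm]

theorem cross_rotate (A B C : Plane) : cross (C - B) (A - B) = cross (B - A) (C - A) := by
  simp [cross]; ring

theorem cross_ne_zero_of_affineIndependent {A B C : Plane}
    (h : AffineIndependent ℝ ![A, B, C]) : cross (B - A) (C - A) ≠ 0 := by
  intro h0
  rw [affineIndependent_iff_linearIndependent_vsub ℝ _ (0 : Fin 3)] at h
  have h2 := h.comp (fun i : Fin 2 => (⟨i.succ, Fin.succ_ne_zero i⟩ : {x : Fin 3 // x ≠ 0}))
    (fun i j hij => by simpa [Fin.ext_iff] using hij)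
  have h3 : LinearIndependent ℝ ![B - A, C - A] := by
    convert! h2 using 1
    funext i
    fin_cases i <;> rfl
  rw [LinearIndependent.pair_iff] at h3
  simp only [cross] at h0
  -- When the determinant vanishes, these coefficients annihilate the pair B − A, C − A;
  -- independence then forces both coordinates of C − A to be zero.
  have e1 := h3 ((C - A) 1) (-((B - A) 1)) (by
    ext i; fin_cases i
    · simp at h0 ⊢; linarith
    · simp; ring)
  have e2 := h3 ((C - A) 0) (-((B - A) 0)) (by
    ext i; fin_cases i
    · simp; ring
    · simp at h0 ⊢; linarith)
  have h4 : C - A = 0 := by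
    ext i; fin_cases i
    · simpa using e2.1
    · simpa using e1.1
  have := h3 0 1 (by simp [h4])
  simp at this

theorem cross_ne_zero_of_coe_eq {K : Finset Plane}
    (hind : AffineIndependent ℝ ((↑) : K → Plane)) {A B C : Plane} (hAB : A ≠ B) (hAC : A ≠ C)
    (hBC : B ≠ C) (hK : (K : Set Plane) = {A, B, C}) : cross (B - A) (C - A) ≠ 0 := by
  have hinj : Function.Injective ![A, B, C] := by
    intro i j hij
    fin_cases i <;> fin_cases j <;> simp_all
  have hmem : ∀ i, ![A, B, C] i ∈ K := fun i => by
    rw [← Finset.mem_coe, hK]; fin_cases i <;> simp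
  exact cross_ne_zero_of_affineIndependent (hind.comp_embedding
    (⟨fun i : Fin 3 => (⟨![A, B, C] i, hmem i⟩ : K), fun i j hij => hinj (by
        simpa using congrArg Subtype.val hij)⟩ : Fin 3 ↪ K))

theorem bary_add (A B C : Plane) (h : cross (B - A) (C - A) ≠ 0) (x : Plane) :
    bary A B C x + bary B C A x + bary C A B x = 1 := by
  have h1 : cross (C - B) (A - B) = cross (B - A) (C - A) := cross_rotate A B C
  have h2 : cross (A - C) (B - C) = cross (B - A) (C - A) := by rw [cross_rotate, cross_rotate]
  rw [bary, bary, bary, h1, h2, ← add_div, ← add_div, div_eq_one_iff_eq h]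
  simp [cross]; ring

theorem bary_smul_add (A B C : Plane) (h : cross (B - A) (C - A) ≠ 0) (x : Plane) :
    bary A B C x • A + bary B C A x • B + bary C A B x • C = x := by
  have h1 : cross (C - B) (A - B) = cross (B - A) (C - A) := cross_rotate A B C
  have h2 : cross (A - C) (B - C) = cross (B - A) (C - A) := by rw [cross_rotate, cross_rotate]
  rw [bary, bary, bary, h1, h2]
  ext i
  fin_cases i
  · simp; field_simp; simp [cross]; ring
  · simp; field_simp; simp [cross]; ring

/-- The quadratic terms of the determinant cancel, so this is an exact identity. It yields
differentiability and smoothness, and later the edge normals. -/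
theorem bary_sub (A B C x y : Plane) :
    bary A B C y - bary A B C x = inner ℝ (gradBary A B C) (y - x) := by
  rw [inner_plane, gradBary, bary, bary]
  simp [cross, div_eq_mul_inv]; ring

theorem bary_combo (A B C : Plane) (x y z : Plane) (a b c : ℝ) (h : a + b + c = 1) :
    bary A B C (a • x + b • y + c • z) =
      a * bary A B C x + b * bary A B C y + c * bary A B C z := by
  obtain rfl : c = 1 - a - b := by linarith
  simp [cross, bary, div_eq_mul_inv]; ring

theorem bary_self (A B C : Plane) (h : cross (B - A) (C - A) ≠ 0) : bary A B C A = 1 :=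
  div_self h

@[simp] theorem bary_left (A B C : Plane) : bary A B C B = 0 := by simp [bary, cross]

@[simp] theorem bary_right (A B C : Plane) : bary A B C C = 0 := by simp [bary, cross]

theorem hasFDerivAt_bary (A B C x : Plane) :
    HasFDerivAt (bary A B C) (innerSL ℝ (gradBary A B C)) x := by
  have : bary A B C = fun y => bary A B C x + innerSL ℝ (gradBary A B C) (y - x) := by
    ext y; rw [innerSL_apply_apply, ← bary_sub]; ring
  rw [this]
  exact (((innerSL ℝ (gradBary A B C)).hasFDerivAt).comp x
    ((hasFDerivAt_id x).sub_const x)).const_add _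

theorem contDiff_bary (A B C : Plane) {n : WithTop ℕ∞} : ContDiff ℝ n (bary A B C) := by
  have : bary A B C = fun y => bary A B C 0 + innerSL ℝ (gradBary A B C) (y - 0) := by
    ext y; rw [innerSL_apply_apply, ← bary_sub]; ring
  rw [this]
  exact contDiff_const.add ((innerSL ℝ (gradBary A B C)).contDiff.comp
    (contDiff_id.sub contDiff_const))

theorem continuous_bary (A B C : Plane) : Continuous (bary A B C) :=
  (contDiff_bary A B C (n := 0)).continuous

theorem mem_convexHull_triangle {A B C : Plane} (h : cross (B - A) (C - A) ≠ 0) {x : Plane} :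
    x ∈ convexHull ℝ ({A, B, C} : Set Plane) ↔
      0 ≤ bary A B C x ∧ 0 ≤ bary B C A x ∧ 0 ≤ bary C A B x := by
  have hB : cross (C - B) (A - B) ≠ 0 := by rwa [cross_rotate]
  have hC : cross (A - C) (B - C) ≠ 0 := by rwa [cross_rotate]
  constructor
  · intro hx
    rw [convexHull_insert ⟨B, by simp⟩, convexHull_pair] at hx
    rw [mem_convexJoin] at hx
    obtain ⟨a, ha, b, hb, hx⟩ := hx
    rw [Set.mem_singleton_iff] at ha
    subst ha
    obtain ⟨p, q, hp, hq, hpq, rfl⟩ := hb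
    obtain ⟨r, s, hr, hs, hrs, rfl⟩ := hx
    have e : r • a + s • (p • B + q • C) = r • a + (s * p) • B + (s * q) • C := by
      module
    have hsum : r + s * p + s * q = 1 := by rw [add_assoc, ← mul_add, hpq]; linarith
    rw [e, bary_combo _ _ _ _ _ _ _ _ _ hsum, bary_combo _ _ _ _ _ _ _ _ _ hsum,
      bary_combo _ _ _ _ _ _ _ _ _ hsum, bary_self _ _ _ h, bary_self _ _ _ hB,
      bary_self _ _ _ hC]
    simp
    exact ⟨hr, by positivity, by positivity⟩
  · rintro ⟨h1, h2, h3⟩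
    rw [← bary_smul_add A B C h x]
    have hs := bary_add A B C h x
    have hc := convex_convexHull ℝ ({A, B, C} : Set Plane)
    have := hc.sum_mem (t := Finset.univ) (w := ![bary A B C x, bary B C A x, bary C A B x])
      (z := ![A, B, C]) (by intro i _; fin_cases i <;> simpa) (by simp [Fin.sum_univ_three, hs])
      (by intro i _; apply subset_convexHull; fin_cases i <;> simp)
    simpa [Fin.sum_univ_three] using this

theorem mem_interior_triangle {A B C : Plane} (h : cross (B - A) (C - A) ≠ 0) {x : Plane} :
    x ∈ interior (convexHull ℝ ({A, B, C} : Set Plane)) ↔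
      0 < bary A B C x ∧ 0 < bary B C A x ∧ 0 < bary C A B x := by
  have hB : cross (C - B) (A - B) ≠ 0 := by rwa [cross_rotate]
  have hC : cross (A - C) (B - C) ≠ 0 := by rwa [cross_rotate]
  have key : ∀ A' B' C' : Plane, cross (B' - A') (C' - A') ≠ 0 →
      (∀ y ∈ convexHull ℝ ({A, B, C} : Set Plane), 0 ≤ bary A' B' C' y) →
      x ∈ interior (convexHull ℝ ({A, B, C} : Set Plane)) → 0 < bary A' B' C' x := by
    intro A' B' C' h' hy hx
    by_contra hneg
    have hx0 : bary A' B' C' x = 0 := le_antisymm (not_lt.mp hneg) (hy x (interior_subset hx))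
    have hnhds := mem_interior_iff_mem_nhds.mp hx
    -- Moving away from A' parallel to the side A'B' lowers the coordinate at unit rate. A zero at
    -- an interior point would therefore turn negative inside the triangle.
    have hcont : Tendsto (fun t : ℝ => x - t • (A' - B')) (𝓝[>] 0) (𝓝 x) := by
      have : Continuous (fun t : ℝ => x - t • (A' - B')) := by fun_prop
      have := this.tendsto 0
      simp only [zero_smul, sub_zero] at this
      exact this.mono_left nhdsWithin_le_nhds
    obtain ⟨t, ht, ht0⟩ := ((hcont.eventually hnhds).and self_mem_nhdsWithin).exists
    have e := hy _ ht
    have e1 : bary A' B' C' (x - t • (A' - B')) = - t := by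
      have : x - t • (A' - B') = (1 : ℝ) • x + (-t) • A' + t • B' := by module
      rw [this, bary_combo _ _ _ _ _ _ _ _ _ (by ring), hx0, bary_self _ _ _ h']
      simp
    rw [e1] at e
    have : (0:ℝ) < t := ht0
    linarith
  constructor
  · intro hx
    exact ⟨key A B C h (fun y hy => ((mem_convexHull_triangle h).1 hy).1) hx,
      key B C A hB (fun y hy => ((mem_convexHull_triangle h).1 hy).2.1) hx,
      key C A B hC (fun y hy => ((mem_convexHull_triangle h).1 hy).2.2) hx⟩
  · intro hx
    rw [mem_interior]
    refine ⟨{y | 0 < bary A B C y ∧ 0 < bary B C A y ∧ 0 < bary C A B y}, ?_, ?_, hx⟩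
    · intro y hy
      exact (mem_convexHull_triangle h).2 ⟨hy.1.le, hy.2.1.le, hy.2.2.le⟩
    · exact (isOpen_lt continuous_const (continuous_bary _ _ _)).inter
        ((isOpen_lt continuous_const (continuous_bary _ _ _)).inter
          (isOpen_lt continuous_const (continuous_bary _ _ _)))

/-! ### Affine coordinates -/

/-- The linear isomorphism of `ℝ × ℝ` with the plane. -/
noncomputable def planeEquiv : ℝ × ℝ ≃ᵐ Plane :=
  (MeasurableEquiv.finTwoArrow (α := ℝ)).symm.trans (MeasurableEquiv.toLp 2 (Fin 2 → ℝ))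

theorem planeEquiv_apply (z : ℝ × ℝ) : planeEquiv z = !₂[z.1, z.2] := rfl

theorem measurePreserving_planeEquiv : MeasurePreserving planeEquiv volume volume :=
  (volume_preserving_finTwoArrow ℝ).symm.trans (PiLp.volume_preserving_toLp (Fin 2))

/-- The linear map of the plane taking the unit vectors to `u` and `w`. -/
noncomputable def frameMap (u w : Plane) : Plane →ₗ[ℝ] Plane :=
  Matrix.toLin (PiLp.basisFun 2 ℝ (Fin 2)) (PiLp.basisFun 2 ℝ (Fin 2)) !![u 0, w 0; u 1, w 1]

theorem frameMap_apply (u w : Plane) (s t : ℝ) : frameMap u w !₂[s, t] = s • u + t • w := by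
  ext i
  fin_cases i <;>
  simp [frameMap, Matrix.toLin_apply, Matrix.mulVec, dotProduct, Fin.sum_univ_two, mul_comm]

theorem det_frameMap (u w : Plane) : LinearMap.det (frameMap u w) = cross u w := by
  rw [frameMap, LinearMap.det_toLin, Matrix.det_fin_two_of, cross]; ring

/-- A translation followed by a linear substitution with determinant `cross u w`. Both are
measurable embeddings, so no integrability of `H` is required. -/
theorem integral_frame (P u w : Plane) (h : cross u w ≠ 0) (H : Plane → ℝ) :
    ∫ x, H x = |cross u w| * ∫ z : ℝ × ℝ, H (P + z.1 • u + z.2 • w) := by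
  have h1 : ∫ x, H x = ∫ x, H (P + x) := (integral_add_left_eq_self H P).symm
  have hdet : LinearMap.det (frameMap u w) ≠ 0 := by rwa [det_frameMap]
  have h2 : ∫ x, H (P + x) = |cross u w| * ∫ x, H (P + frameMap u w x) := by
    set e := (LinearEquiv.ofIsUnitDet (f := frameMap u w) (v := PiLp.basisFun 2 ℝ (Fin 2))
      (v' := PiLp.basisFun 2 ℝ (Fin 2)) (by
        rw [LinearMap.det_toMatrix]; exact hdet.isUnit))
    have hm := Measure.map_linearMap_addHaar_eq_smul_addHaar (volume : Measure Plane) hdet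
    have he : MeasurableEmbedding (frameMap u w) :=
      e.toContinuousLinearEquiv.toHomeomorph.measurableEmbedding
    have := he.integral_map (μ := volume) (fun x => H (P + x))
    rw [hm, integral_smul_measure, det_frameMap] at this
    rw [← this, ENNReal.toReal_ofReal (abs_nonneg _), smul_eq_mul, abs_inv, ← mul_assoc,
      mul_inv_cancel₀ (abs_ne_zero.mpr h), one_mul]
  rw [h1, h2, ← measurePreserving_planeEquiv.integral_comp planeEquiv.measurableEmbedding]
  simp_rw [planeEquiv_apply, frameMap_apply, add_assoc]


/-! ### Test functions -/

theorem IsTestFunction.continuous {U : Set Plane} {φ : Plane → ℝ} (h : IsTestFunction U φ) :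
    Continuous φ := h.1.continuous

theorem IsTestFunction.differentiable {U : Set Plane} {φ : Plane → ℝ} (h : IsTestFunction U φ) :
    Differentiable ℝ φ := h.1.differentiable (by simp)

theorem IsTestFunction.continuous_fderiv {U : Set Plane} {φ : Plane → ℝ}
    (h : IsTestFunction U φ) : Continuous (fderiv ℝ φ) := h.1.continuous_fderiv (by simp)

theorem IsTestFunction.mul_contDiff {U : Set Plane} {φ g : Plane → ℝ} (h : IsTestFunction U φ)
    (hg : ContDiff ℝ ((⊤ : ℕ∞) : WithTop ℕ∞) g) : IsTestFunction U (fun x => φ x * g x) :=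
  ⟨h.1.mul hg, h.2.1.mul_right, (tsupport_mul_subset_left).trans h.2.2⟩

theorem IsTestFunction.mono {U V : Set Plane} {φ : Plane → ℝ} (h : IsTestFunction U φ)
    (hUV : U ⊆ V) : IsTestFunction V φ := ⟨h.1, h.2.1, h.2.2.trans hUV⟩

theorem IsTestFunction.eq_zero {U : Set Plane} {φ : Plane → ℝ} (h : IsTestFunction U φ)
    {x : Plane} (hx : x ∉ U) : φ x = 0 :=
  image_eq_zero_of_notMem_tsupport (fun h' => hx (h.2.2 h'))

theorem IsTestFunction.fderiv_eq_zero {U : Set Plane} {φ : Plane → ℝ} (h : IsTestFunction U φ)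
    {x : Plane} (hx : x ∉ U) : fderiv ℝ φ x = 0 :=
  image_eq_zero_of_notMem_tsupport (fun h' => hx (h.2.2 (tsupport_fderiv_subset ℝ h')))

theorem integrable_mul_of_compactSupport {μ : Measure Plane} {v ψ : Plane → ℝ}
    (hv : Integrable v μ) (hψ : Continuous ψ) (hc : HasCompactSupport ψ) :
    Integrable (fun x => v x * ψ x) μ := by
  obtain ⟨M, hM⟩ := hψ.bounded_above_of_compact_support hc
  exact hv.mul_bdd hψ.aestronglyMeasurable (Eventually.of_forall hM)

theorem clm_apply_plane (L : Plane →L[ℝ] ℝ) (p : Plane) :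
    L p = p 0 * L (EuclideanSpace.single 0 1) + p 1 * L (EuclideanSpace.single 1 1) := by
  conv_lhs => rw [show p = p 0 • EuclideanSpace.single 0 (1 : ℝ) +
    p 1 • EuclideanSpace.single 1 (1 : ℝ) by ext i; fin_cases i <;> simp]
  simp

theorem hasFDerivAt_coord (i : Fin 2) (x : Plane) :
    HasFDerivAt (fun y : Plane => y i) (EuclideanSpace.proj i : Plane →L[ℝ] ℝ) x :=
  (EuclideanSpace.proj i : Plane →L[ℝ] ℝ).hasFDerivAt

/-- Integration by parts against a test function times an affine field `a + c x`. -/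
theorem HasWeakGrad.integral_affine {U : Set Plane} {v : Plane → ℝ} {G : Plane → Plane}
    (hw : HasWeakGrad U v G) (hv : IntegrableOn v U) (hG : IntegrableOn G U) {ψ : Plane → ℝ}
    (hψ : IsTestFunction U ψ) (a : Plane) (c : ℝ) :
    ∫ x in U, v x * (fderiv ℝ ψ x (a + c • x) + 2 * c * ψ x) =
      - ∫ x in U, inner ℝ (G x) (a + c • x) * ψ x := by
  -- The weak gradient is tested by scalar functions in fixed directions, so the j-th component of
  -- ψ(a + cx) is used in direction e_j. Each coordinate contributes cψ, which adds up to 2cψ.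
  have htest : ∀ j : Fin 2, IsTestFunction U (fun x => ψ x * (a j + c * x j)) := fun j =>
    hψ.mul_contDiff (contDiff_const.add (contDiff_const.mul
      (EuclideanSpace.proj j : Plane →L[ℝ] ℝ).contDiff))
  have hder : ∀ j : Fin 2, ∀ x : Plane,
      fderiv ℝ (fun x => ψ x * (a j + c * x j)) x (EuclideanSpace.single j 1) =
        fderiv ℝ ψ x (EuclideanSpace.single j 1) * (a j + c * x j) + c * ψ x := by
    intro j x
    have h1 := (hψ.differentiable x).hasFDerivAt.mul
      (((hasFDerivAt_coord j x).const_mul c).const_add (a j))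
    have h2 : fderiv ℝ (fun x => ψ x * (a j + c * x j)) x = _ := h1.fderiv
    rw [h2]
    simp; ring
  have hint1 : ∀ j : Fin 2, Integrable (fun x => v x *
      fderiv ℝ (fun x => ψ x * (a j + c * x j)) x (EuclideanSpace.single j 1))
      (volume.restrict U) := by
    intro j
    refine integrable_mul_of_compactSupport hv ?_ ?_
    · exact (htest j).continuous_fderiv.clm_apply continuous_const
    · exact (htest j).2.1.fderiv_apply ℝ _
  have hint2 : ∀ j : Fin 2, Integrable (fun x => inner ℝ (G x) (EuclideanSpace.single j (1 : ℝ)) *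
      (ψ x * (a j + c * x j))) (volume.restrict U) := by
    intro j
    refine integrable_mul_of_compactSupport ?_ (htest j).continuous (htest j).2.1
    exact hG.inner_const _
  have e1 : ∀ x, v x * (fderiv ℝ ψ x (a + c • x) + 2 * c * ψ x) =
      v x * fderiv ℝ (fun x => ψ x * (a 0 + c * x 0)) x (EuclideanSpace.single 0 1) +
      v x * fderiv ℝ (fun x => ψ x * (a 1 + c * x 1)) x (EuclideanSpace.single 1 1) := by
    intro x
    rw [hder, hder, clm_apply_plane]
    simp; ring
  have e2 : ∀ x, inner ℝ (G x) (a + c • x) * ψ x =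
      inner ℝ (G x) (EuclideanSpace.single 0 (1 : ℝ)) * (ψ x * (a 0 + c * x 0)) +
      inner ℝ (G x) (EuclideanSpace.single 1 (1 : ℝ)) * (ψ x * (a 1 + c * x 1)) := by
    intro x
    rw [inner_plane, inner_plane, inner_plane]
    simp; ring
  simp_rw [e1, e2]
  rw [integral_add (hint1 0) (hint1 1), integral_add (hint2 0) (hint2 1), hw _ (htest 0),
    hw _ (htest 1)]
  ring

/-! ### Cut-off functions on a triangle -/

theorem deriv_smoothTransition_eq_zero {r : ℝ} (hr : r ∉ Set.Icc (0 : ℝ) 1) :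
    deriv Real.smoothTransition r = 0 := by
  rw [Set.mem_Icc, not_and_or, not_le, not_le] at hr
  rcases hr with hr | hr
  · have : Real.smoothTransition =ᶠ[𝓝 r] fun _ => 0 := by
      filter_upwards [Iio_mem_nhds hr] with y hy
      exact Real.smoothTransition.zero_of_nonpos (le_of_lt hy)
    rw [this.deriv_eq, deriv_const]
  · have : Real.smoothTransition =ᶠ[𝓝 r] fun _ => 1 := by
      filter_upwards [Ioi_mem_nhds hr] with y hy
      exact Real.smoothTransition.one_of_one_le (le_of_lt hy)
    rw [this.deriv_eq, deriv_const]

theorem continuous_deriv_smoothTransition : Continuous (deriv Real.smoothTransition) :=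
  (Real.smoothTransition.contDiff (n := 1)).continuous_deriv le_rfl

theorem integral_deriv_smoothTransition :
    ∫ r in Set.Icc (0 : ℝ) 1, deriv Real.smoothTransition r = 1 := by
  rw [integral_Icc_eq_integral_Ioc, ← intervalIntegral.integral_of_le zero_le_one,
    intervalIntegral.integral_deriv_eq_sub]
  · simp [Real.smoothTransition.one, Real.smoothTransition.zero]
  · exact fun x _ => (Real.smoothTransition.contDiff (n := 1)).differentiable (by simp) x
  · exact continuous_deriv_smoothTransition.intervalIntegrable _ _

theorem isCompact_triangle (A B C : Plane) :
    IsCompact (convexHull ℝ ({A, B, C} : Set Plane)) :=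
  (Set.toFinite _).isCompact_convexHull ℝ

/-- The differentiated factor lives in a strip of width of order 1/n along BC and has mass one
across it. The other two factors only cut off the ends of the strip, so the limit is a line integral
along BC, weighted by the area element of the triangle. -/
theorem tendsto_integral_strip {A B C : Plane} (h : cross (B - A) (C - A) ≠ 0) {F : Plane → ℝ}
    (hF : ContinuousOn F (convexHull ℝ ({A, B, C} : Set Plane))) :
    Tendsto (fun n : ℕ => ∫ x in interior (convexHull ℝ ({A, B, C} : Set Plane)),
      F x * (n * deriv Real.smoothTransition (n * bary A B C x - 1) *
        Real.smoothTransition (n * bary B C A x - 1) *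
        Real.smoothTransition (n * bary C A B x - 1))) atTop
      (𝓝 (|cross (B - A) (C - A)| * ∫ t in Set.Ioo (0 : ℝ) 1, F (B + t • (C - B)))) := by
  set T := interior (convexHull ℝ ({A, B, C} : Set Plane)) with hT
  have hTo : IsOpen T := isOpen_interior
  have hB : cross (C - B) (A - B) ≠ 0 := by rwa [cross_rotate]
  have hC : cross (A - C) (B - C) ≠ 0 := by rwa [cross_rotate]
  have hcr : cross (A - B) (C - B) = - cross (B - A) (C - A) := by
    simp [cross]; ring
  -- In these coordinates z.1 is n times the coordinate of A, minus 1, and z.2 is the coordinate of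
  -- C. The strip where that coordinate of A is between 1/n and 2/n becomes 0 ≤ z.1 ≤ 1, and the
  -- Jacobian 1/n cancels the factor n.
  let X : ℕ → ℝ × ℝ → Plane := fun n z =>
    (B + (n : ℝ)⁻¹ • (A - B)) + z.1 • ((n : ℝ)⁻¹ • (A - B)) + z.2 • (C - B)
  have hX : ∀ n z, X n z = ((z.1 + 1) / n) • A + (1 - (z.1 + 1) / n - z.2) • B + z.2 • C := by
    intro n z
    simp only [X, div_eq_mul_inv]; module
  have bA : ∀ n z, bary A B C (X n z) = (z.1 + 1) / n := by
    intro n z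
    rw [hX, bary_combo _ _ _ _ _ _ _ _ _ (by ring), bary_self _ _ _ h]; simp
  have bB : ∀ n z, bary B C A (X n z) = 1 - (z.1 + 1) / n - z.2 := by
    intro n z
    rw [hX, bary_combo _ _ _ _ _ _ _ _ _ (by ring), bary_self _ _ _ hB]; simp
  have bC : ∀ n z, bary C A B (X n z) = z.2 := by
    intro n z
    rw [hX, bary_combo _ _ _ _ _ _ _ _ _ (by ring), bary_self _ _ _ hC]; simp
  have hmem : ∀ n z, X n z ∈ T ↔ 0 < (z.1 + 1) / n ∧ 0 < 1 - (z.1 + 1) / n - z.2 ∧ 0 < z.2 := by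
    intro n z
    rw [hT, mem_interior_triangle h, bA, bB, bC]
  obtain ⟨M, hM⟩ := (isCompact_triangle A B C).exists_bound_of_continuousOn hF
  obtain ⟨M', hM'⟩ := (isCompact_Icc (a := (0:ℝ)) (b := 1)).exists_bound_of_continuousOn
    continuous_deriv_smoothTransition.continuousOn
  classical
  let F' : Plane → ℝ := T.indicator F
  have hF' : Measurable F' := by
    have := (hF.mono interior_subset).measurable_piecewise
      (g := fun _ => (0 : ℝ)) continuousOn_const hTo.measurableSet
    convert! this using 1
  let Φ : ℕ → ℝ × ℝ → ℝ := fun n z => F' (X n z) * (deriv Real.smoothTransition z.1 *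
    Real.smoothTransition (n * (1 - (z.1 + 1) / n - z.2) - 1) *
    Real.smoothTransition (n * z.2 - 1))
  let Φ' : ℝ × ℝ → ℝ := (Set.Icc (0 : ℝ) 1 ×ˢ Set.Ioo (0 : ℝ) 1).indicator
    (fun z => deriv Real.smoothTransition z.1 * F (B + z.2 • (C - B)))
  have hM0 : 0 ≤ M := (norm_nonneg _).trans
    (hM A (subset_convexHull ℝ _ (by simp)))
  have hM0' : 0 ≤ M' := (norm_nonneg _).trans (hM' 0 (by simp))
  have hst : ∀ y, ‖Real.smoothTransition y‖ ≤ 1 := fun y => by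
    rw [Real.norm_eq_abs, abs_of_nonneg (Real.smoothTransition.nonneg y)]
    exact Real.smoothTransition.le_one y
  have hlim : Tendsto (fun n => ∫ z, Φ n z) atTop (𝓝 (∫ z, Φ' z)) := by
    refine tendsto_integral_of_dominated_convergence
      ((Set.Icc (0 : ℝ) 1 ×ˢ Set.Icc (0 : ℝ) 1).indicator (fun _ => M * M')) ?_ ?_ ?_ ?_
    · intro n
      have : Measurable (Φ n) := by
        have hXm : Measurable (X n) := by
          have : Continuous (X n) := by fun_prop
          exact this.measurable
        have h1 := continuous_deriv_smoothTransition.measurable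
        have h2 := Real.smoothTransition.continuous.measurable
        refine (hF'.comp hXm).mul (((h1.comp measurable_fst).mul (h2.comp ?_)).mul (h2.comp ?_))
        · fun_prop
        · fun_prop
      exact this.aestronglyMeasurable
    · rw [integrable_indicator_iff (measurableSet_Icc.prod measurableSet_Icc)]
      refine integrableOn_const ?_
      exact (isCompact_Icc.prod isCompact_Icc).measure_lt_top.ne
    · intro n
      refine Eventually.of_forall fun z => ?_
      by_cases hz1 : z.1 ∈ Set.Icc (0 : ℝ) 1
      · by_cases hXT : X n z ∈ T
        · have h' := (hmem n z).1 hXT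
          have hz : z ∈ Set.Icc (0 : ℝ) 1 ×ˢ Set.Icc (0 : ℝ) 1 :=
            ⟨hz1, h'.2.2.le, by linarith [h'.1, h'.2.1]⟩
          rw [Set.indicator_of_mem hz]
          simp only [Φ, F', Set.indicator_of_mem hXT, norm_mul]
          refine mul_le_mul (hM _ (interior_subset hXT)) ?_ (by positivity) hM0
          calc _ ≤ M' * 1 * 1 := by
                gcongr
                · exact hM' _ hz1
                · exact hst _
                · exact hst _
            _ = M' := by ring
        · simp only [Φ, F', Set.indicator_of_notMem hXT, zero_mul, norm_zero]
          exact Set.indicator_nonneg (fun _ _ => mul_nonneg hM0 hM0') _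
      · simp only [Φ, deriv_smoothTransition_eq_zero hz1, zero_mul, mul_zero, norm_zero]
        exact Set.indicator_nonneg (fun _ _ => mul_nonneg hM0 hM0') _
    · refine Eventually.of_forall fun z => ?_
      by_cases hz1 : z.1 ∈ Set.Icc (0 : ℝ) 1
      · have hdiv : Tendsto (fun n : ℕ => (z.1 + 1) / (n : ℝ)) atTop (𝓝 0) :=
          tendsto_const_div_atTop_nhds_zero_nat _
        by_cases hz2 : z.2 ∈ Set.Ioo (0 : ℝ) 1
        · have hz : z ∈ Set.Icc (0 : ℝ) 1 ×ˢ Set.Ioo (0 : ℝ) 1 := ⟨hz1, hz2⟩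
          simp only [Φ', Set.indicator_of_mem hz]
          have hXlim : Tendsto (fun n => X n z) atTop (𝓝 (B + z.2 • (C - B))) := by
            have e : B + z.2 • (C - B) = (0 : ℝ) • A + (1 - 0 - z.2) • B + z.2 • C := by module
            simp_rw [hX, e]
            exact ((hdiv.smul_const A).add (((tendsto_const_nhds.sub hdiv).sub
              tendsto_const_nhds).smul_const B)).add tendsto_const_nhds
          -- The thresholds make the arguments of both end cut-offs at least 1: n(1 − (z.1 + 1)/n −
          -- z.2) exceeds half of n(1 − z.2), which is at least 4.
          have hev1 : ∀ᶠ n : ℕ in atTop, (z.1 + 1) / (n : ℝ) < (1 - z.2) / 2 :=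
            hdiv.eventually_lt_const (by linarith [hz2.2])
          have hev2 : ∀ᶠ n : ℕ in atTop, 2 ≤ (n : ℝ) * z.2 :=
            (tendsto_natCast_atTop_atTop.atTop_mul_const hz2.1).eventually_ge_atTop 2
          have hev3 : ∀ᶠ n : ℕ in atTop, 4 ≤ (n : ℝ) * (1 - z.2) :=
            (tendsto_natCast_atTop_atTop.atTop_mul_const
              (by linarith [hz2.2])).eventually_ge_atTop 4
          have hXT : ∀ᶠ n : ℕ in atTop, X n z ∈ T := by
            filter_upwards [hev1, eventually_gt_atTop 0] with n hn hn0
            have hn0' : (0:ℝ) < n := by exact_mod_cast hn0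
            rw [hmem]
            exact ⟨div_pos (by linarith [hz1.1]) hn0', by linarith [hz2.2], hz2.1⟩
          have hmemS : B + z.2 • (C - B) ∈ convexHull ℝ ({A, B, C} : Set Plane) := by
            have e : B + z.2 • (C - B) = (0 : ℝ) • A + (1 - z.2) • B + z.2 • C := by module
            rw [mem_convexHull_triangle h, e, bary_combo _ _ _ _ _ _ _ _ _ (by ring),
              bary_combo _ _ _ _ _ _ _ _ _ (by ring), bary_combo _ _ _ _ _ _ _ _ _ (by ring),
              bary_self _ _ _ hB, bary_self _ _ _ hC]
            simp [hz2.2.le, hz2.1.le]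
          have hFlim : Tendsto (fun n => F (X n z)) atTop (𝓝 (F (B + z.2 • (C - B)))) := by
            refine (hF _ hmemS).tendsto.comp (tendsto_nhdsWithin_iff.2 ⟨hXlim, ?_⟩)
            filter_upwards [hXT] with n hn using interior_subset hn
          have : Tendsto (fun n => F (X n z) * deriv Real.smoothTransition z.1) atTop
              (𝓝 (deriv Real.smoothTransition z.1 * F (B + z.2 • (C - B)))) := by
            rw [mul_comm]; exact hFlim.mul_const _
          refine this.congr' ?_
          filter_upwards [hXT, hev1, hev2, hev3, eventually_gt_atTop 0] with n h1 h2 h3 h4 hn0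
          have hn0' : (0:ℝ) < n := by exact_mod_cast hn0
          simp only [Φ, F', Set.indicator_of_mem h1]
          rw [Real.smoothTransition.one_of_one_le (x := n * z.2 - 1) (by linarith),
            Real.smoothTransition.one_of_one_le (by nlinarith)]
          ring
        · have hz : z ∉ Set.Icc (0 : ℝ) 1 ×ˢ Set.Ioo (0 : ℝ) 1 := fun hz => hz2 hz.2
          simp only [Φ', Set.indicator_of_notMem hz]
          refine tendsto_const_nhds.congr' ?_
          filter_upwards with n
          have hXT : X n z ∉ T := by
            rw [hmem]
            rintro ⟨h1, h2, h3⟩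
            exact hz2 ⟨h3, by linarith⟩
          simp only [Φ, F', Set.indicator_of_notMem hXT, zero_mul]
      · have hz : z ∉ Set.Icc (0 : ℝ) 1 ×ˢ Set.Ioo (0 : ℝ) 1 := fun hz => hz1 hz.1
        simp only [Φ', Φ, deriv_smoothTransition_eq_zero hz1, Set.indicator_of_notMem hz, zero_mul,
          mul_zero]
        exact tendsto_const_nhds
  have hval : ∫ z, Φ' z = ∫ t in Set.Ioo (0 : ℝ) 1, F (B + t • (C - B)) := by
    rw [integral_indicator (measurableSet_Icc.prod measurableSet_Ioo), Measure.volume_eq_prod,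
      setIntegral_prod_mul (deriv Real.smoothTransition) (fun t => F (B + t • (C - B))),
      integral_deriv_smoothTransition, one_mul]
  rw [← hval]
  refine (hlim.const_mul _).congr' ?_
  filter_upwards [eventually_gt_atTop 0] with n hn0
  have hn0' : (0:ℝ) < n := by exact_mod_cast hn0
  have hcr' : cross ((n : ℝ)⁻¹ • (A - B)) (C - B) = - (cross (B - A) (C - A) / n) := by
    rw [neg_div', ← hcr]
    simp [cross]; ring
  rw [← integral_indicator hTo.measurableSet,
    integral_frame (B + (n : ℝ)⁻¹ • (A - B)) ((n : ℝ)⁻¹ • (A - B)) (C - B)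
      (by rw [hcr']; exact neg_ne_zero.2 (div_ne_zero h hn0'.ne')), hcr', abs_neg, abs_div,
      abs_of_pos hn0', div_mul_eq_mul_div, mul_div_assoc, ← integral_div]
  congr 2
  ext z
  change F' (X n z) * _ = (T.indicator _ (X n z)) / n
  by_cases hXT : X n z ∈ T
  · simp only [F', Set.indicator_of_mem hXT, bA, bB, bC]
    rw [show (n : ℝ) * ((z.1 + 1) / n) - 1 = z.1 by field_simp; ring]
    field_simp
  · simp only [F', Set.indicator_of_notMem hXT, zero_mul, zero_div]


/-! ### Green's formula on a triangle -/

/-- Smooth cut-off functions exhausting the open triangle `ABC`. -/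
noncomputable def triCut (A B C : Plane) (n : ℕ) (x : Plane) : ℝ :=
  Real.smoothTransition (n * bary A B C x - 1) * Real.smoothTransition (n * bary B C A x - 1) *
    Real.smoothTransition (n * bary C A B x - 1)

theorem abs_triCut_le_one (A B C : Plane) (n : ℕ) (x : Plane) : ‖triCut A B C n x‖ ≤ 1 := by
  have h0 := Real.smoothTransition.nonneg
  have h1 := Real.smoothTransition.le_one
  rw [triCut, Real.norm_eq_abs, abs_of_nonneg (mul_nonneg (mul_nonneg (h0 _) (h0 _)) (h0 _))]
  exact mul_le_one₀ (mul_le_one₀ (h1 _) (h0 _) (h1 _)) (h0 _) (h1 _)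

/-- A factor can be nonzero only where its coordinate is at least 1/n, which confines the support to
a compact subset of the open triangle. -/
theorem isTestFunction_triCut {A B C : Plane} (h : cross (B - A) (C - A) ≠ 0) {n : ℕ}
    (hn : 0 < n) :
    IsTestFunction (interior (convexHull ℝ ({A, B, C} : Set Plane))) (triCut A B C n) := by
  have hn' : (0 : ℝ) < n := by exact_mod_cast hn
  have hsupp : tsupport (triCut A B C n) ⊆
      {x | (n : ℝ)⁻¹ ≤ bary A B C x} ∩ {x | (n : ℝ)⁻¹ ≤ bary B C A x} ∩
        {x | (n : ℝ)⁻¹ ≤ bary C A B x} := by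
    refine closure_minimal ?_ (((isClosed_le continuous_const (continuous_bary _ _ _)).inter
      (isClosed_le continuous_const (continuous_bary _ _ _))).inter
      (isClosed_le continuous_const (continuous_bary _ _ _)))
    intro x hx
    rw [Function.mem_support, triCut, mul_ne_zero_iff, mul_ne_zero_iff] at hx
    have key : ∀ r : ℝ, Real.smoothTransition (n * r - 1) ≠ 0 → (n : ℝ)⁻¹ ≤ r := by
      intro r hr
      by_contra hlt
      rw [not_le] at hlt
      refine hr (Real.smoothTransition.zero_of_nonpos ?_)
      have := mul_lt_mul_of_pos_left hlt hn'
      rw [mul_inv_cancel₀ hn'.ne'] at this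
      linarith
    exact ⟨⟨key _ hx.1.1, key _ hx.1.2⟩, key _ hx.2⟩
  have hsub : tsupport (triCut A B C n) ⊆ interior (convexHull ℝ ({A, B, C} : Set Plane)) := by
    intro x hx
    have hpos : 0 < (n : ℝ)⁻¹ := by positivity
    have := hsupp hx
    exact (mem_interior_triangle h).2 ⟨hpos.trans_le this.1.1, hpos.trans_le this.1.2,
      hpos.trans_le this.2⟩
  refine ⟨?_, ?_, hsub⟩
  · have hs : ∀ A B C : Plane, ContDiff ℝ ((⊤ : ℕ∞) : WithTop ℕ∞)
        (fun x => Real.smoothTransition (n * bary A B C x - 1)) := fun A B C =>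
      Real.smoothTransition.contDiff.comp
        ((contDiff_const.mul (contDiff_bary A B C)).sub contDiff_const)
    exact ((hs A B C).mul (hs B C A)).mul (hs C A B)
  · exact (isCompact_triangle A B C).of_isClosed_subset (isClosed_tsupport _)
      (hsub.trans interior_subset)

theorem fderiv_triCut (A B C : Plane) (n : ℕ) (x p : Plane) :
    fderiv ℝ (triCut A B C n) x p =
      inner ℝ (gradBary A B C) p * (n * deriv Real.smoothTransition (n * bary A B C x - 1) *
        Real.smoothTransition (n * bary B C A x - 1) *
        Real.smoothTransition (n * bary C A B x - 1)) +
      inner ℝ (gradBary B C A) p * (n * deriv Real.smoothTransition (n * bary B C A x - 1) *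
        Real.smoothTransition (n * bary C A B x - 1) *
        Real.smoothTransition (n * bary A B C x - 1)) +
      inner ℝ (gradBary C A B) p * (n * deriv Real.smoothTransition (n * bary C A B x - 1) *
        Real.smoothTransition (n * bary A B C x - 1) *
        Real.smoothTransition (n * bary B C A x - 1)) := by
  have hs : ∀ A B C : Plane, HasFDerivAt (fun x => Real.smoothTransition (n * bary A B C x - 1))
      (deriv Real.smoothTransition (n * bary A B C x - 1) •
        ((n : ℝ) • innerSL ℝ (gradBary A B C))) x := fun A B C => by
    have h1 : DifferentiableAt ℝ Real.smoothTransition (n * bary A B C x - 1) :=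
      (Real.smoothTransition.contDiff (n := 1)).differentiable (by simp) _
    exact h1.hasDerivAt.comp_hasFDerivAt x (((hasFDerivAt_bary A B C x).const_mul (n : ℝ)).sub_const 1)
  have h := ((hs A B C).mul (hs B C A)).mul (hs C A B)
  have h' : fderiv ℝ (triCut A B C n) x = _ := h.fderiv
  rw [h']
  simp
  ring

theorem tendsto_triCut {A B C : Plane} (h : cross (B - A) (C - A) ≠ 0) {x : Plane}
    (hx : x ∈ interior (convexHull ℝ ({A, B, C} : Set Plane))) :
    Tendsto (fun n => triCut A B C n x) atTop (𝓝 1) := by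
  obtain ⟨h1, h2, h3⟩ := (mem_interior_triangle h).1 hx
  have key : ∀ r : ℝ, 0 < r → ∀ᶠ n : ℕ in atTop, Real.smoothTransition (n * r - 1) = 1 := by
    intro r hr
    filter_upwards [(tendsto_natCast_atTop_atTop.atTop_mul_const hr).eventually_ge_atTop 2]
      with n hn
    exact Real.smoothTransition.one_of_one_le (by linarith)
  refine tendsto_const_nhds.congr' ?_
  filter_upwards [key _ h1, key _ h2, key _ h3] with n e1 e2 e3
  rw [triCut, e1, e2, e3]; norm_num

/-- Tested with `triCut`, the weak gradient produces one strip integral for each side, with known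
limits. Continuity of φ on the closed triangle thus takes the place of a trace theorem. The
gradients of the coordinates point inwards, whence the minus sign. -/
theorem green_triangle_coords {A B C : Plane} (h : cross (B - A) (C - A) ≠ 0) {φ : Plane → ℝ}
    {G : Plane → Plane} (hφ : ContinuousOn φ (convexHull ℝ ({A, B, C} : Set Plane)))
    (hG : IntegrableOn G (interior (convexHull ℝ ({A, B, C} : Set Plane))))
    (hw : HasWeakGrad (interior (convexHull ℝ ({A, B, C} : Set Plane))) φ G) (a : Plane) (c : ℝ) :
    ∫ x in interior (convexHull ℝ ({A, B, C} : Set Plane)),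
        (inner ℝ (G x) (a + c • x) + 2 * c * φ x) =
      - |cross (B - A) (C - A)| *
        ((∫ t in Set.Ioo (0 : ℝ) 1, φ (B + t • (C - B)) *
            inner ℝ (gradBary A B C) (a + c • (B + t • (C - B)))) +
          (∫ t in Set.Ioo (0 : ℝ) 1, φ (C + t • (A - C)) *
            inner ℝ (gradBary B C A) (a + c • (C + t • (A - C)))) +
          ∫ t in Set.Ioo (0 : ℝ) 1, φ (A + t • (B - A)) *
            inner ℝ (gradBary C A B) (a + c • (A + t • (B - A)))) := by
  set H := convexHull ℝ ({A, B, C} : Set Plane) with hH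
  set T := interior H with hT
  have hTo : IsOpen T := isOpen_interior
  have hHc : IsCompact H := isCompact_triangle A B C
  have hB : cross (C - B) (A - B) ≠ 0 := by rwa [cross_rotate]
  have hC : cross (A - C) (B - C) ≠ 0 := by rwa [cross_rotate]
  have e1 : ({B, C, A} : Set Plane) = {A, B, C} := by
    ext x; simp; tauto
  have e2 : ({C, A, B} : Set Plane) = {A, B, C} := by
    ext x; simp; tauto
  have hint : ∀ f : Plane → ℝ, ContinuousOn f H → IntegrableOn f T := fun f hf =>
    (hf.integrableOn_compact hHc).mono_set interior_subset
  have hp : Continuous fun x : Plane => a + c • x := by fun_prop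
  have hF : ∀ g : Plane, ContinuousOn (fun x => φ x * inner ℝ g (a + c • x)) H := fun g =>
    hφ.mul (by fun_prop)
  have s1 := tendsto_integral_strip h (hF (gradBary A B C))
  have s2 := tendsto_integral_strip hB (F := fun x => φ x * inner ℝ (gradBary B C A) (a + c • x))
    (by rw [e1]; exact hF (gradBary B C A))
  have s3 := tendsto_integral_strip hC (F := fun x => φ x * inner ℝ (gradBary C A B) (a + c • x))
    (by rw [e2]; exact hF (gradBary C A B))
  rw [e1] at s2
  rw [e2] at s3
  rw [cross_rotate] at s2
  rw [cross_rotate, cross_rotate] at s3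
  have hGp : IntegrableOn (fun x => inner ℝ (G x) (a + c • x)) T := by
    obtain ⟨M, hM⟩ := hHc.exists_bound_of_continuousOn hp.continuousOn
    refine (hG.norm.mul_const M).mono' ?_ ?_
    · exact hG.aestronglyMeasurable.inner hp.aestronglyMeasurable
    · refine (ae_restrict_mem hTo.measurableSet).mono fun x hx => ?_
      exact (norm_inner_le_norm _ _).trans
        (mul_le_mul_of_nonneg_left (hM x (interior_subset hx)) (norm_nonneg _))
  have cutLim : ∀ f : Plane → ℝ, IntegrableOn f T →
      Tendsto (fun n => ∫ x in T, f x * triCut A B C n x) atTop (𝓝 (∫ x in T, f x)) := by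
    intro f hf
    refine tendsto_integral_filter_of_dominated_convergence (fun x => ‖f x‖) ?_ ?_ hf.norm ?_
    · filter_upwards [eventually_gt_atTop 0] with n hn
      exact hf.aestronglyMeasurable.mul
        (isTestFunction_triCut h hn).continuous.aestronglyMeasurable
    · filter_upwards with n
      filter_upwards with x
      rw [norm_mul]
      exact mul_le_of_le_one_right (norm_nonneg _) (abs_triCut_le_one _ _ _ _ _)
    · filter_upwards [ae_restrict_mem hTo.measurableSet] with x hx
      simpa using (tendsto_triCut h hx).const_mul (f x)
  have l1 := cutLim _ hGp
  have l2 := cutLim _ ((hint φ hφ).const_mul (2 * c))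
  have hid : ∀ᶠ n : ℕ in atTop, (∫ x in T, inner ℝ (G x) (a + c • x) * triCut A B C n x) +
      (∫ x in T, 2 * c * φ x * triCut A B C n x) = - (
      (∫ x in T, φ x * inner ℝ (gradBary A B C) (a + c • x) *
        (n * deriv Real.smoothTransition (n * bary A B C x - 1) *
        Real.smoothTransition (n * bary B C A x - 1) *
        Real.smoothTransition (n * bary C A B x - 1))) +
      (∫ x in T, φ x * inner ℝ (gradBary B C A) (a + c • x) *
        (n * deriv Real.smoothTransition (n * bary B C A x - 1) *
        Real.smoothTransition (n * bary C A B x - 1) *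
        Real.smoothTransition (n * bary A B C x - 1))) +
      ∫ x in T, φ x * inner ℝ (gradBary C A B) (a + c • x) *
        (n * deriv Real.smoothTransition (n * bary C A B x - 1) *
        Real.smoothTransition (n * bary A B C x - 1) *
        Real.smoothTransition (n * bary B C A x - 1))) := by
    filter_upwards [eventually_gt_atTop 0] with n hn
    have htest := isTestFunction_triCut h hn
    have := hw.integral_affine (hint φ hφ) hG htest a c
    have hi : ∀ g A' B' C' : Plane, IntegrableOn (fun x => φ x * inner ℝ g (a + c • x) *
        (n * deriv Real.smoothTransition (n * bary A' B' C' x - 1) *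
        Real.smoothTransition (n * bary B' C' A' x - 1) *
        Real.smoothTransition (n * bary C' A' B' x - 1))) T := by
      intro g A' B' C'
      refine hint _ ((hF g).mul (Continuous.continuousOn ?_))
      have k1 := continuous_deriv_smoothTransition
      have k2 := Real.smoothTransition.continuous
      have b1 := continuous_bary A' B' C'
      have b2 := continuous_bary B' C' A'
      have b3 := continuous_bary C' A' B'
      fun_prop
    have hadd : ∀ f1 f2 f3 f4 : Plane → ℝ, IntegrableOn f1 T → IntegrableOn f2 T →
        IntegrableOn f3 T → IntegrableOn f4 T → ∫ x in T, (f1 x + f2 x + f3 x + f4 x) =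
          (∫ x in T, f1 x) + (∫ x in T, f2 x) + (∫ x in T, f3 x) + ∫ x in T, f4 x := by
      intro f1 f2 f3 f4 h1 h2 h3 h4
      have h12 : IntegrableOn (fun x => f1 x + f2 x) T := h1.add h2
      have h123 : IntegrableOn (fun x => f1 x + f2 x + f3 x) T := h12.add h3
      rw [integral_add h123 h4, integral_add h12 h3, integral_add h1 h2]
    have hsum := hadd _ _ _ _ (hi (gradBary A B C) A B C) (hi (gradBary B C A) B C A)
      (hi (gradBary C A B) C A B) (integrable_mul_of_compactSupport
        ((hint φ hφ).const_mul (2 * c)) htest.continuous htest.2.1)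
    have hcongr : ∀ x, φ x * (fderiv ℝ (triCut A B C n) x (a + c • x) + 2 * c * triCut A B C n x) =
        φ x * inner ℝ (gradBary A B C) (a + c • x) *
        (n * deriv Real.smoothTransition (n * bary A B C x - 1) *
        Real.smoothTransition (n * bary B C A x - 1) *
        Real.smoothTransition (n * bary C A B x - 1)) +
        φ x * inner ℝ (gradBary B C A) (a + c • x) *
        (n * deriv Real.smoothTransition (n * bary B C A x - 1) *
        Real.smoothTransition (n * bary C A B x - 1) *
        Real.smoothTransition (n * bary A B C x - 1)) +
        φ x * inner ℝ (gradBary C A B) (a + c • x) *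
        (n * deriv Real.smoothTransition (n * bary C A B x - 1) *
        Real.smoothTransition (n * bary A B C x - 1) *
        Real.smoothTransition (n * bary B C A x - 1)) + 2 * c * φ x * triCut A B C n x := by
      intro x
      rw [fderiv_triCut]; ring
    simp_rw [hcongr] at this
    rw [hsum] at this
    linarith
  have key := tendsto_nhds_unique ((l1.add l2).congr' hid) ((s1.add s2).add s3).neg
  rw [integral_add hGp ((hint φ hφ).const_mul (2 * c)), key]
  ring

/-! ### Arc length on a segment -/

theorem openEdge_eq_image {e : Finset Plane} {B C : Plane} (he : (e : Set Plane) = {B, C})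
    (hBC : B ≠ C) : openEdge e = (fun t : ℝ => B + t • (C - B)) '' Set.Ioo 0 1 := by
  have hsub : C - B ≠ 0 := sub_ne_zero.2 hBC.symm
  rw [openEdge, he, convexHull_pair, segment_eq_image']
  ext x
  constructor
  · rintro ⟨⟨t, ht, rfl⟩, hx⟩
    refine ⟨t, ⟨lt_of_le_of_ne ht.1 ?_, lt_of_le_of_ne ht.2 ?_⟩, rfl⟩
    · rintro rfl; simp at hx
    · rintro rfl; simp at hx
  · rintro ⟨t, ht, rfl⟩
    refine ⟨⟨t, ⟨ht.1.le, ht.2.le⟩, rfl⟩, ?_⟩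
    rintro (hx | hx)
    · have : t • (C - B) = 0 := by simpa using hx
      rcases smul_eq_zero.1 this with h | h
      · exact ht.1.ne' h
      · exact hsub h
    · have : (t - 1) • (C - B) = 0 := by
        have hx' : B + t • (C - B) = C := hx
        rw [show (t - 1) • (C - B) = B + t • (C - B) - C by module, hx', sub_self]
      rcases smul_eq_zero.1 this with h | h
      · exact ht.2.ne (by linarith)
      · exact hsub h

-- The unit speed parametrization is an isometry of the line into the plane, so it carries Lebesgue
-- measure to one-dimensional Hausdorff measure on its range. Rescaling the parameter to (0, 1)
-- gives the factor `dist B C`.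
open scoped Pointwise in
theorem integral_openEdge {e : Finset Plane} {B C : Plane} (he : (e : Set Plane) = {B, C})
    (hBC : B ≠ C) (g : Plane → ℝ) :
    ∫ x in openEdge e, g x ∂(Measure.hausdorffMeasure 1 : Measure Plane) =
      dist B C * ∫ t in Set.Ioo (0 : ℝ) 1, g (B + t • (C - B)) := by
  have hsub : C - B ≠ 0 := sub_ne_zero.2 hBC.symm
  have hL : 0 < ‖C - B‖ := norm_pos_iff.2 hsub
  set L := ‖C - B‖ with hLdef
  let ℓ : ℝ → Plane := fun t => B + t • (L⁻¹ • (C - B))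
  have hiso : Isometry ℓ := by
    refine Isometry.of_dist_eq fun s t => ?_
    simp only [ℓ, dist_add_left]
    rw [dist_eq_norm, ← sub_smul, norm_smul, norm_smul, ← hLdef, norm_inv, Real.norm_of_nonneg hL.le,
      inv_mul_cancel₀ hL.ne', mul_one, Real.dist_eq, Real.norm_eq_abs]
  have hemb : MeasurableEmbedding ℓ := hiso.isClosedEmbedding.measurableEmbedding
  have himg : openEdge e = ℓ '' Set.Ioo 0 L := by
    rw [openEdge_eq_image he hBC]
    ext x
    constructor
    · rintro ⟨t, ht, rfl⟩
      refine ⟨t * L, ⟨mul_pos ht.1 hL, by nlinarith [ht.2]⟩, ?_⟩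
      simp only [ℓ, smul_smul, mul_assoc, mul_inv_cancel₀ hL.ne', mul_one]
    · rintro ⟨t, ht, rfl⟩
      refine ⟨t * L⁻¹, ⟨mul_pos ht.1 (inv_pos.2 hL), ?_⟩, ?_⟩
      · rw [← div_eq_mul_inv, div_lt_one hL]; exact ht.2
      · simp only [ℓ, smul_smul]
  have hmap := hiso.map_hausdorffMeasure (d := 1) (Or.inl zero_le_one)
  have h1 : (Measure.hausdorffMeasure 1 : Measure Plane).restrict (openEdge e) =
      (Measure.map ℓ (Measure.hausdorffMeasure 1)).restrict (openEdge e) := by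
    rw [hmap, Measure.restrict_restrict_of_subset]
    rw [himg]; exact Set.image_subset_range _ _
  rw [h1, hemb.setIntegral_map, himg, Set.preimage_image_eq _ hiso.injective, hausdorffMeasure_real]
  have h2 := Measure.setIntegral_comp_smul_of_pos (volume : Measure ℝ) (fun t => g (ℓ t))
    (Set.Ioo 0 1) hL
  have h3 : L • Set.Ioo (0 : ℝ) 1 = Set.Ioo 0 L := by
    rw [LinearOrderedField.smul_Ioo hL]; simp
  rw [h3] at h2
  simp only [Module.finrank_self, pow_one, smul_eq_mul] at h2
  rw [dist_comm, dist_eq_norm, ← hLdef]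
  have h4 : ∀ t : ℝ, ℓ (L * t) = B + t • (C - B) := fun t => by
    simp only [ℓ, smul_smul]
    rw [mul_right_comm, mul_inv_cancel₀ hL.ne', one_mul]
  simp_rw [h4] at h2
  rw [h2, ← mul_assoc, mul_inv_cancel₀ hL.ne', one_mul]

/-! ### Outer normals -/

/-- The outer unit normal to the edge `BC` of the triangle `ABC`. -/
noncomputable def edgeNormal (A B C : Plane) : Plane :=
  (-(|cross (B - A) (C - A)| / dist B C)) • gradBary A B C

theorem isOuterNormal_edgeNormal {A B C : Plane} (h : cross (B - A) (C - A) ≠ 0) (hBC : B ≠ C)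
    {K e : Finset Plane} (hK : (K : Set Plane) = {A, B, C}) (he : (e : Set Plane) = {B, C}) :
    IsOuterNormal K e (edgeNormal A B C) := by
  have hd : 0 < dist B C := dist_pos.2 hBC
  have hD : 0 < |cross (B - A) (C - A)| := abs_pos.2 h
  have hbe : ∀ x ∈ e, bary A B C x = 0 := by
    intro x hx
    have : x ∈ ({B, C} : Set Plane) := he ▸ (Finset.mem_coe.2 hx)
    rcases this with rfl | rfl <;> simp
  refine ⟨?_, ?_, ?_⟩
  · rw [edgeNormal, norm_smul, norm_neg, Real.norm_of_nonneg (by positivity), gradBary, norm_smul,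
      norm_inv, Real.norm_eq_abs, dist_eq_norm]
    -- The vector on the left is B − C turned by a right angle.
    have : ‖(!₂[B 1 - C 1, C 0 - B 0] : Plane)‖ = ‖B - C‖ := by
      rw [EuclideanSpace.norm_eq, EuclideanSpace.norm_eq]
      congr 1
      simp [Fin.sum_univ_two]
      ring
    rw [this]
    rw [dist_eq_norm] at hd
    field_simp
  · intro x hx y hy
    rw [edgeNormal, inner_smul_left, ← bary_sub, hbe x hx, hbe y hy]; simp
  · intro x hx y hy
    rw [edgeNormal, inner_smul_left, ← bary_sub, hbe x hx]
    have hy0 : 0 ≤ bary A B C y := by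
      have : y ∈ ({A, B, C} : Set Plane) := hK ▸ (Finset.mem_coe.2 hy)
      rcases this with rfl | rfl | rfl
      · rw [bary_self _ _ _ h]; exact zero_le_one
      · simp
      · simp
    simp
    positivity

open Classical in
/-- Green's formula for affine fields `a + c x` on a triangle `K`; edges are denoted by the
opposite vertices. -/
theorem exists_green_normals {K : Finset Plane} (hcard : K.card = 3)
    (hind : AffineIndependent ℝ ((↑) : K → Plane)) :
    ∃ N : Plane → Plane, (∀ A ∈ K, IsOuterNormal K (K.erase A) (N A)) ∧
      ∀ (φ : Plane → ℝ) (G : Plane → Plane), ContinuousOn φ (convexHull ℝ (K : Set Plane)) →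
        IntegrableOn G (openTriangle K) → HasWeakGrad (openTriangle K) φ G →
        ∀ (a : Plane) (c : ℝ), ∫ x in openTriangle K, (inner ℝ (G x) (a + c • x) + 2 * c * φ x) =
          ∑ A ∈ K, ∫ x in openEdge (K.erase A), φ x * inner ℝ (N A) (a + c • x)
            ∂(Measure.hausdorffMeasure 1 : Measure Plane) := by
  obtain ⟨A, B, C, hAB, hAC, hBC, rfl⟩ := Finset.card_eq_three.1 hcard
  have h := cross_ne_zero_of_coe_eq hind hAB hAC hBC (by simp)
  have hB : cross (C - B) (A - B) ≠ 0 := by rwa [cross_rotate]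
  have hC : cross (A - C) (B - C) ≠ 0 := by rwa [cross_rotate]
  have hK : ((({A, B, C} : Finset Plane)) : Set Plane) = {A, B, C} := by simp
  have e1 : ({B, C, A} : Set Plane) = {A, B, C} := by
    ext x; simp; tauto
  have e2 : ({C, A, B} : Set Plane) = {A, B, C} := by
    ext x; simp; tauto
  have eA : ((({A, B, C} : Finset Plane).erase A : Finset Plane) : Set Plane) = {B, C} := by
    ext x; simp
    rintro (rfl | rfl) <;> simp [hAB.symm, hAC.symm]
  have eB : ((({A, B, C} : Finset Plane).erase B : Finset Plane) : Set Plane) = {C, A} := by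
    ext x; simp; constructor
    · rintro ⟨h1, h2⟩; tauto
    · rintro (rfl | rfl) <;> simp [hAB, hBC.symm]
  have eC : ((({A, B, C} : Finset Plane).erase C : Finset Plane) : Set Plane) = {A, B} := by
    ext x; simp; constructor
    · rintro ⟨h1, h2⟩; tauto
    · rintro (rfl | rfl) <;> simp [hAC, hBC]
  let N : Plane → Plane := fun V => if V = A then edgeNormal A B C else
    if V = B then edgeNormal B C A else edgeNormal C A B
  have NA : N A = edgeNormal A B C := by simp [N]
  have NB : N B = edgeNormal B C A := by simp [N, hAB.symm]
  have NC : N C = edgeNormal C A B := by simp [N, hAC.symm, hBC.symm]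
  refine ⟨N, ?_, ?_⟩
  · intro V hV
    simp only [Finset.mem_insert, Finset.mem_singleton] at hV
    rcases hV with rfl | rfl | rfl
    · rw [NA]; exact isOuterNormal_edgeNormal h hBC hK eA
    · rw [NB]; exact isOuterNormal_edgeNormal hB hAC.symm (hK.trans e1.symm) eB
    · rw [NC]; exact isOuterNormal_edgeNormal hC hAB (hK.trans e2.symm) eC
  · intro φ G hφ hG hw a c
    rw [Finset.sum_insert (by simp [hAB, hAC]), Finset.sum_insert (by simp [hBC]),
      Finset.sum_singleton, NA, NB, NC, integral_openEdge eA hBC, integral_openEdge eB hAC.symm,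
      integral_openEdge eC hAB]
    rw [openTriangle, hK] at hG hw ⊢
    rw [hK] at hφ
    rw [green_triangle_coords h hφ hG hw a c]
    have d1 : dist B C ≠ 0 := (dist_pos.2 hBC).ne'
    have d2 : dist C A ≠ 0 := (dist_pos.2 hAC.symm).ne'
    have d3 : dist A B ≠ 0 := (dist_pos.2 hAB).ne'
    have key : ∀ (d D : ℝ) (g : Plane) (γ : ℝ → Plane), d ≠ 0 →
        d * ∫ t in Set.Ioo (0 : ℝ) 1, φ (γ t) * inner ℝ ((-(D / d)) • g) (a + c • γ t) =
          - D * ∫ t in Set.Ioo (0 : ℝ) 1, φ (γ t) * inner ℝ g (a + c • γ t) := by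
      intro d D g γ hd
      rw [← integral_const_mul, ← integral_const_mul]
      congr 1; ext t
      rw [inner_smul_left]
      simp
      field_simp
    simp only [edgeNormal]
    rw [key _ _ _ _ d1, key _ _ _ _ d2, key _ _ _ _ d3, cross_rotate B C A, cross_rotate A B C]
    ring


/-! ### The combinatorics of a triangulation -/

section Triangulation

variable {Ω : Set Plane} {T : Geometry.SimplicialComplex ℝ Plane}

/-- The finite set of triangles of a triangulation. -/
noncomputable def IsTriangulation.tris (hT : IsTriangulation Ω T) : Finset (Finset Plane) :=
  (hT.finite.subset (t := triangles T) fun _ h => h.1).toFinset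

@[simp] theorem IsTriangulation.mem_tris (hT : IsTriangulation Ω T) {K : Finset Plane} :
    K ∈ hT.tris ↔ K ∈ triangles T := by simp [IsTriangulation.tris]

/-- The finite set of edges of a triangulation. -/
noncomputable def IsTriangulation.edges (hT : IsTriangulation Ω T) : Finset (Finset Plane) :=
  (hT.finite.subset (t := {e | e ∈ T.faces ∧ e.card = 2}) fun _ h => h.1).toFinset

@[simp] theorem IsTriangulation.mem_edges (hT : IsTriangulation Ω T) {e : Finset Plane} :
    e ∈ hT.edges ↔ e ∈ T.faces ∧ e.card = 2 := by simp [IsTriangulation.edges]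

theorem edge_mem_faces {K e : Finset Plane} (hK : K ∈ triangles T) (he : e ⊆ K)
    (hcard : e.card = 2) : e ∈ T.faces :=
  T.down_closed hK.1 he (Finset.card_pos.1 (by omega))

open Classical in
theorem erase_card {K : Finset Plane} (hK : K ∈ triangles T) {A : Plane} (hA : A ∈ K) :
    (K.erase A).card = 2 := by
  rw [Finset.card_erase_of_mem hA, hK.2]

open Classical in
theorem exists_eq_erase {K e : Finset Plane} (hK : K ∈ triangles T) (he : e ⊆ K)
    (hcard : e.card = 2) : ∃ A ∈ K, e = K.erase A := by
  have h1 : (K \ e).card = 1 := by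
    rw [Finset.card_sdiff_of_subset he, hK.2, hcard]
  obtain ⟨A, hA⟩ := Finset.card_eq_one.1 h1
  have hA' : A ∈ K \ e := by rw [hA]; simp
  rw [Finset.mem_sdiff] at hA'
  refine ⟨A, hA'.1, Finset.eq_of_subset_of_card_le ?_ ?_⟩
  · intro x hx
    exact Finset.mem_erase.2 ⟨fun h => hA'.2 (h ▸ hx), he hx⟩
  · rw [erase_card hK hA'.1, hcard]

theorem exists_apex {K e : Finset Plane} {B C : Plane} (hK : K ∈ triangles T) (he : e ⊆ K)
    (hBC : B ≠ C) (hcoe : (e : Set Plane) = {B, C}) :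
    ∃ A ∈ K, A ∉ e ∧ (K : Set Plane) = {A, B, C} ∧ cross (B - A) (C - A) ≠ 0 := by
  classical
  have hcard : e.card = 2 := by
    have : e = {B, C} := by ext x; rw [← Finset.mem_coe, hcoe]; simp
    rw [this, Finset.card_pair hBC]
  obtain ⟨A, hA, rfl⟩ := exists_eq_erase hK he hcard
  have hKcoe : (K : Set Plane) = {A, B, C} := by
    rw [← hcoe, ← Finset.coe_insert, Finset.insert_erase hA]
  have hB : B ∈ K.erase A := by rw [← Finset.mem_coe, hcoe]; simp
  have hC : C ∈ K.erase A := by rw [← Finset.mem_coe, hcoe]; simp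
  exact ⟨A, hA, by simp, hKcoe, cross_ne_zero_of_coe_eq (T.indep hK.1)
    (Finset.ne_of_mem_erase hB).symm (Finset.ne_of_mem_erase hC).symm hBC hKcoe⟩

theorem exists_pair {e : Finset Plane} (he : e.card = 2) :
    ∃ B C : Plane, B ≠ C ∧ (e : Set Plane) = {B, C} := by
  classical
  obtain ⟨B, C, h, rfl⟩ := Finset.card_eq_two.1 he
  exact ⟨B, C, h, by simp⟩

theorem exists_apex_of_mem {K : Finset Plane} {A : Plane} (hK : K ∈ triangles T) (hA : A ∈ K) :
    ∃ B C : Plane, (K : Set Plane) = {A, B, C} ∧ cross (B - A) (C - A) ≠ 0 := by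
  classical
  obtain ⟨B, C, hBC, hcoe⟩ := exists_pair (erase_card hK hA)
  obtain ⟨A', hA', hne, h1, h2⟩ := exists_apex hK (Finset.erase_subset A K) hBC hcoe
  obtain rfl : A' = A := by
    by_contra h
    exact hne (Finset.mem_erase.2 ⟨h, hA'⟩)
  exact ⟨B, C, h1, h2⟩

/-- Two faces meet in the hull of their common vertices. If a vertex A of K were missing from s, the
coordinate of A would vanish on that hull, whereas it is positive in the open triangle. -/
theorem subset_of_mem_openTriangle {K s : Finset Plane} (hK : K ∈ triangles T)
    (hs : s ∈ T.faces) {x : Plane} (hx : x ∈ openTriangle K)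
    (hxs : x ∈ convexHull ℝ (s : Set Plane)) : K ⊆ s := by
  intro A hA
  by_contra hAs
  obtain ⟨B, C, hcoe, hcr⟩ := exists_apex_of_mem hK hA
  have h1 := T.inter_subset_convexHull hK.1 hs ⟨interior_subset hx, hxs⟩
  have h2 : ((K : Set Plane) ∩ s) ⊆ {y | bary A B C y = 0} := by
    rintro y ⟨hy1, hy2⟩
    rw [hcoe] at hy1
    rcases hy1 with rfl | rfl | rfl
    · exact absurd hy2 hAs
    · simp
    · simp
  have hconv : Convex ℝ {y | bary A B C y = 0} := by
    intro y hy z hz p q _ _ hpq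
    have := bary_combo A B C y z z p q 0 (by linarith)
    simp only [zero_smul, add_zero] at this
    simp only [Set.mem_ofPred_eq] at hy hz ⊢
    rw [this, hy, hz]; simp
  have h3 : bary A B C x = 0 := convexHull_min h2 hconv h1
  rw [openTriangle, hcoe, mem_interior_triangle hcr] at hx
  exact hx.1.ne' h3

/-- If s missed one endpoint, the intersection of the two faces would be contained in the other
endpoint, which is not in the open edge. -/
theorem subset_of_mem_openEdge {e s : Finset Plane} (he : e ∈ T.faces) (hcard : e.card = 2)
    (hs : s ∈ T.faces) {x : Plane} (hx : x ∈ openEdge e)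
    (hxs : x ∈ convexHull ℝ (s : Set Plane)) : e ⊆ s := by
  classical
  intro A hA
  by_contra hAs
  have h1 := T.inter_subset_convexHull he hs ⟨hx.1, hxs⟩
  have hc : (e.erase A).card = 1 := by rw [Finset.card_erase_of_mem hA, hcard]
  obtain ⟨B, hB⟩ := Finset.card_eq_one.1 hc
  have hBe : B ∈ e := Finset.mem_of_mem_erase (a := A) (by rw [hB]; simp)
  have h2 : ((e : Set Plane) ∩ s) ⊆ {B} := by
    rintro y ⟨hy1, hy2⟩
    have : y ∈ e.erase A := Finset.mem_erase.2 ⟨fun h => hAs (h ▸ hy2), hy1⟩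
    rw [hB] at this
    simpa using this
  have h3 : x ∈ ({B} : Set Plane) := convexHull_min h2 (convex_singleton B) h1
  exact hx.2 (by rw [Set.mem_singleton_iff] at h3; rw [h3]; exact hBe)

theorem disjoint_openTriangle {K K' : Finset Plane} (hK : K ∈ triangles T)
    (hK' : K' ∈ triangles T) (hne : K ≠ K') : Disjoint (openTriangle K) (openTriangle K') := by
  rw [Set.disjoint_left]
  intro x hx hx'
  have := subset_of_mem_openTriangle hK hK'.1 hx (interior_subset hx')
  exact hne (Finset.eq_of_subset_of_card_le this (by rw [hK.2, hK'.2]))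

theorem disjoint_openEdge {e e' : Finset Plane} (he : e ∈ T.faces) (hc : e.card = 2)
    (he' : e' ∈ T.faces) (hc' : e'.card = 2) (hne : e ≠ e') :
    Disjoint (openEdge e) (openEdge e') := by
  rw [Set.disjoint_left]
  intro x hx hx'
  have := subset_of_mem_openEdge he hc he' hx hx'.1
  exact hne (Finset.eq_of_subset_of_card_le this (by rw [hc, hc']))

theorem IsTriangulation.closure_eq (hT : IsTriangulation Ω T) :
    closure Ω = ⋃ K ∈ hT.tris, convexHull ℝ (K : Set Plane) := by
  rw [← hT.space_eq]
  ext x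
  rw [Geometry.SimplicialComplex.mem_space_iff]
  simp only [Set.mem_iUnion, hT.mem_tris, exists_prop]
  constructor
  · rintro ⟨s, hs, hx⟩
    obtain ⟨K, hK, hsK⟩ := hT.pure s hs
    exact ⟨K, hK, convexHull_mono (by exact_mod_cast hsK) hx⟩
  · rintro ⟨K, hK, hx⟩
    exact ⟨K, hK.1, hx⟩

theorem IsTriangulation.convexHull_subset (hT : IsTriangulation Ω T) {K : Finset Plane}
    (hK : K ∈ triangles T) : convexHull ℝ (K : Set Plane) ⊆ closure Ω := by
  rw [hT.closure_eq]
  exact Set.subset_biUnion_of_mem (u := fun K : Finset Plane => convexHull ℝ (K : Set Plane))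
    (Finset.mem_coe.2 (hT.mem_tris.2 hK))

theorem isCompact_hull (K : Finset Plane) : IsCompact (convexHull ℝ (K : Set Plane)) :=
  K.finite_toSet.isCompact_convexHull ℝ

theorem IsTriangulation.isCompact_closure (hT : IsTriangulation Ω T) : IsCompact (closure Ω) := by
  rw [hT.closure_eq]
  exact hT.tris.isCompact_biUnion fun K _ => isCompact_hull K

theorem isOpen_openTriangle (K : Finset Plane) : IsOpen (openTriangle K) := isOpen_interior

theorem measurableSet_openEdge (e : Finset Plane) : MeasurableSet (openEdge e) :=
  (isCompact_hull e).isClosed.measurableSet.diff e.finite_toSet.measurableSet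

theorem IsTriangulation.openTriangle_subset (hT : IsTriangulation Ω T) (hΩ : IsPolygonalDomain Ω)
    {K : Finset Plane} (hK : K ∈ triangles T) : openTriangle K ⊆ Ω := by
  rw [← hΩ.interior_closure]
  exact interior_mono (hT.convexHull_subset hK)

theorem openTriangle_nonempty {K : Finset Plane} (hK : K ∈ triangles T) :
    (openTriangle K).Nonempty := by
  obtain ⟨A, hA⟩ : K.Nonempty := Finset.card_pos.1 (by rw [hK.2]; norm_num)
  obtain ⟨B, C, hcoe, hcr⟩ := exists_apex_of_mem hK hA
  have hB : cross (C - B) (A - B) ≠ 0 := by rwa [cross_rotate]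
  have hC : cross (A - C) (B - C) ≠ 0 := by rwa [cross_rotate, cross_rotate]
  refine ⟨(1/3 : ℝ) • A + (1/3 : ℝ) • B + (1/3 : ℝ) • C, ?_⟩
  rw [openTriangle, hcoe, mem_interior_triangle hcr, bary_combo _ _ _ _ _ _ _ _ _ (by norm_num),
    bary_combo _ _ _ _ _ _ _ _ _ (by norm_num), bary_combo _ _ _ _ _ _ _ _ _ (by norm_num),
    bary_self _ _ _ hcr, bary_self _ _ _ hB, bary_self _ _ _ hC]
  norm_num

theorem convexHull_subset_closure_openTriangle {K : Finset Plane} (hK : K ∈ triangles T) :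
    convexHull ℝ (K : Set Plane) ⊆ closure (openTriangle K) := by
  rw [openTriangle, (convex_convexHull ℝ _).closure_interior_eq_closure_of_nonempty_interior
    (openTriangle_nonempty hK)]
  exact subset_closure

theorem volume_openTriangle_pos {K : Finset Plane} (hK : K ∈ triangles T) :
    0 < volume (openTriangle K) :=
  (isOpen_openTriangle K).measure_pos _ (openTriangle_nonempty hK)

theorem volume_openTriangle_lt_top (K : Finset Plane) : volume (openTriangle K) < ⊤ :=
  (measure_mono interior_subset).trans_lt (isCompact_hull K).measure_lt_top

/-- What is left out lies on the frontiers of finitely many convex sets, and these are null sets. -/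
theorem IsTriangulation.ae_eq_biUnion (hT : IsTriangulation Ω T) (hΩ : IsPolygonalDomain Ω) :
    Ω =ᵐ[volume] (⋃ K ∈ hT.tris, openTriangle K : Set Plane) := by
  have h1 : (⋃ K ∈ hT.tris, openTriangle K) ⊆ Ω :=
    Set.iUnion₂_subset fun K hK => hT.openTriangle_subset hΩ (hT.mem_tris.1 hK)
  refine (ae_eq_set).2 ⟨?_, by rw [Set.sdiff_eq_empty.2 h1]; simp⟩
  have h2 : Ω \ (⋃ K ∈ hT.tris, openTriangle K) ⊆
      ⋃ K ∈ hT.tris, frontier (convexHull ℝ (K : Set Plane)) := by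
    rintro x ⟨hx, hx'⟩
    have := subset_closure hx
    rw [hT.closure_eq] at this
    simp only [Set.mem_iUnion, exists_prop] at this hx' ⊢
    obtain ⟨K, hK, hxK⟩ := this
    refine ⟨K, hK, ?_⟩
    rw [frontier, (isCompact_hull K).isClosed.closure_eq]
    exact ⟨hxK, fun h => hx' ⟨K, hK, h⟩⟩
  refine measure_mono_null h2 ((measure_biUnion_null_iff hT.tris.countable_toSet).2 fun K _ => ?_)
  exact (convex_convexHull ℝ _).addHaar_frontier _

theorem IsTriangulation.restrict_eq (hT : IsTriangulation Ω T) (hΩ : IsPolygonalDomain Ω) :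
    volume.restrict Ω = volume.restrict (⋃ K ∈ hT.tris, openTriangle K : Set Plane) :=
  Measure.restrict_congr_set (hT.ae_eq_biUnion hΩ)

theorem IsTriangulation.integral_eq_sum (hT : IsTriangulation Ω T) (hΩ : IsPolygonalDomain Ω)
    {F : Type*} [NormedAddCommGroup F] [NormedSpace ℝ F] {f : Plane → F}
    (hf : IntegrableOn f Ω) : ∫ x in Ω, f x = ∑ K ∈ hT.tris, ∫ x in openTriangle K, f x := by
  rw [hT.restrict_eq hΩ]
  refine integral_biUnion_finset _ (fun K _ => (isOpen_openTriangle K).measurableSet) ?_ ?_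
  · intro K hK K' hK' hne
    exact disjoint_openTriangle (hT.mem_tris.1 hK) (hT.mem_tris.1 hK') hne
  · intro K hK
    exact hf.mono_set (hT.openTriangle_subset hΩ (hT.mem_tris.1 hK))

theorem IsTriangulation.ae_of_forall_openTriangle (hT : IsTriangulation Ω T)
    (hΩ : IsPolygonalDomain Ω) {P : Plane → Prop}
    (h : ∀ K ∈ triangles T, ∀ x ∈ openTriangle K, P x) : ∀ᵐ x ∂volume.restrict Ω, P x := by
  rw [hT.restrict_eq hΩ]
  refine (ae_restrict_mem (Finset.measurableSet_biUnion _ fun K _ =>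
    (isOpen_openTriangle K).measurableSet)).mono fun x hx => ?_
  simp only [Set.mem_iUnion, exists_prop] at hx
  obtain ⟨K, hK, hx⟩ := hx
  exact h K (hT.mem_tris.1 hK) x hx

/-! ### Interior and boundary edges -/

theorem openEdge_nonempty {e : Finset Plane} (he : e.card = 2) : (openEdge e).Nonempty := by
  obtain ⟨B, C, hBC, hcoe⟩ := exists_pair he
  rw [openEdge_eq_image hcoe hBC]
  exact ⟨_, ⟨1/2, by norm_num, rfl⟩⟩

theorem convexHull_subset_closure_openEdge {e : Finset Plane} (he : e.card = 2) :
    convexHull ℝ (e : Set Plane) ⊆ closure (openEdge e) := by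
  obtain ⟨B, C, hBC, hcoe⟩ := exists_pair he
  rw [openEdge_eq_image hcoe hBC, hcoe, convexHull_pair, segment_eq_image',
    ← closure_Ioo (zero_ne_one (α := ℝ))]
  exact image_closure_subset_closure_image (by fun_prop)

/-- Near a point of the relative interior of the edge `BC`, the triangle `ABC` is the half plane
on the side of `A`. -/
theorem bary_pos_of_mem_openEdge {e : Finset Plane} {A B C : Plane} (hBC : B ≠ C)
    (he : (e : Set Plane) = {B, C}) (h : cross (B - A) (C - A) ≠ 0) {x : Plane}
    (hx : x ∈ openEdge e) : bary A B C x = 0 ∧ 0 < bary B C A x ∧ 0 < bary C A B x := by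
  have hB : cross (C - B) (A - B) ≠ 0 := by rwa [cross_rotate]
  have hC : cross (A - C) (B - C) ≠ 0 := by rwa [cross_rotate, cross_rotate]
  rw [openEdge_eq_image he hBC] at hx
  obtain ⟨t, ht, rfl⟩ := hx
  have e1 : B + t • (C - B) = (0 : ℝ) • A + (1 - t) • B + t • C := by module
  simp only [e1]
  rw [bary_combo _ _ _ _ _ _ _ _ _ (by ring), bary_combo _ _ _ _ _ _ _ _ _ (by ring),
    bary_combo _ _ _ _ _ _ _ _ _ (by ring), bary_self _ _ _ hB, bary_self _ _ _ hC]
  simp only [bary_left, bary_right]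
  refine ⟨by ring, by linarith [ht.2], by linarith [ht.1]⟩

theorem eventually_side {e : Finset Plane} {A B C : Plane} (hBC : B ≠ C)
    (he : (e : Set Plane) = {B, C}) (h : cross (B - A) (C - A) ≠ 0) {x : Plane}
    (hx : x ∈ openEdge e) : ∀ᶠ y in 𝓝 x, 0 < bary B C A y ∧ 0 < bary C A B y := by
  obtain ⟨_, h2, h3⟩ := bary_pos_of_mem_openEdge hBC he h hx
  exact ((continuous_bary B C A).continuousAt.eventually_const_lt h2).and
    ((continuous_bary C A B).continuousAt.eventually_const_lt h3)

/-- Points on the side of `A` arbitrarily close to the edge `BC`. -/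
theorem frequently_side {e : Finset Plane} {A B C : Plane} (hBC : B ≠ C)
    (he : (e : Set Plane) = {B, C}) (h : cross (B - A) (C - A) ≠ 0) {x : Plane}
    (hx : x ∈ openEdge e) {s : ℝ} (hs : s ≠ 0) : ∃ᶠ y in 𝓝 x, 0 < s * bary A B C y := by
  have h1 := (bary_pos_of_mem_openEdge hBC he h hx).1
  have hcont : Tendsto (fun t : ℝ => x + t • (s • (A - B))) (𝓝[>] 0) (𝓝 x) := by
    have : Continuous (fun t : ℝ => x + t • (s • (A - B))) := by fun_prop
    have := this.tendsto 0
    simp only [zero_smul, add_zero] at this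
    exact this.mono_left nhdsWithin_le_nhds
  refine hcont.frequently (Eventually.frequently ?_)
  filter_upwards [self_mem_nhdsWithin] with t ht
  have e1 : x + t • (s • (A - B)) = (1 : ℝ) • x + (t * s) • A + (-(t * s)) • B := by module
  rw [e1, bary_combo _ _ _ _ _ _ _ _ _ (by ring), h1, bary_self _ _ _ h, bary_left]
  have : (0 : ℝ) < t := ht
  have := mul_self_pos.2 hs
  nlinarith [mul_pos ‹(0 : ℝ) < t› this]

theorem bary_eq_mul (A A' B C x : Plane) (h : cross (B - A') (C - A') ≠ 0) :
    bary A B C x = cross (B - A') (C - A') / cross (B - A) (C - A) * bary A' B C x := by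
  rw [bary, bary]; field_simp

/-- Two triangles on the same side of a common edge coincide. -/
theorem eq_of_same_side {K K' e : Finset Plane} {A A' B C : Plane} (hK : K ∈ triangles T)
    (hK' : K' ∈ triangles T) (hBC : B ≠ C) (he : (e : Set Plane) = {B, C})
    (hKc : (K : Set Plane) = {A, B, C}) (hKc' : (K' : Set Plane) = {A', B, C})
    (h : cross (B - A) (C - A) ≠ 0) (h' : cross (B - A') (C - A') ≠ 0) (hcard : e.card = 2)
    (hside : 0 < cross (B - A') (C - A') * cross (B - A) (C - A)) : K = K' := by
  obtain ⟨x, hx⟩ := openEdge_nonempty hcard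
  -- Near a relative interior point of the edge both triangles look like half planes. A nearby point
  -- on the common side lies in both open triangles, which are disjoint unless the triangles
  -- coincide.
  have hf := frequently_side hBC he h' hx one_ne_zero
  obtain ⟨y, hy, hy1, hy2⟩ := (hf.and_eventually ((eventually_side hBC he h hx).and
    (eventually_side hBC he h' hx))).exists
  rw [one_mul] at hy
  have hyK' : y ∈ openTriangle K' := by
    rw [openTriangle, hKc', mem_interior_triangle h']
    exact ⟨hy, hy2⟩
  have hyK : y ∈ openTriangle K := by
    rw [openTriangle, hKc, mem_interior_triangle h, bary_eq_mul A A' B C y h']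
    refine ⟨mul_pos ?_ hy, hy1⟩
    rw [div_eq_mul_inv]
    rcases mul_pos_iff.1 hside with ⟨h1, h2⟩ | ⟨h1, h2⟩
    · exact mul_pos h1 (inv_pos.2 h2)
    · exact mul_pos_of_neg_of_neg h1 (inv_lt_zero.2 h2)
  by_contra hne
  exact Set.disjoint_left.1 (disjoint_openTriangle hK hK' hne) hyK hyK'

theorem IsTriangulation.exists_triangle (hT : IsTriangulation Ω T) {e : Finset Plane}
    (he : e ∈ T.faces) : ∃ K ∈ triangles T, e ⊆ K := hT.pure e he

/-- An edge has only two sides, distinguished by the sign of the determinant, and each side is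
occupied by at most one triangle. -/
theorem eq_or_eq_of_common_edge {K K' K'' e : Finset Plane}
    (hcard : e.card = 2) (hK : K ∈ triangles T) (hK' : K' ∈ triangles T) (hne : K ≠ K')
    (hK'' : K'' ∈ triangles T) (h : e ⊆ K) (h' : e ⊆ K') (h'' : e ⊆ K'') : K'' = K ∨ K'' = K' := by
  obtain ⟨B, C, hBC, hcoe⟩ := exists_pair hcard
  obtain ⟨A, _, _, hKc, hcr⟩ := exists_apex hK h hBC hcoe
  obtain ⟨A', _, _, hKc', hcr'⟩ := exists_apex hK' h' hBC hcoe
  obtain ⟨A'', _, _, hKc'', hcr''⟩ := exists_apex hK'' h'' hBC hcoe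
  have k1 : cross (B - A') (C - A') * cross (B - A) (C - A) < 0 := by
    refine lt_of_le_of_ne (not_lt.1 fun hp => hne ?_) (mul_ne_zero hcr' hcr)
    exact eq_of_same_side hK hK' hBC hcoe hKc hKc' hcr hcr' hcard hp
  by_cases hp : 0 < cross (B - A'') (C - A'') * cross (B - A) (C - A)
  · exact Or.inl (eq_of_same_side hK hK'' hBC hcoe hKc hKc'' hcr hcr'' hcard hp).symm
  · refine Or.inr (eq_of_same_side hK' hK'' hBC hcoe hKc' hKc'' hcr' hcr'' hcard ?_).symm
    have k2 : cross (B - A'') (C - A'') * cross (B - A) (C - A) < 0 :=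
      lt_of_le_of_ne (not_lt.1 hp) (mul_ne_zero hcr'' hcr)
    have k3 := mul_pos_of_neg_of_neg k1 k2
    have k4 := mul_self_pos.2 hcr
    by_contra hn
    rw [not_lt] at hn
    nlinarith

/-- The two triangles lie on opposite sides and together cover a neighbourhood of each point of the
open edge. Such a point is interior to the closure of Ω, hence in Ω because there are no cracks. -/
theorem IsTriangulation.openEdge_subset (hT : IsTriangulation Ω T) (hΩ : IsPolygonalDomain Ω)
    {K K' e : Finset Plane}
    (hcard : e.card = 2) (hK : K ∈ triangles T) (hK' : K' ∈ triangles T) (hne : K ≠ K')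
    (h : e ⊆ K) (h' : e ⊆ K') : openEdge e ⊆ Ω := by
  obtain ⟨B, C, hBC, hcoe⟩ := exists_pair hcard
  obtain ⟨A, _, _, hKc, hcr⟩ := exists_apex hK h hBC hcoe
  obtain ⟨A', _, _, hKc', hcr'⟩ := exists_apex hK' h' hBC hcoe
  have k1 : cross (B - A') (C - A') * cross (B - A) (C - A) < 0 := by
    refine lt_of_le_of_ne (not_lt.1 fun hp => hne ?_) (mul_ne_zero hcr' hcr)
    exact eq_of_same_side hK hK' hBC hcoe hKc hKc' hcr hcr' hcard hp
  intro x hx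
  rw [← hΩ.interior_closure, mem_interior_iff_mem_nhds]
  filter_upwards [eventually_side hBC hcoe hcr hx, eventually_side hBC hcoe hcr' hx] with y hy hy'
  by_cases hp : 0 ≤ bary A B C y
  · refine hT.convexHull_subset hK ?_
    rw [hKc, mem_convexHull_triangle hcr]
    exact ⟨hp, hy.1.le, hy.2.le⟩
  · refine hT.convexHull_subset hK' ?_
    rw [hKc', mem_convexHull_triangle hcr']
    refine ⟨?_, hy'.1.le, hy'.2.le⟩
    rw [bary_eq_mul A' A B C y hcr]
    refine mul_nonneg_of_nonpos_of_nonpos ?_ (not_le.1 hp).le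
    rw [div_eq_mul_inv]
    rcases mul_neg_iff.1 k1 with ⟨h1, h2⟩ | ⟨h1, h2⟩
    · exact mul_nonpos_of_nonpos_of_nonneg h2.le (inv_pos.2 h1).le
    · exact mul_nonpos_of_nonneg_of_nonpos h2.le (inv_lt_zero.2 h1).le

/-- Every other triangle is closed and misses a given point of the open edge. Hence points just
across the edge belong to no triangle, and the point is not interior to the closure of Ω. -/
theorem IsTriangulation.mem_boundaryEdges (hT : IsTriangulation Ω T) (hΩ : IsPolygonalDomain Ω)
    {K e : Finset Plane} (hcard : e.card = 2) (hK : K ∈ triangles T) (h : e ⊆ K)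
    (huniq : ∀ K' ∈ triangles T, e ⊆ K' → K' = K) : e ∈ boundaryEdges Ω T := by
  have hface := edge_mem_faces hK h hcard
  refine ⟨hface, hcard, ?_⟩
  obtain ⟨B, C, hBC, hcoe⟩ := exists_pair hcard
  obtain ⟨A, _, _, hKc, hcr⟩ := exists_apex hK h hBC hcoe
  refine (convexHull_subset_closure_openEdge hcard).trans (closure_minimal ?_ isClosed_frontier)
  intro x hx
  refine ⟨hT.convexHull_subset hK (convexHull_mono (by exact_mod_cast h) hx.1), ?_⟩
  rw [hΩ.isOpen.interior_eq, ← hΩ.interior_closure, mem_interior_iff_mem_nhds]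
  intro hnhds
  have hother : ∀ᶠ y in 𝓝 x, ∀ K' ∈ hT.tris.erase K, y ∉ convexHull ℝ (K' : Set Plane) := by
    rw [eventually_all_finset]
    intro K' hK'
    rw [Finset.mem_erase, hT.mem_tris] at hK'
    refine (isCompact_hull K').isClosed.isOpen_compl.mem_nhds fun hxK' => hK'.1 ?_
    exact huniq K' hK'.2 (subset_of_mem_openEdge hface hcard hK'.2.1 hx hxK')
  have hnhds' : ∀ᶠ y in 𝓝 x, y ∈ closure Ω := hnhds
  -- The sign −1 selects points beyond the edge, where the coordinate of A is negative.
  obtain ⟨y, hy, hy1, hy2⟩ := ((frequently_side hBC hcoe hcr hx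
    (neg_ne_zero.2 one_ne_zero)).and_eventually (hother.and hnhds')).exists
  rw [hT.closure_eq] at hy2
  simp only [Set.mem_iUnion, exists_prop] at hy2
  obtain ⟨K', hK', hyK'⟩ := hy2
  by_cases hKK : K' = K
  · subst hKK
    rw [hKc, mem_convexHull_triangle hcr] at hyK'
    linarith [hyK'.1]
  · exact hy1 K' (Finset.mem_erase.2 ⟨hKK, hK'⟩) hyK'

theorem openEdge_subset_frontier {e : Finset Plane} (he : e ∈ boundaryEdges Ω T) :
    openEdge e ⊆ frontier Ω := Set.sdiff_subset.trans he.2.2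

/-- An edge is either a boundary edge, belonging to exactly one triangle, or an interior edge,
belonging to exactly two triangles. -/
theorem IsTriangulation.edge_cases (hT : IsTriangulation Ω T) (hΩ : IsPolygonalDomain Ω)
    {e : Finset Plane} (he : e ∈ T.faces) (hcard : e.card = 2) :
    (e ∈ boundaryEdges Ω T ∧ ∃ K ∈ triangles T, e ⊆ K ∧ ∀ K' ∈ triangles T, e ⊆ K' → K' = K) ∨
    (openEdge e ⊆ Ω ∧ ∃ K ∈ triangles T, ∃ K' ∈ triangles T, K ≠ K' ∧ e ⊆ K ∧ e ⊆ K' ∧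
      ∀ K'' ∈ triangles T, e ⊆ K'' → K'' = K ∨ K'' = K') := by
  obtain ⟨K, hK, heK⟩ := hT.exists_triangle he
  by_cases h : ∀ K' ∈ triangles T, e ⊆ K' → K' = K
  · exact Or.inl ⟨hT.mem_boundaryEdges hΩ hcard hK heK h, K, hK, heK, h⟩
  · push Not at h
    obtain ⟨K', hK', heK', hne⟩ := h
    exact Or.inr ⟨hT.openEdge_subset hΩ hcard hK hK' hne.symm heK heK', K, hK, K', hK', hne.symm,
      heK, heK', fun K'' hK'' h'' => eq_or_eq_of_common_edge hcard hK hK' hne.symm hK'' heK heK' h''⟩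

theorem IsPolygonalDomain.notMem_frontier (hΩ : IsPolygonalDomain Ω) {x : Plane} (hx : x ∈ Ω) :
    x ∉ frontier Ω := fun h => h.2 (by rwa [hΩ.isOpen.interior_eq])

/-- The boundary is the union of the boundary edges, up to finitely many points. -/
theorem IsTriangulation.frontier_subset (hT : IsTriangulation Ω T) (hΩ : IsPolygonalDomain Ω) :
    frontier Ω ⊆ (⋃ e ∈ boundaryEdges Ω T, openEdge e) ∪ ⋃ K ∈ hT.tris, (K : Set Plane) := by
  classical
  intro x hx
  have hx1 := frontier_subset_closure hx
  rw [hT.closure_eq] at hx1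
  simp only [Set.mem_iUnion, exists_prop] at hx1
  obtain ⟨K, hK, hxK⟩ := hx1
  by_cases hxv : x ∈ K
  · refine Or.inr ?_
    simp only [Set.mem_iUnion, exists_prop]
    exact ⟨K, hK, hxv⟩
  have hKt := hT.mem_tris.1 hK
  have hxo : x ∉ openTriangle K := fun h => hΩ.notMem_frontier (hT.openTriangle_subset hΩ hKt h) hx
  -- A vanishing coordinate places x on the opposite edge. That edge cannot be interior, since its
  -- relative interior would then be contained in the open set Ω.
  have key : ∀ A ∈ K, ∀ B C : Plane, (K : Set Plane) = {A, B, C} → cross (B - A) (C - A) ≠ 0 →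
      bary A B C x = 0 → x ∈ (⋃ e ∈ boundaryEdges Ω T, openEdge e) := by
    intro A hA B C hcoe hcr h0
    have hcard := erase_card hKt hA
    have hfaces := edge_mem_faces hKt (Finset.erase_subset A K) hcard
    have hmem : x ∈ openEdge (K.erase A) := by
      refine ⟨?_, fun h => hxv (Finset.mem_of_mem_erase h)⟩
      have hx' := bary_smul_add A B C hcr x
      rw [h0, zero_smul, zero_add] at hx'
      have hsum := bary_add A B C hcr x
      rw [hcoe, mem_convexHull_triangle hcr] at hxK
      have hAB : A ≠ B := by rintro rfl; simp [cross] at hcr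
      have hAC : A ≠ C := by rintro rfl; simp [cross] at hcr
      have hBm : B ∈ ((K.erase A : Finset Plane) : Set Plane) := by
        rw [Finset.coe_erase, hcoe]; simp [hAB.symm]
      have hCm : C ∈ ((K.erase A : Finset Plane) : Set Plane) := by
        rw [Finset.coe_erase, hcoe]; simp [hAC.symm]
      rw [← hx']
      exact (convex_convexHull ℝ _) (subset_convexHull ℝ _ hBm) (subset_convexHull ℝ _ hCm)
        hxK.2.1 hxK.2.2 (by linarith)
    simp only [Set.mem_iUnion, exists_prop]
    rcases hT.edge_cases hΩ hfaces hcard with ⟨hb, _⟩ | ⟨hi, _⟩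
    · exact ⟨_, hb, hmem⟩
    · exact absurd hx (hΩ.notMem_frontier (hi hmem))
  obtain ⟨A, hA⟩ : K.Nonempty := Finset.card_pos.1 (by rw [hKt.2]; norm_num)
  obtain ⟨B, C, hcoe, hcr⟩ := exists_apex_of_mem hKt hA
  have hB : cross (C - B) (A - B) ≠ 0 := by rwa [cross_rotate]
  have hC : cross (A - C) (B - C) ≠ 0 := by rwa [cross_rotate, cross_rotate]
  have e1 : ({A, B, C} : Set Plane) = {B, C, A} := by
    ext x; simp; tauto
  have e2 : ({A, B, C} : Set Plane) = {C, A, B} := by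
    ext x; simp; tauto
  rw [openTriangle, hcoe, mem_interior_triangle hcr] at hxo
  have hxK' := hxK
  rw [hcoe, mem_convexHull_triangle hcr] at hxK'
  refine Or.inl ?_
  by_cases h1 : bary A B C x = 0
  · exact key A hA B C hcoe hcr h1
  by_cases h2 : bary B C A x = 0
  · exact key B (by rw [← Finset.mem_coe, hcoe]; simp) C A (hcoe.trans e1) hB h2
  by_cases h3 : bary C A B x = 0
  · exact key C (by rw [← Finset.mem_coe, hcoe]; simp) A B (hcoe.trans e2) hC h3
  · exact absurd ⟨lt_of_le_of_ne hxK'.1 (Ne.symm h1), lt_of_le_of_ne hxK'.2.1 (Ne.symm h2),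
      lt_of_le_of_ne hxK'.2.2 (Ne.symm h3)⟩ hxo

end Triangulation


/-! ### `L²` norms -/

section L2

variable {F : Type*} [NormedAddCommGroup F]

theorem l2norm_eq {A : Set Plane} {g : Plane → F} (hg : MemLp g 2 (volume.restrict A)) :
    l2norm A g = (eLpNorm g 2 (volume.restrict A)).toReal := by
  rw [l2norm, hg.eLpNorm_eq_integral_rpow_norm two_ne_zero ENNReal.ofNat_ne_top,
    ENNReal.toReal_ofReal (by positivity), Real.sqrt_eq_rpow]
  simp

theorem l2norm_nonneg (A : Set Plane) (g : Plane → F) : 0 ≤ l2norm A g := Real.sqrt_nonneg _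

theorem l2norm_congr {A : Set Plane} {g g' : Plane → F} (h : g =ᵐ[volume.restrict A] g') :
    l2norm A g = l2norm A g' := by
  rw [l2norm, l2norm]
  congr 1
  exact integral_congr_ae (h.mono fun x hx => by simp only [hx])

theorem norm_toLp_eq_l2norm {A : Set Plane} {g : Plane → F}
    (hg : MemLp g 2 (volume.restrict A)) : ‖hg.toLp g‖ = l2norm A g := by
  rw [Lp.norm_toLp, l2norm_eq hg]

theorem tendsto_l2norm_iff {A : Set Plane} {f : ℕ → Plane → F}
    (hf : ∀ n, MemLp (f n) 2 (volume.restrict A)) :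
    Tendsto (fun n => l2norm A (f n)) atTop (𝓝 0) ↔
      Tendsto (fun n => eLpNorm (f n) 2 (volume.restrict A)) atTop (𝓝 0) := by
  simp_rw [fun n => l2norm_eq (hf n)]
  rw [← ENNReal.toReal_zero, ENNReal.tendsto_toReal_iff (fun n => (hf n).2.ne) (by simp)]

theorem tendsto_integral_inner [InnerProductSpace ℝ F] {μ : Measure Plane} {f : ℕ → Plane → F}
    {g h : Plane → F} (hf : ∀ n, MemLp (f n) 2 μ) (hg : MemLp g 2 μ) (hh : MemLp h 2 μ)
    (hlim : Tendsto (fun n => eLpNorm (fun x => f n x - g x) 2 μ) atTop (𝓝 0)) :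
    Tendsto (fun n => ∫ x, inner ℝ (f n x) (h x) ∂μ) atTop (𝓝 (∫ x, inner ℝ (g x) (h x) ∂μ)) := by
  have key : ∀ {g : Plane → F} (hg : MemLp g 2 μ),
      ∫ x, inner ℝ (g x) (h x) ∂μ = inner ℝ (hg.toLp g) (hh.toLp h) := by
    intro g hg
    rw [L2.inner_def]
    refine integral_congr_ae ?_
    filter_upwards [hg.coeFn_toLp, hh.coeFn_toLp] with x h1 h2
    rw [h1, h2]
  simp_rw [fun n => key (hf n), key hg]
  exact ((Lp.tendsto_Lp_iff_tendsto_eLpNorm'' f hf g hg).2 hlim).inner tendsto_const_nhds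

theorem tendsto_integral_mul {μ : Measure Plane} {f : ℕ → Plane → ℝ}
    {g h : Plane → ℝ} (hf : ∀ n, MemLp (f n) 2 μ) (hg : MemLp g 2 μ) (hh : MemLp h 2 μ)
    (hlim : Tendsto (fun n => eLpNorm (fun x => f n x - g x) 2 μ) atTop (𝓝 0)) :
    Tendsto (fun n => ∫ x, h x * f n x ∂μ) atTop (𝓝 (∫ x, h x * g x ∂μ)) := by
  simpa using tendsto_integral_inner hf hg hh hlim

theorem memLp_of_continuousOn {μ : Measure Plane} {S : Set Plane} {g : Plane → F}
    (hS : IsCompact S) (hμ : μ S < ⊤) (hg : ContinuousOn g S) (p : ENNReal) :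
    MemLp g p (μ.restrict S) := by
  have : IsFiniteMeasure (μ.restrict S) := ⟨by rwa [Measure.restrict_apply_univ]⟩
  obtain ⟨M, hM⟩ := hS.exists_bound_of_continuousOn hg
  exact MemLp.of_bound (hg.aestronglyMeasurable_of_isCompact hS hS.isClosed.measurableSet) M
    ((ae_restrict_mem hS.isClosed.measurableSet).mono hM)

theorem integrable_inner_of_memLp [InnerProductSpace ℝ F] {μ : Measure Plane} {f g : Plane → F}
    (hf : MemLp f 2 μ) (hg : MemLp g 2 μ) : Integrable (fun x => inner ℝ (f x) (g x)) μ := by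
  refine (hf.norm.integrable_mul hg.norm).mono' (hf.1.inner hg.1) (Eventually.of_forall fun x => ?_)
  exact norm_inner_le_norm _ _

end L2

/-! ### Weak gradients of smooth functions -/

theorem HasWeakGrad.mono {U V : Set Plane} (hV : MeasurableSet V)
    (hUV : U ⊆ V) {v : Plane → ℝ}
    {G : Plane → Plane} (h : HasWeakGrad V v G) : HasWeakGrad U v G := by
  intro φ hφ e
  have := h φ (hφ.mono hUV) e
  rw [setIntegral_eq_of_subset_of_forall_sdiff_eq_zero hV hUV,
    setIntegral_eq_of_subset_of_forall_sdiff_eq_zero hV hUV] at this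
  · exact this
  · intro x hx; rw [hφ.eq_zero hx.2, mul_zero]
  · intro x hx; rw [hφ.fderiv_eq_zero hx.2]; simp

theorem inner_gradient (f : Plane → ℝ) (x p : Plane) :
    inner ℝ (gradient f x) p = fderiv ℝ f x p := by
  rw [gradient, InnerProductSpace.toDual_symm_apply]

theorem continuous_gradient {v : Plane → ℝ} (hv : ContDiff ℝ 1 v) : Continuous (gradient v) :=
  (InnerProductSpace.toDual ℝ Plane).symm.continuous.comp (hv.continuous_fderiv one_ne_zero)

theorem hasWeakGrad_of_contDiff {U : Set Plane} {v : Plane → ℝ} (hv : ContDiff ℝ 1 v) :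
    HasWeakGrad U v (gradient v) := by
  intro φ hφ e
  have hc : ∀ {g : Plane → ℝ}, Continuous g → HasCompactSupport g → Integrable g := fun h1 h2 =>
    h1.integrable_of_hasCompactSupport h2
  have c1 : Continuous fun x => fderiv ℝ v x e :=
    (hv.continuous_fderiv one_ne_zero).clm_apply continuous_const
  have c2 : Continuous fun x => fderiv ℝ φ x e :=
    hφ.continuous_fderiv.clm_apply continuous_const
  have s2 : HasCompactSupport fun x => fderiv ℝ φ x e := hφ.2.1.fderiv_apply ℝ e
  rw [setIntegral_eq_integral_of_forall_compl_eq_zero (fun x hx => by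
      rw [hφ.fderiv_eq_zero hx]; simp),
    setIntegral_eq_integral_of_forall_compl_eq_zero (fun x hx => by rw [hφ.eq_zero hx, mul_zero])]
  simp_rw [inner_gradient]
  exact integral_mul_fderiv_eq_neg_fderiv_mul_of_integrable
    (hc (c1.mul hφ.continuous) hφ.2.1.mul_left) (hc (hv.continuous.mul c2) s2.mul_left)
    (hc (hv.continuous.mul hφ.continuous) hφ.2.1.mul_left)
    (fun x _ => hv.differentiable (by simp) x) (fun x _ => hφ.differentiable x)

/-- A continuously differentiable function, as an element of `H¹(U)` for bounded `U`. -/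
noncomputable def H1.ofContDiff (U : Set Plane) (hU : Bornology.IsBounded U) (v : Plane → ℝ)
    (hv : ContDiff ℝ 1 v) : H1 U where
  toFun := v
  grad := gradient v
  memLp_toFun := (memLp_of_continuousOn hU.isCompact_closure
    hU.isCompact_closure.measure_lt_top hv.continuous.continuousOn 2).mono_measure
      (Measure.restrict_mono subset_closure le_rfl)
  memLp_grad := (memLp_of_continuousOn hU.isCompact_closure
    hU.isCompact_closure.measure_lt_top (continuous_gradient hv).continuousOn 2).mono_measure
      (Measure.restrict_mono subset_closure le_rfl)
  hasWeakGrad := hasWeakGrad_of_contDiff hv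

theorem exists_bump {U : Set Plane} {x : Plane} (hU : U ∈ 𝓝 x) :
    ∃ φ : Plane → ℝ, IsTestFunction U φ ∧ (∀ y, 0 ≤ φ y) ∧ φ x = 1 := by
  obtain ⟨φ, h1, h2, h3, h4, h5⟩ := exists_contDiff_tsupport_subset (n := ⊤) hU
  exact ⟨φ, ⟨h3, h2, h1⟩, fun y => (h4 ⟨y, rfl⟩).1, h5⟩

/-! ### Connectedness through adjacent triangles -/

/-- The punctured plane is connected in dimension two, and a homeomorphism from the plane to the
ball takes the origin to the centre. -/
theorem isPreconnected_ball_diff_center (p : Plane) {r : ℝ} (hr : 0 < r) :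
    IsPreconnected (Metric.ball p r \ {p}) := by
  have hrank : 1 < Module.rank ℝ Plane := by
    rw [← Module.finrank_eq_rank, finrank_euclideanSpace_fin]; norm_num
  have h1 := (isConnected_compl_singleton_of_one_lt_rank hrank (0 : Plane)).isPreconnected
  have h2 := h1.image (OpenPartialHomeomorph.univBall p r)
    (OpenPartialHomeomorph.continuous_univBall p r).continuousOn
  have hinj : Function.Injective (OpenPartialHomeomorph.univBall p r) := by
    rw [← Set.injOn_univ, ← OpenPartialHomeomorph.univBall_source p r]
    exact (OpenPartialHomeomorph.univBall p r).injOn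
  rw [Set.image_compl_eq_range_sdiff_image hinj, Set.image_singleton,
    OpenPartialHomeomorph.univBall_apply_zero, ← Set.image_univ,
    ← OpenPartialHomeomorph.univBall_source p r,
    (OpenPartialHomeomorph.univBall p r).image_source_eq_target,
    OpenPartialHomeomorph.univBall_target p hr] at h2
  exact h2

variable {Ω : Set Plane} {T : Geometry.SimplicialComplex ℝ Plane}

/-- Without a common edge the triangles share at most one vertex, and by the face-to-face property
they meet in nothing else. -/
theorem mem_of_mem_hull_of_not_adjacent {K K' : Finset Plane} (hK : K ∈ triangles T)
    (hK' : K' ∈ triangles T) 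
    (hadj : ∀ e : Finset Plane, e.card = 2 → e ⊆ K → ¬ e ⊆ K') {x : Plane}
    (hx : x ∈ convexHull ℝ (K : Set Plane)) (hx' : x ∈ convexHull ℝ (K' : Set Plane)) : x ∈ K := by
  classical
  have h1 := T.inter_subset_convexHull hK.1 hK'.1 ⟨hx, hx'⟩
  rw [← Finset.coe_inter] at h1
  have h2 : (K ∩ K').card ≤ 1 := by
    by_contra h
    obtain ⟨e, he, hc⟩ := Finset.exists_subset_card_eq (n := 2) (s := K ∩ K') (by omega)
    exact hadj e hc (he.trans Finset.inter_subset_left) (he.trans Finset.inter_subset_right)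
  rcases Nat.le_one_iff_eq_zero_or_eq_one.1 h2 with h | h
  · rw [Finset.card_eq_zero] at h
    rw [h] at h1
    simp at h1
  · obtain ⟨B, hB⟩ := Finset.card_eq_one.1 h
    rw [hB] at h1
    simp only [Finset.coe_singleton, convexHull_singleton, Set.mem_singleton_iff] at h1
    have : B ∈ K ∩ K' := by rw [hB]; simp
    rw [h1]
    exact (Finset.mem_inter.1 this).1

theorem vertex_notMem_openTriangle {K : Finset Plane} (hK : K ∈ triangles T) {x : Plane}
    (hx : x ∈ K) : x ∉ openTriangle K := by
  intro h
  have hs : ({x} : Finset Plane) ∈ T.faces :=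
    T.down_closed hK.1 (by simpa using hx) (Finset.singleton_nonempty x)
  have := Finset.card_le_card (subset_of_mem_openTriangle hK hs h (by simp))
  rw [hK.2] at this
  simp at this

theorem nonempty_ball_inter {K : Finset Plane} (hK : K ∈ triangles T) {x : Plane}
    (hx : x ∈ K) {r : ℝ} (hr : 0 < r) :
    ((Metric.ball x r \ {x}) ∩ convexHull ℝ (K : Set Plane)).Nonempty := by
  have h1 := convexHull_subset_closure_openTriangle hK (subset_convexHull ℝ _ hx)
  obtain ⟨y, hy, hy'⟩ := mem_closure_iff_nhds.1 h1 _ (Metric.ball_mem_nhds x hr)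
  refine ⟨y, ⟨hy, ?_⟩, interior_subset hy'⟩
  rintro rfl
  exact vertex_notMem_openTriangle hK hx hy'

/-- A property of triangles which is inherited by adjacent triangles holds for all triangles or
for none. -/
theorem IsTriangulation.forall_of_adjacent (hT : IsTriangulation Ω T) (hΩ : IsPolygonalDomain Ω)
    {P : Finset Plane → Prop} {K₀ : Finset Plane} (hK₀ : K₀ ∈ triangles T) (h₀ : P K₀)
    (hstep : ∀ K ∈ triangles T, ∀ K' ∈ triangles T, K ≠ K' → ∀ e : Finset Plane, e.card = 2 →
      e ⊆ K → e ⊆ K' → P K → P K') : ∀ K ∈ triangles T, P K := by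
  classical
  intro K₁ hK₁
  by_contra hP₁
  set S := (hT.tris.filter P) with hS
  set S' := (hT.tris.filter fun K => ¬ P K) with hS'
  set A : Set Plane := ⋃ K ∈ S, convexHull ℝ (K : Set Plane) with hA
  set B : Set Plane := ⋃ K ∈ S', convexHull ℝ (K : Set Plane) with hB
  have hclosed : ∀ S : Finset (Finset Plane), IsClosed (⋃ K ∈ S, convexHull ℝ (K : Set Plane)) :=
    fun S => (S.isCompact_biUnion fun K _ => isCompact_hull K).isClosed
  have hcover : closure Ω ⊆ A ∪ B := by
    rw [hT.closure_eq]
    refine Set.iUnion₂_subset fun K hK => ?_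
    by_cases hP : P K
    · exact (Set.subset_biUnion_of_mem (u := fun K : Finset Plane => convexHull ℝ (K : Set Plane))
        (Finset.mem_coe.2 (Finset.mem_filter.2 ⟨hK, hP⟩))).trans Set.subset_union_left
    · exact (Set.subset_biUnion_of_mem (u := fun K : Finset Plane => convexHull ℝ (K : Set Plane))
        (Finset.mem_coe.2 (Finset.mem_filter.2 ⟨hK, hP⟩))).trans Set.subset_union_right
  have hmemA : ∀ K ∈ triangles T, P K → convexHull ℝ (K : Set Plane) ⊆ A := fun K hK hP =>
    Set.subset_biUnion_of_mem (u := fun K : Finset Plane => convexHull ℝ (K : Set Plane))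
        (Finset.mem_coe.2 (Finset.mem_filter.2 ⟨hT.mem_tris.2 hK, hP⟩))
  have hmemB : ∀ K ∈ triangles T, ¬ P K → convexHull ℝ (K : Set Plane) ⊆ B := fun K hK hP =>
    Set.subset_biUnion_of_mem (u := fun K : Finset Plane => convexHull ℝ (K : Set Plane))
        (Finset.mem_coe.2 (Finset.mem_filter.2 ⟨hT.mem_tris.2 hK, hP⟩))
  -- Triangles from the two classes have no common edge, so the two closed unions meet only at
  -- vertices.
  have hAB : ∀ x ∈ A ∩ B, (∃ K ∈ triangles T, P K ∧ x ∈ K) ∧ ∃ K ∈ triangles T, ¬ P K ∧ x ∈ K := by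
    rintro x ⟨hxA, hxB⟩
    simp only [hA, hB, hS, hS', Set.mem_iUnion, exists_prop, Finset.mem_filter, hT.mem_tris]
      at hxA hxB
    obtain ⟨K, ⟨hK, hPK⟩, hxK⟩ := hxA
    obtain ⟨K', ⟨hK', hPK'⟩, hxK'⟩ := hxB
    have hne : K ≠ K' := by rintro rfl; exact hPK' hPK
    refine ⟨⟨K, hK, hPK, ?_⟩, K', hK', hPK', ?_⟩
    · exact mem_of_mem_hull_of_not_adjacent hK hK'
        (fun e hc h1 h2 => hPK' (hstep K hK K' hK' hne e hc h1 h2 hPK)) hxK hxK'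
    · exact mem_of_mem_hull_of_not_adjacent hK' hK
        (fun e hc h1 h2 => hPK' (hstep K hK K' hK' hne e hc h2 h1 hPK)) hxK' hxK
  have hpre := isPreconnected_closed_iff.1 hΩ.isConnected.isPreconnected A B (hclosed S)
    (hclosed S') (subset_closure.trans hcover)
  obtain ⟨x₀, hx₀⟩ := openTriangle_nonempty hK₀
  obtain ⟨x₁, hx₁⟩ := openTriangle_nonempty hK₁
  obtain ⟨p, hpΩ, hp⟩ := hpre
    ⟨x₀, hT.openTriangle_subset hΩ hK₀ hx₀, hmemA K₀ hK₀ h₀ (interior_subset hx₀)⟩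
    ⟨x₁, hT.openTriangle_subset hΩ hK₁ hx₁, hmemB K₁ hK₁ hP₁ (interior_subset hx₁)⟩
  obtain ⟨⟨K, hK, hPK, hpK⟩, K', hK', hPK', hpK'⟩ := hAB p hp
  -- Connectedness of Ω gives a common vertex p in Ω. A small disc about p that contains no other
  -- vertex stays connected after p is removed, so the two unions meet there again; this would be at
  -- a vertex different from p.
  set V : Set Plane := (⋃ K ∈ hT.tris, (K : Set Plane)) \ {p} with hV
  have hVfin : V.Finite := (hT.tris.finite_toSet.biUnion fun K _ => K.finite_toSet).sdiff
  have hnhds : Ω ∩ Vᶜ ∈ 𝓝 p := Filter.inter_mem (hΩ.isOpen.mem_nhds hpΩ)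
    (hVfin.isClosed.isOpen_compl.mem_nhds (by simp [hV]))
  obtain ⟨r, hr, hball⟩ := Metric.mem_nhds_iff.1 hnhds
  have hpre2 := isPreconnected_closed_iff.1 (isPreconnected_ball_diff_center p hr) A B (hclosed S)
    (hclosed S') (fun y hy => hcover (subset_closure (hball hy.1).1))
  obtain ⟨y, hy, hyAB⟩ := hpre2
    ((nonempty_ball_inter hK hpK hr).mono (Set.inter_subset_inter_right _ (hmemA K hK hPK)))
    ((nonempty_ball_inter hK' hpK' hr).mono (Set.inter_subset_inter_right _ (hmemB K' hK' hPK')))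
  obtain ⟨⟨K'', hK'', _, hyK''⟩, _⟩ := hAB y hyAB
  refine (hball hy.1).2 ⟨?_, hy.2⟩
  simp only [Set.mem_iUnion, exists_prop]
  exact ⟨K'', hT.mem_tris.2 hK'', hyK''⟩


/-! ### Fluxes of piecewise affine fields -/

open Classical in
/-- The outer unit normal to the edge of `K` opposite to the vertex `A`. -/
noncomputable def outerNormal (K : Finset Plane) (A : Plane) : Plane :=
  if h : K.card = 3 ∧ AffineIndependent ℝ ((↑) : K → Plane) then
    (exists_green_normals h.1 h.2).choose A else 0

open Classical in
/-- The constant value of the normal component of `a + c x` on the edge of `K` opposite to `A`. -/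
noncomputable def flux (K : Finset Plane) (A a : Plane) (c : ℝ) : ℝ :=
  inner ℝ (outerNormal K A) (a + c • Classical.epsilon fun x => x ∈ K.erase A)

variable {Ω : Set Plane} {T : Geometry.SimplicialComplex ℝ Plane}

open Classical in
theorem isOuterNormal_outerNormal {K : Finset Plane} (hK : K ∈ triangles T) {A : Plane}
    (hA : A ∈ K) : IsOuterNormal K (K.erase A) (outerNormal K A) := by
  have h : K.card = 3 ∧ AffineIndependent ℝ ((↑) : K → Plane) := ⟨hK.2, T.indep hK.1⟩
  rw [outerNormal, dif_pos h]
  exact (exists_green_normals h.1 h.2).choose_spec.1 A hA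

theorem IsOuterNormal.inner_eq {K e : Finset Plane} {n : Plane} (h : IsOuterNormal K e n)
    {x y : Plane} (hx : x ∈ convexHull ℝ (e : Set Plane)) (hy : y ∈ e) :
    inner ℝ n x = inner ℝ n y := by
  have hconv : Convex ℝ {z : Plane | inner ℝ n z = inner ℝ n y} := by
    intro z hz w hw p q _ _ hpq
    simp only [Set.mem_ofPred_eq, inner_add_right, inner_smul_right] at hz hw ⊢
    rw [hz, hw, ← add_mul, hpq, one_mul]
  refine convexHull_min (s := (e : Set Plane)) (fun z hz => ?_) hconv hx
  have := h.2.1 z hz y hy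
  rw [inner_sub_right] at this
  exact sub_eq_zero.1 this

open Classical in
theorem inner_eq_flux {K : Finset Plane} (hK : K ∈ triangles T) {A : Plane} (hA : A ∈ K)
    (a : Plane) (c : ℝ) {x : Plane} (hx : x ∈ convexHull ℝ ((K.erase A : Finset Plane) : Set Plane)) :
    inner ℝ (outerNormal K A) (a + c • x) = flux K A a c := by
  have hne : ∃ x, x ∈ K.erase A := Finset.card_pos.1 (by rw [erase_card hK hA]; norm_num)
  rw [flux, inner_add_right, inner_add_right, inner_smul_right, inner_smul_right,
    (isOuterNormal_outerNormal hK hA).inner_eq hx (Classical.epsilon_spec hne)]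

open Classical in
theorem green_triangle {K : Finset Plane} (hK : K ∈ triangles T) {φ : Plane → ℝ}
    {G : Plane → Plane} (hφ : ContinuousOn φ (convexHull ℝ (K : Set Plane)))
    (hG : IntegrableOn G (openTriangle K)) (hw : HasWeakGrad (openTriangle K) φ G) (a : Plane)
    (c : ℝ) : ∫ x in openTriangle K, (inner ℝ (G x) (a + c • x) + 2 * c * φ x) =
      ∑ A ∈ K, flux K A a c * ∫ x in openEdge (K.erase A), φ x
        ∂(Measure.hausdorffMeasure 1 : Measure Plane) := by
  have h : K.card = 3 ∧ AffineIndependent ℝ ((↑) : K → Plane) := ⟨hK.2, T.indep hK.1⟩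
  rw [(exists_green_normals h.1 h.2).choose_spec.2 φ G hφ hG hw a c]
  refine Finset.sum_congr rfl fun A hA => ?_
  rw [← integral_const_mul]
  refine setIntegral_congr_fun (measurableSet_openEdge _) fun x hx => ?_
  have : (exists_green_normals h.1 h.2).choose A = outerNormal K A := by
    rw [outerNormal, dif_pos h]
  simp only [this]
  rw [inner_eq_flux hK hA a c hx.1, mul_comm]

/-- `p` is the field `a_K + c_K x` and `d` its divergence `2 c_K` on each triangle `K`. -/
structure IsPiecewiseRT (T : Geometry.SimplicialComplex ℝ Plane) (p : Plane → Plane)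
    (d : Plane → ℝ) (a : Finset Plane → Plane) (c : Finset Plane → ℝ) : Prop where
  field_eq : ∀ K ∈ triangles T, ∀ x ∈ openTriangle K, p x = a K + c K • x
  div_eq : ∀ K ∈ triangles T, ∀ x ∈ openTriangle K, d x = 2 * c K

/-- Up to a null set the function is a finite sum of continuous functions cut off to triangles, so
its values on the edges do not matter. -/
theorem IsTriangulation.memLp_of_piecewise {F : Type*} [NormedAddCommGroup F]
    (hT : IsTriangulation Ω T) (hΩ : IsPolygonalDomain Ω)
    {f : Plane → F} (h : ∀ K ∈ triangles T, ∃ g : Plane → F, Continuous g ∧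
      ∀ x ∈ openTriangle K, f x = g x) : MemLp f 2 (volume.restrict Ω) := by
  classical
  choose! g hg hfg using h
  have h1 : f =ᵐ[volume.restrict Ω]
      fun x => ∑ K ∈ hT.tris, (openTriangle K).indicator (g K) x := by
    refine hT.ae_of_forall_openTriangle hΩ fun K hK x hx => ?_
    change f x = ∑ K ∈ hT.tris, (openTriangle K).indicator (g K) x
    rw [Finset.sum_eq_single_of_mem K (hT.mem_tris.2 hK), Set.indicator_of_mem hx, hfg K hK x hx]
    intro K' hK' hne
    exact Set.indicator_of_notMem (fun h => Set.disjoint_left.1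
      (disjoint_openTriangle (hT.mem_tris.1 hK') hK hne) h hx) _
  refine (memLp_congr_ae h1).2 (memLp_finsetSum _ fun K hK => ?_)
  rw [memLp_indicator_iff_restrict (isOpen_openTriangle K).measurableSet]
  refine (memLp_of_continuousOn (isCompact_hull K) (μ := volume.restrict Ω) ?_
    (hg K (hT.mem_tris.1 hK)).continuousOn 2).mono_measure
      (Measure.restrict_mono interior_subset le_rfl)
  exact (Measure.restrict_apply_le _ _).trans_lt (isCompact_hull K).measure_lt_top

theorem IsPiecewiseRT.memLp_field {p : Plane → Plane} {d : Plane → ℝ} {a : Finset Plane → Plane}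
    {c : Finset Plane → ℝ} (h : IsPiecewiseRT T p d a c) (hT : IsTriangulation Ω T)
    (hΩ : IsPolygonalDomain Ω) : MemLp p 2 (volume.restrict Ω) :=
  hT.memLp_of_piecewise hΩ fun K hK => ⟨fun x => a K + c K • x, by fun_prop, h.field_eq K hK⟩

theorem IsPiecewiseRT.memLp_div {p : Plane → Plane} {d : Plane → ℝ} {a : Finset Plane → Plane}
    {c : Finset Plane → ℝ} (h : IsPiecewiseRT T p d a c) (hT : IsTriangulation Ω T)
    (hΩ : IsPolygonalDomain Ω) : MemLp d 2 (volume.restrict Ω) :=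
  hT.memLp_of_piecewise hΩ fun K hK => ⟨fun _ => 2 * c K, by fun_prop, h.div_eq K hK⟩

theorem IsPiecewiseRT.integral_add {p : Plane → Plane} {d : Plane → ℝ} {a : Finset Plane → Plane}
    {c : Finset Plane → ℝ} (h : IsPiecewiseRT T p d a c) (hT : IsTriangulation Ω T)
    (hΩ : IsPolygonalDomain Ω) (v : H1 Ω) :
    ∫ x in Ω, (inner ℝ (v.grad x) (p x) + d x * v.toFun x) =
      (∫ x in Ω, inner ℝ (v.grad x) (p x)) + ∫ x in Ω, d x * v.toFun x :=
  MeasureTheory.integral_add (integrable_inner_of_memLp v.memLp_grad (h.memLp_field hT hΩ))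
    ((h.memLp_div hT hΩ).integrable_mul v.memLp_toFun)

theorem IsTriangulation.measure_lt_top (hT : IsTriangulation Ω T) : volume Ω < ⊤ :=
  (measure_mono subset_closure).trans_lt hT.isCompact_closure.measure_lt_top

theorem IsTriangulation.isBounded (hT : IsTriangulation Ω T) : Bornology.IsBounded Ω :=
  hT.isCompact_closure.isBounded.subset subset_closure

theorem IsTriangulation.isFiniteMeasure (hT : IsTriangulation Ω T) :
    IsFiniteMeasure (volume.restrict Ω) :=
  ⟨by rw [Measure.restrict_apply_univ]; exact hT.measure_lt_top⟩

/-- The total flux through the edge `e` out of the adjacent triangles. -/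
noncomputable def IsTriangulation.edgeFlux (hT : IsTriangulation Ω T) (a : Finset Plane → Plane)
    (c : Finset Plane → ℝ) (e : Finset Plane) : ℝ :=
  open Classical in ∑ K ∈ hT.tris, ∑ A ∈ K, if K.erase A = e then flux K A (a K) (c K) else 0

/-- The formulas on the triangles are added and the sum is regrouped by edges. No compatibility of
the field across edges enters yet. -/
theorem IsPiecewiseRT.green {p : Plane → Plane} {d : Plane → ℝ} {a : Finset Plane → Plane}
    {c : Finset Plane → ℝ} (h : IsPiecewiseRT T p d a c) (hT : IsTriangulation Ω T)
    (hΩ : IsPolygonalDomain Ω) (φ : H1 Ω) (hφ : ContinuousOn φ.toFun (closure Ω)) :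
    ∫ x in Ω, (inner ℝ (φ.grad x) (p x) + d x * φ.toFun x) =
      ∑ e ∈ hT.edges, hT.edgeFlux a c e * ∫ x in openEdge e, φ.toFun x
        ∂(Measure.hausdorffMeasure 1 : Measure Plane) := by
  classical
  have : IsFiniteMeasure (volume.restrict Ω) := hT.isFiniteMeasure
  have hint : IntegrableOn (fun x => inner ℝ (φ.grad x) (p x) + d x * φ.toFun x) Ω :=
    (integrable_inner_of_memLp φ.memLp_grad (h.memLp_field hT hΩ)).add
      ((h.memLp_div hT hΩ).integrable_mul φ.memLp_toFun)
  rw [hT.integral_eq_sum hΩ hint]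
  have h1 : ∀ K ∈ hT.tris, ∫ x in openTriangle K, (inner ℝ (φ.grad x) (p x) + d x * φ.toFun x) =
      ∑ A ∈ K, flux K A (a K) (c K) * ∫ x in openEdge (K.erase A), φ.toFun x
        ∂(Measure.hausdorffMeasure 1 : Measure Plane) := by
    intro K hK
    rw [hT.mem_tris] at hK
    rw [← green_triangle hK (hφ.mono (hT.convexHull_subset hK))
      (IntegrableOn.mono_set (φ.memLp_grad.integrable one_le_two) (hT.openTriangle_subset hΩ hK))
      (φ.hasWeakGrad.mono hΩ.isOpen.measurableSet (hT.openTriangle_subset hΩ hK))]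
    refine setIntegral_congr_fun (isOpen_openTriangle K).measurableSet fun x hx => ?_
    simp only [h.field_eq K hK x hx, h.div_eq K hK x hx]
  rw [Finset.sum_congr rfl h1]
  simp only [IsTriangulation.edgeFlux, Finset.sum_mul]
  rw [Finset.sum_comm]
  refine Finset.sum_congr rfl fun K hK => ?_
  rw [Finset.sum_comm]
  refine Finset.sum_congr rfl fun A hA => ?_
  rw [hT.mem_tris] at hK
  have hmem : K.erase A ∈ hT.edges := hT.mem_edges.2
    ⟨edge_mem_faces hK (Finset.erase_subset A K) (erase_card hK hA), erase_card hK hA⟩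
  rw [Finset.sum_eq_single_of_mem _ hmem]
  · simp
  · intro e _ hne
    rw [if_neg hne.symm, zero_mul]

open Classical in
theorem IsTriangulation.edgeFlux_of_boundary (hT : IsTriangulation Ω T) (a : Finset Plane → Plane)
    (c : Finset Plane → ℝ) {K : Finset Plane} {A : Plane} (hK : K ∈ triangles T) (hA : A ∈ K)
    (huniq : ∀ K' ∈ triangles T, K.erase A ⊆ K' → K' = K) :
    hT.edgeFlux a c (K.erase A) = flux K A (a K) (c K) := by
  rw [IsTriangulation.edgeFlux, Finset.sum_eq_single_of_mem K (hT.mem_tris.2 hK)]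
  · rw [Finset.sum_eq_single_of_mem A hA, if_pos rfl]
    intro A' hA' hne
    refine if_neg fun h => hne ?_
    exact Finset.erase_injOn _ (Finset.mem_coe.2 hA') (Finset.mem_coe.2 hA) h
  · intro K' hK' hne
    refine Finset.sum_eq_zero fun A' _ => if_neg fun h => hne ?_
    exact huniq K' (hT.mem_tris.1 hK') (h ▸ Finset.erase_subset A' K')

theorem integral_openEdge_pos {e : Finset Plane} (hcard : e.card = 2) {φ : Plane → ℝ}
    (hφ : Continuous φ) (h0 : ∀ y, 0 ≤ φ y) {x : Plane} (hx : x ∈ openEdge e) (h1 : 0 < φ x) :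
    0 < ∫ x in openEdge e, φ x ∂(Measure.hausdorffMeasure 1 : Measure Plane) := by
  obtain ⟨B, C, hBC, hcoe⟩ := exists_pair hcard
  rw [integral_openEdge hcoe hBC]
  refine mul_pos (dist_pos.2 hBC) ?_
  rw [openEdge_eq_image hcoe hBC] at hx
  obtain ⟨t, ht, rfl⟩ := hx
  rw [← integral_Ioc_eq_integral_Ioo, ← intervalIntegral.integral_of_le zero_le_one]
  exact intervalIntegral.integral_pos zero_lt_one (by fun_prop) (fun _ _ => h0 _)
    ⟨t, ⟨ht.1.le, ht.2.le⟩, h1⟩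

/-- The weak divergence of a piecewise affine field is its piecewise divergence. -/
theorem div_eq_of_hasWeakDiv (hT : IsTriangulation Ω T) (hΩ : IsPolygonalDomain Ω)
    {p : Plane → Plane} {d : Plane → ℝ} {a : Finset Plane → Plane} {c m : Finset Plane → ℝ}
    (hp : ∀ K ∈ triangles T, ∀ x ∈ openTriangle K, p x = a K + c K • x)
    (hd : ∀ K ∈ triangles T, ∀ x ∈ openTriangle K, d x = m K) (hdiv : HasWeakDiv Ω p d)
    {K : Finset Plane} (hK : K ∈ triangles T) : m K = 2 * c K := by
  classical
  obtain ⟨z, hz⟩ := openTriangle_nonempty hK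
  -- A bump inside the open triangle removes all edge terms from Green's formula, leaving 2c − m
  -- times its positive integral.
  obtain ⟨φ, hφ, hφ0, hφ1⟩ := exists_bump ((isOpen_openTriangle K).mem_nhds hz)
  have hsub := hT.openTriangle_subset hΩ hK
  have hφ' : ContDiff ℝ 1 φ := hφ.1.of_le (by simp)
  have h1 := green_triangle hK hφ.continuous.continuousOn
    (((continuous_gradient hφ').continuousOn.integrableOn_compact (isCompact_hull K)).mono_set
      interior_subset) (hasWeakGrad_of_contDiff hφ') (a K) (c K)
  rw [Finset.sum_eq_zero] at h1
  · have h2 := hdiv φ (hφ.mono hsub)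
    rw [setIntegral_eq_of_subset_of_forall_sdiff_eq_zero hΩ.isOpen.measurableSet hsub,
      setIntegral_eq_of_subset_of_forall_sdiff_eq_zero hΩ.isOpen.measurableSet hsub] at h2
    · have e1 : ∫ x in openTriangle K, fderiv ℝ φ x (p x) =
          ∫ x in openTriangle K, inner ℝ (gradient φ x) (a K + c K • x) :=
        setIntegral_congr_fun (isOpen_openTriangle K).measurableSet fun x hx => by
          simp only [inner_gradient, hp K hK x hx]
      have e2 : ∫ x in openTriangle K, d x * φ x = m K * ∫ x in openTriangle K, φ x := by
        rw [← integral_const_mul]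
        exact setIntegral_congr_fun (isOpen_openTriangle K).measurableSet fun x hx => by
          simp only [hd K hK x hx]
      have i1 : ∀ f : Plane → ℝ, Continuous f → IntegrableOn f (openTriangle K) := fun f hf =>
        (hf.continuousOn.integrableOn_compact (isCompact_hull K)).mono_set interior_subset
      rw [integral_add (i1 _ ((continuous_gradient hφ').inner (by fun_prop)))
        (i1 _ (hφ.continuous.const_mul _)), integral_const_mul, ← e1, h2, e2] at h1
      have hpos : 0 < ∫ x in openTriangle K, φ x := by
        rw [setIntegral_eq_integral_of_forall_compl_eq_zero (fun x hx => hφ.eq_zero hx)]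
        exact hφ.continuous.integral_pos_of_hasCompactSupport_nonneg_nonzero hφ.2.1 hφ0
          (by rw [hφ1]; exact one_ne_zero)
      have h3 : (2 * c K - m K) * ∫ x in openTriangle K, φ x = 0 := by linarith
      rcases mul_eq_zero.1 h3 with h | h
      · linarith
      · exact absurd h hpos.ne'
    · intro x hx; rw [hφ.eq_zero hx.2, mul_zero]
    · intro x hx; rw [hφ.fderiv_eq_zero hx.2]; simp
  · intro A hA
    rw [setIntegral_eq_zero_of_forall_eq_zero, mul_zero]
    intro x hx
    refine hφ.eq_zero fun hxK => ?_
    have hcard := erase_card hK hA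
    have := Finset.card_le_card (subset_of_mem_openTriangle hK
      (edge_mem_faces hK (Finset.erase_subset A K) hcard) hxK hx.1)
    rw [hcard, hK.2] at this
    omega

/-- The normal component of a piecewise affine field in `H(div)` is continuous across interior
edges. -/
theorem IsPiecewiseRT.edgeFlux_eq_zero {p : Plane → Plane} {d : Plane → ℝ}
    {a : Finset Plane → Plane} {c : Finset Plane → ℝ} (h : IsPiecewiseRT T p d a c)
    (hT : IsTriangulation Ω T) (hΩ : IsPolygonalDomain Ω) (hdiv : HasWeakDiv Ω p d)
    {e : Finset Plane} (he : e ∈ hT.edges) (heΩ : openEdge e ⊆ Ω) : hT.edgeFlux a c e = 0 := by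
  classical
  rw [hT.mem_edges] at he
  obtain ⟨x, hx⟩ := openEdge_nonempty he.2
  -- A bump supported in U meets no other edge. Green's formula then reduces to the flux through e
  -- times a positive integral.
  set U : Set Plane := Ω ∩ (⋃ e' ∈ hT.edges.erase e, convexHull ℝ (e' : Set Plane))ᶜ with hU
  have hUo : IsOpen U := hΩ.isOpen.inter
    ((hT.edges.erase e).isCompact_biUnion fun K _ => isCompact_hull K).isClosed.isOpen_compl
  have hxU : x ∈ U := by
    refine ⟨heΩ hx, ?_⟩
    simp only [Set.mem_compl_iff, Set.mem_iUnion, exists_prop, not_exists, not_and]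
    intro e' he' hxe'
    rw [Finset.mem_erase, hT.mem_edges] at he'
    have := subset_of_mem_openEdge he.1 he.2 he'.2.1 hx hxe'
    exact he'.1 (Finset.eq_of_subset_of_card_le this (by rw [he.2, he'.2.2])).symm
  obtain ⟨φ, hφ, hφ0, hφ1⟩ := exists_bump (hUo.mem_nhds hxU)
  have hφ' : ContDiff ℝ 1 φ := hφ.1.of_le (by simp)
  have h1 := h.green hT hΩ (H1.ofContDiff Ω hT.isBounded φ hφ') hφ.continuous.continuousOn
  rw [h.integral_add hT hΩ] at h1
  simp only [H1.ofContDiff, inner_gradient] at h1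
  rw [hdiv φ (hφ.mono Set.inter_subset_left), neg_add_cancel,
    Finset.sum_eq_single_of_mem e (hT.mem_edges.2 he)] at h1
  · rcases mul_eq_zero.1 h1.symm with h2 | h2
    · exact h2
    · exact absurd h2 (integral_openEdge_pos he.2 hφ.continuous hφ0 hx (by rw [hφ1]; simp)).ne'
  · intro e' he' hne
    rw [setIntegral_eq_zero_of_forall_eq_zero, mul_zero]
    intro y hy
    refine hφ.eq_zero fun hyU => hyU.2 ?_
    simp only [Set.mem_iUnion, exists_prop]
    exact ⟨e', Finset.mem_erase.2 ⟨hne, he'⟩, hy.1⟩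

/-! ### The boundary -/

theorem hausdorffMeasure_finite_eq_zero {S : Set Plane} (hS : S.Finite) :
    (Measure.hausdorffMeasure 1 : Measure Plane) S = 0 := by
  have := Measure.nullSingletonClass_hausdorff Plane (d := 1) one_pos
  exact hS.measure_zero _

theorem IsTriangulation.boundaryEdges_subset (hT : IsTriangulation Ω T) {e : Finset Plane}
    (he : e ∈ boundaryEdges Ω T) : e ∈ hT.edges := hT.mem_edges.2 ⟨he.1, he.2.1⟩

theorem hausdorffMeasure_hull_lt_top {e : Finset Plane} (he : e.card = 2) :
    (Measure.hausdorffMeasure 1 : Measure Plane) (convexHull ℝ (e : Set Plane)) < ⊤ := by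
  obtain ⟨B, C, _, hcoe⟩ := exists_pair he
  rw [hcoe, convexHull_pair, hausdorffMeasure_segment]
  exact edist_lt_top _ _

theorem IsTriangulation.finite_vertices (hT : IsTriangulation Ω T) :
    (⋃ K ∈ hT.tris, (K : Set Plane)).Finite :=
  hT.tris.finite_toSet.biUnion fun K _ => K.finite_toSet

theorem IsTriangulation.hausdorffMeasure_frontier_lt_top (hT : IsTriangulation Ω T)
    (hΩ : IsPolygonalDomain Ω) :
    (Measure.hausdorffMeasure 1 : Measure Plane) (frontier Ω) < ⊤ := by
  refine (measure_mono (hT.frontier_subset hΩ)).trans_lt ?_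
  refine (measure_union_le _ _).trans_lt ?_
  rw [hausdorffMeasure_finite_eq_zero hT.finite_vertices, add_zero]
  refine (measure_mono (t := ⋃ e ∈ hT.edges, convexHull ℝ (e : Set Plane)) ?_).trans_lt ?_
  · exact Set.iUnion₂_subset fun e he => Set.sdiff_subset.trans
      (Set.subset_biUnion_of_mem (u := fun e : Finset Plane => convexHull ℝ (e : Set Plane))
        (Finset.mem_coe.2 (hT.boundaryEdges_subset he)))
  · exact measure_biUnion_lt_top hT.edges.finite_toSet
      fun e he => hausdorffMeasure_hull_lt_top (hT.mem_edges.1 he).2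

theorem IsTriangulation.isFiniteMeasure_arcLength (hT : IsTriangulation Ω T)
    (hΩ : IsPolygonalDomain Ω) : IsFiniteMeasure (arcLength (frontier Ω)) :=
  ⟨by rw [arcLength, Measure.restrict_apply_univ]; exact hT.hausdorffMeasure_frontier_lt_top hΩ⟩

theorem IsTriangulation.isCompact_frontier (hT : IsTriangulation Ω T) : IsCompact (frontier Ω) :=
  hT.isCompact_closure.of_isClosed_subset isClosed_frontier frontier_subset_closure

/-- The piecewise constant normal component of a piecewise affine field on the boundary. -/
noncomputable def IsTriangulation.boundaryFlux (hT : IsTriangulation Ω T)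
    (a : Finset Plane → Plane) (c : Finset Plane → ℝ) (x : Plane) : ℝ :=
  ∑ e ∈ hT.edges, (openEdge e).indicator (fun _ => hT.edgeFlux a c e) x

theorem IsTriangulation.memLp_boundaryFlux (hT : IsTriangulation Ω T) (hΩ : IsPolygonalDomain Ω)
    (a : Finset Plane → Plane) (c : Finset Plane → ℝ) :
    MemLp (hT.boundaryFlux a c) 2 (arcLength (frontier Ω)) := by
  have := hT.isFiniteMeasure_arcLength hΩ
  exact memLp_finsetSum _ fun e _ => (memLp_const _).indicator (measurableSet_openEdge e)

theorem IsTriangulation.boundaryFlux_eq (hT : IsTriangulation Ω T)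
    (a : Finset Plane → Plane) (c : Finset Plane → ℝ) {e : Finset Plane} (he : e ∈ hT.edges)
    {x : Plane} (hx : x ∈ openEdge e) : hT.boundaryFlux a c x = hT.edgeFlux a c e := by
  rw [IsTriangulation.boundaryFlux, Finset.sum_eq_single_of_mem e he, Set.indicator_of_mem hx]
  intro e' he' hne
  rw [hT.mem_edges] at he he'
  exact Set.indicator_of_notMem (fun h => Set.disjoint_left.1
    (disjoint_openEdge he'.1 he'.2 he.1 he.2 hne) h hx) _

/-- The weak divergence on Ω makes the fluxes through interior edges vanish, so only boundary edges
contribute. -/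
theorem IsPiecewiseRT.green_boundary {p : Plane → Plane} {d : Plane → ℝ}
    {a : Finset Plane → Plane} {c : Finset Plane → ℝ} (h : IsPiecewiseRT T p d a c)
    (hT : IsTriangulation Ω T) (hΩ : IsPolygonalDomain Ω) (hdiv : HasWeakDiv Ω p d) (φ : H1 Ω)
    (hφ : ContinuousOn φ.toFun (closure Ω)) :
    ∫ x in Ω, (inner ℝ (φ.grad x) (p x) + d x * φ.toFun x) =
      ∫ x, hT.boundaryFlux a c x * φ.toFun x ∂(arcLength (frontier Ω)) := by
  have hfin := hT.isFiniteMeasure_arcLength hΩ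
  rw [h.green hT hΩ φ hφ]
  simp only [IsTriangulation.boundaryFlux, Finset.sum_mul]
  have hφi : Integrable φ.toFun (arcLength (frontier Ω)) :=
    (hφ.mono frontier_subset_closure).integrableOn_of_subset_isCompact hT.isCompact_frontier
      isClosed_frontier.measurableSet subset_rfl (hT.hausdorffMeasure_frontier_lt_top hΩ).ne
  have hind : ∀ e x, (openEdge e).indicator (fun _ => hT.edgeFlux a c e) x * φ.toFun x =
      (openEdge e).indicator (fun x => hT.edgeFlux a c e * φ.toFun x) x := by
    intro e x
    by_cases hx : x ∈ openEdge e
    · rw [Set.indicator_of_mem hx, Set.indicator_of_mem hx]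
    · rw [Set.indicator_of_notMem hx, Set.indicator_of_notMem hx, zero_mul]
  simp_rw [hind]
  rw [integral_finsetSum]
  · refine Finset.sum_congr rfl fun e he => ?_
    rw [integral_indicator (measurableSet_openEdge e), integral_const_mul]
    have he' := hT.mem_edges.1 he
    rcases hT.edge_cases hΩ he'.1 he'.2 with ⟨hb, _⟩ | ⟨hi, _⟩
    · rw [arcLength, Measure.restrict_restrict_of_subset (openEdge_subset_frontier hb)]
    · rw [h.edgeFlux_eq_zero hT hΩ hdiv he hi, zero_mul, zero_mul]
  · intro e _
    exact (hφi.const_mul _).indicator (measurableSet_openEdge e)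

/-- Traces are defined through functions continuous up to the boundary, for which the formula is
known. Both sides pass to the limit because the field, its divergence and its boundary flux are
square integrable. -/
theorem IsPiecewiseRT.green_trace {p : Plane → Plane} {d : Plane → ℝ}
    {a : Finset Plane → Plane} {c : Finset Plane → ℝ} (h : IsPiecewiseRT T p d a c)
    (hT : IsTriangulation Ω T) (hΩ : IsPolygonalDomain Ω) (hdiv : HasWeakDiv Ω p d) (v : H1 Ω)
    {τ : Plane → ℝ} (hτ : HasTrace Ω v τ) :
    ∫ x in Ω, (inner ℝ (v.grad x) (p x) + d x * v.toFun x) =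
      ∫ x, hT.boundaryFlux a c x * τ x ∂(arcLength (frontier Ω)) := by
  have hfin := hT.isFiniteMeasure_arcLength hΩ
  obtain ⟨hτ2, φ, hφc, h1, h2, h3⟩ := hτ
  have hp := h.memLp_field hT hΩ
  have hd := h.memLp_div hT hΩ
  have hφ2 : ∀ n, MemLp (φ n).toFun 2 (arcLength (frontier Ω)) := fun n =>
    memLp_of_continuousOn hT.isCompact_frontier (hT.hausdorffMeasure_frontier_lt_top hΩ)
      ((hφc n).mono frontier_subset_closure) 2
  replace h1 := (tendsto_l2norm_iff fun n => (φ n).memLp_toFun.sub v.memLp_toFun).1 h1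
  replace h2 := (tendsto_l2norm_iff fun n => (φ n).memLp_grad.sub v.memLp_grad).1 h2
  have l1 := tendsto_integral_mul (fun n => (φ n).memLp_toFun) v.memLp_toFun hd h1
  have l2 := tendsto_integral_inner (fun n => (φ n).memLp_grad) v.memLp_grad hp h2
  have l3 := tendsto_integral_mul hφ2 hτ2 (hT.memLp_boundaryFlux hΩ a c) h3
  rw [h.integral_add hT hΩ]
  refine tendsto_nhds_unique (l2.add l1) (l3.congr fun n => ?_)
  rw [← h.integral_add hT hΩ, h.green_boundary hT hΩ hdiv _ (hφc n)]

section Partition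

variable {ΓD ΓN : Set Plane}

theorem IsBoundaryPartition.symm_mem (hΓ : IsBoundaryPartition Ω T ΓD ΓN)
    {e : Finset Plane} (he : e ∈ boundaryEdges Ω T) {x : Plane} (hx : x ∈ openEdge e)
    (hxN : x ∈ ΓN) : openEdge e ⊆ ΓN :=
  (hΓ.resolved e he).resolve_left fun h => Set.disjoint_left.1 hΓ.disjoint (h hx) hxN

/-- Up to finitely many vertices the set is a finite union of open edges. -/
theorem IsBoundaryPartition.measurableSet_right (hΓ : IsBoundaryPartition Ω T ΓD ΓN)
    (hT : IsTriangulation Ω T) (hΩ : IsPolygonalDomain Ω) : MeasurableSet ΓN := by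
  classical
  set V := ⋃ K ∈ hT.tris, (K : Set Plane) with hV
  set E := ⋃ e ∈ hT.edges.filter (fun e => openEdge e ⊆ ΓN), openEdge e with hE
  have h1 : ΓN = E ∪ (ΓN ∩ V) := by
    apply Set.Subset.antisymm
    · intro x hx
      have hxf : x ∈ frontier Ω := hΓ.union_eq ▸ Or.inr hx
      rcases hT.frontier_subset hΩ hxf with h | h
      · simp only [Set.mem_iUnion, exists_prop] at h
        obtain ⟨e, he, hxe⟩ := h
        refine Or.inl ?_
        simp only [hE, Set.mem_iUnion, exists_prop, Finset.mem_filter]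
        exact ⟨e, ⟨hT.boundaryEdges_subset he, hΓ.symm_mem he hxe hx⟩, hxe⟩
      · exact Or.inr ⟨hx, h⟩
    · rintro x (hx | hx)
      · simp only [hE, Set.mem_iUnion, exists_prop, Finset.mem_filter] at hx
        obtain ⟨e, ⟨_, he⟩, hxe⟩ := hx
        exact he hxe
      · exact hx.1
  rw [h1]
  exact (Finset.measurableSet_biUnion _ fun e _ => measurableSet_openEdge e).union
    (hT.finite_vertices.subset Set.inter_subset_right).measurableSet

theorem IsBoundaryPartition.measurableSet_left (hΓ : IsBoundaryPartition Ω T ΓD ΓN)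
    (hT : IsTriangulation Ω T) (hΩ : IsPolygonalDomain Ω) : MeasurableSet ΓD := by
  have h1 : ΓD = frontier Ω \ ΓN := by
    rw [← hΓ.union_eq, Set.union_sdiff_right, hΓ.disjoint.sdiff_eq_left]
  rw [h1]
  exact isClosed_frontier.measurableSet.diff (hΓ.measurableSet_right hT hΩ)

/-- Away from vertices a boundary point belongs to an edge with exactly one adjacent triangle. The
one-sided limit in the normal trace is the affine formula of that triangle evaluated at the point.
-/
theorem IsPiecewiseRT.boundaryFlux_ae_eq {p : Plane → Plane} {d : Plane → ℝ}
    {a : Finset Plane → Plane} {c : Finset Plane → ℝ} (h : IsPiecewiseRT T p d a c)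
    (hT : IsTriangulation Ω T) (hΩ : IsPolygonalDomain Ω) (hΓ : IsBoundaryPartition Ω T ΓD ΓN)
    {g : Plane → ℝ} (hg : HasNormalTrace Ω T ΓN p g) :
    hT.boundaryFlux a c =ᵐ[arcLength ΓN] g := by
  classical
  have hV : ∀ᵐ x ∂(Measure.hausdorffMeasure 1 : Measure Plane),
      x ∉ ⋃ K ∈ hT.tris, (K : Set Plane) :=
    measure_eq_zero_iff_ae_notMem.1 (hausdorffMeasure_finite_eq_zero hT.finite_vertices)
  rw [arcLength]
  filter_upwards [ae_restrict_of_ae hV, ae_restrict_mem (hΓ.measurableSet_right hT hΩ)]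
    with x hxV hxN
  have hxf : x ∈ frontier Ω := hΓ.union_eq ▸ Or.inr hxN
  have h1 := (hT.frontier_subset hΩ hxf).resolve_right hxV
  simp only [Set.mem_iUnion, exists_prop] at h1
  obtain ⟨e, he, hxe⟩ := h1
  have heN := hΓ.symm_mem he hxe hxN
  rw [hT.boundaryFlux_eq a c (hT.boundaryEdges_subset he) hxe]
  rcases hT.edge_cases hΩ he.1 he.2.1 with ⟨_, K, hK, heK, huniq⟩ | ⟨hi, _⟩
  · obtain ⟨A, hA, rfl⟩ := exists_eq_erase hK heK he.2.1
    rw [hT.edgeFlux_of_boundary a c hK hA huniq, ← inner_eq_flux hK hA (a K) (c K) hxe.1]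
    have hlim := hg K hK _ he heK heN _ (isOuterNormal_outerNormal hK hA) x hxe
    have hne : (𝓝[openTriangle K] x).NeBot := mem_closure_iff_nhdsWithin_neBot.1
      (convexHull_subset_closure_openTriangle hK (convexHull_mono (by exact_mod_cast heK) hxe.1))
    refine tendsto_nhds_unique ?_ hlim
    have hcont : Continuous fun y : Plane => inner ℝ (outerNormal K A) (a K + c K • y) := by
      fun_prop
    refine ((hcont.tendsto x).mono_left nhdsWithin_le_nhds).congr' ?_
    filter_upwards [self_mem_nhdsWithin] with y hy
    rw [h.field_eq K hK y hy, real_inner_comm]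
  · exact absurd hxf (hΩ.notMem_frontier (hi hxe))

/-- Green's formula for `v ∈ H¹(Ω)` with trace `τ` vanishing on `ΓD`, and a Raviart--Thomas field
`p` with normal component `g` on `ΓN`. -/
theorem IsPiecewiseRT.green_mixed {p : Plane → Plane} {d : Plane → ℝ}
    {a : Finset Plane → Plane} {c : Finset Plane → ℝ} (h : IsPiecewiseRT T p d a c)
    (hT : IsTriangulation Ω T) (hΩ : IsPolygonalDomain Ω) (hΓ : IsBoundaryPartition Ω T ΓD ΓN)
    (hdiv : HasWeakDiv Ω p d) {g : Plane → ℝ} (hg : HasNormalTrace Ω T ΓN p g) (v : H1 Ω)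
    {τ : Plane → ℝ} (hτ : HasTrace Ω v τ) (hτD : τ =ᵐ[arcLength ΓD] 0) :
    (∫ x in Ω, inner ℝ (v.grad x) (p x)) =
      (∫ x in Ω, - d x * v.toFun x) + ∫ x, g x * τ x ∂(arcLength ΓN) := by
  have h1 := h.green_trace hT hΩ hdiv v hτ
  rw [h.integral_add hT hΩ] at h1
  have hint : Integrable (fun x => hT.boundaryFlux a c x * τ x) (arcLength (frontier Ω)) :=
    (hT.memLp_boundaryFlux hΩ a c).integrable_mul hτ.1
  have h2 : ∫ x, hT.boundaryFlux a c x * τ x ∂(arcLength (frontier Ω)) =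
      (∫ x, hT.boundaryFlux a c x * τ x ∂(arcLength ΓD)) +
        ∫ x, hT.boundaryFlux a c x * τ x ∂(arcLength ΓN) := by
    have hint' : IntegrableOn (fun x => hT.boundaryFlux a c x * τ x) (frontier Ω)
      (Measure.hausdorffMeasure 1 : Measure Plane) := hint
    simp only [arcLength]
    rw [← hΓ.union_eq] at hint' ⊢
    exact setIntegral_union hΓ.disjoint (hΓ.measurableSet_right hT hΩ)
      (hint'.mono_set Set.subset_union_left) (hint'.mono_set Set.subset_union_right)
  have h3 : ∫ x, hT.boundaryFlux a c x * τ x ∂(arcLength ΓD) = 0 := by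
    rw [integral_eq_zero_of_ae]
    filter_upwards [hτD] with x hx
    simp [hx]
  have h4 : ∫ x, hT.boundaryFlux a c x * τ x ∂(arcLength ΓN) = ∫ x, g x * τ x ∂(arcLength ΓN) :=
    integral_congr_ae ((h.boundaryFlux_ae_eq hT hΩ hΓ hg).mono fun x hx => by simp only [hx])
  have h5 : ∫ x in Ω, - d x * v.toFun x = - ∫ x in Ω, d x * v.toFun x := by
    rw [← integral_neg]; simp only [neg_mul]
  rw [h5]
  linarith

end Partition


/-! ### Linear operations on `H¹` -/

theorem IsTestFunction.memLp {U : Set Plane} {φ : Plane → ℝ} (h : IsTestFunction U φ)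
    (μ : Measure Plane) [IsFiniteMeasureOnCompacts μ] : MemLp φ 2 μ :=
  h.continuous.memLp_of_hasCompactSupport h.2.1

theorem IsTestFunction.memLp_fderiv {U : Set Plane} {φ : Plane → ℝ} (h : IsTestFunction U φ)
    (μ : Measure Plane) [IsFiniteMeasureOnCompacts μ] (e : Plane) :
    MemLp (fun x => fderiv ℝ φ x e) 2 μ :=
  (h.continuous_fderiv.clm_apply continuous_const).memLp_of_hasCompactSupport
    (h.2.1.fderiv_apply ℝ e)

theorem IsTestFunction.memLp_gradient {U : Set Plane} {φ : Plane → ℝ} (h : IsTestFunction U φ)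
    (μ : Measure Plane) [IsFiniteMeasureOnCompacts μ] : MemLp (gradient φ) 2 μ := by
  refine (continuous_gradient (h.1.of_le (by simp))).memLp_of_hasCompactSupport ?_
  exact (h.2.1.fderiv ℝ).comp_left (g := (InnerProductSpace.toDual ℝ Plane).symm) (by simp)

theorem HasWeakGrad.add {U : Set Plane} {v w : Plane → ℝ} {G H : Plane → Plane}
    (hv : HasWeakGrad U v G) (hw : HasWeakGrad U w H) (v2 : MemLp v 2 (volume.restrict U))
    (w2 : MemLp w 2 (volume.restrict U)) (G2 : MemLp G 2 (volume.restrict U))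
    (H2 : MemLp H 2 (volume.restrict U)) :
    HasWeakGrad U (fun x => v x + w x) (fun x => G x + H x) := by
  intro φ hφ e
  have d2 := hφ.memLp_fderiv (volume.restrict U) e
  have φ2 := hφ.memLp (volume.restrict U)
  have e1 : ∫ x in U, (v x + w x) * fderiv ℝ φ x e =
      (∫ x in U, v x * fderiv ℝ φ x e) + ∫ x in U, w x * fderiv ℝ φ x e := by
    simp_rw [add_mul]
    exact integral_add (v2.integrable_mul d2) (w2.integrable_mul d2)
  have e2 : ∫ x in U, inner ℝ (G x + H x) e * φ x =
      (∫ x in U, inner ℝ (G x) e * φ x) + ∫ x in U, inner ℝ (H x) e * φ x := by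
    simp_rw [inner_add_left, add_mul]
    exact integral_add ((G2.inner_const e).integrable_mul φ2)
      ((H2.inner_const e).integrable_mul φ2)
  rw [e1, e2, hv φ hφ e, hw φ hφ e]; ring

theorem HasWeakGrad.const_smul {U : Set Plane} {v : Plane → ℝ} {G : Plane → Plane}
    (hv : HasWeakGrad U v G) (c : ℝ) : HasWeakGrad U (fun x => c * v x) (fun x => c • G x) := by
  intro φ hφ e
  simp_rw [inner_smul_left, mul_assoc]
  rw [integral_const_mul, integral_const_mul, hv φ hφ e]
  simp

/-- The zero function. -/
def H1.zero (U : Set Plane) : H1 U where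
  toFun := fun _ => 0
  grad := fun _ => 0
  memLp_toFun := MemLp.zero'
  memLp_grad := MemLp.zero'
  hasWeakGrad := by intro φ _ e; simp

/-- The sum of two functions in `H¹`. -/
def H1.add {U : Set Plane} (v w : H1 U) : H1 U where
  toFun := fun x => v.toFun x + w.toFun x
  grad := fun x => v.grad x + w.grad x
  memLp_toFun := v.memLp_toFun.add w.memLp_toFun
  memLp_grad := v.memLp_grad.add w.memLp_grad
  hasWeakGrad := v.hasWeakGrad.add w.hasWeakGrad v.memLp_toFun w.memLp_toFun v.memLp_grad
    w.memLp_grad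

/-- Multiples of a function in `H¹`. -/
def H1.smul {U : Set Plane} (c : ℝ) (v : H1 U) : H1 U where
  toFun := fun x => c * v.toFun x
  grad := fun x => c • v.grad x
  memLp_toFun := v.memLp_toFun.const_mul c
  memLp_grad := v.memLp_grad.const_smul c
  hasWeakGrad := v.hasWeakGrad.const_smul c

/-! ### Linear operations on fluxes -/

theorem HasWeakDiv.add {U : Set Plane} {p q : Plane → Plane} {d b : Plane → ℝ}
    (hp : HasWeakDiv U p d) (hq : HasWeakDiv U q b) (p2 : MemLp p 2 (volume.restrict U))
    (q2 : MemLp q 2 (volume.restrict U)) (d2 : MemLp d 2 (volume.restrict U))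
    (b2 : MemLp b 2 (volume.restrict U)) :
    HasWeakDiv U (fun x => p x + q x) (fun x => d x + b x) := by
  intro φ hφ
  have g2 := hφ.memLp_gradient (volume.restrict U)
  have φ2 := hφ.memLp (volume.restrict U)
  have h1 := hp φ hφ
  have h2 := hq φ hφ
  simp_rw [← inner_gradient] at h1 h2 ⊢
  have e1 : ∫ x in U, inner ℝ (gradient φ x) (p x + q x) =
      (∫ x in U, inner ℝ (gradient φ x) (p x)) + ∫ x in U, inner ℝ (gradient φ x) (q x) := by
    simp_rw [inner_add_right]
    exact integral_add (integrable_inner_of_memLp g2 p2) (integrable_inner_of_memLp g2 q2)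
  have e2 : ∫ x in U, (d x + b x) * φ x = (∫ x in U, d x * φ x) + ∫ x in U, b x * φ x := by
    simp_rw [add_mul]
    exact integral_add (d2.integrable_mul φ2) (b2.integrable_mul φ2)
  rw [e1, e2, h1, h2]; ring

theorem HasWeakDiv.const_smul {U : Set Plane} {p : Plane → Plane} {d : Plane → ℝ}
    (hp : HasWeakDiv U p d) (c : ℝ) : HasWeakDiv U (fun x => c • p x) (fun x => c * d x) := by
  intro φ hφ
  simp_rw [map_smul, smul_eq_mul, mul_assoc]
  rw [integral_const_mul, integral_const_mul, hp φ hφ]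
  simp

theorem HasWeakDiv.congr {U : Set Plane} {p : Plane → Plane} {d b : Plane → ℝ}
    (hp : HasWeakDiv U p d) (h : d =ᵐ[volume.restrict U] b) : HasWeakDiv U p b := by
  intro φ hφ
  rw [hp φ hφ]
  congr 1
  exact integral_congr_ae (h.mono fun x hx => by simp only [hx])

variable {Ω : Set Plane} {T : Geometry.SimplicialComplex ℝ Plane} {ΓD ΓN : Set Plane}

/-- `q` is a Raviart--Thomas field with normal component `0` on `ΓN` and divergence `d`. -/
structure IsRTFlux (Ω : Set Plane) (T : Geometry.SimplicialComplex ℝ Plane) (ΓN : Set Plane)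
    (q : Plane → Plane) (d : Plane → ℝ) : Prop where
  field : ∀ K ∈ triangles T, ∃ (a : Plane) (c : ℝ), ∀ x ∈ openTriangle K, q x = a + c • x
  const : ∀ K ∈ triangles T, ∃ m : ℝ, ∀ x ∈ openTriangle K, d x = m
  weakDiv : HasWeakDiv Ω q d
  normal : HasNormalTrace Ω T ΓN q 0

theorem IsRTFlux.memLp_field {q : Plane → Plane} {d : Plane → ℝ} (h : IsRTFlux Ω T ΓN q d)
    (hT : IsTriangulation Ω T) (hΩ : IsPolygonalDomain Ω) : MemLp q 2 (volume.restrict Ω) :=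
  hT.memLp_of_piecewise hΩ fun K hK => by
    obtain ⟨a, c, hac⟩ := h.field K hK
    exact ⟨fun x => a + c • x, by fun_prop, hac⟩

theorem IsRTFlux.memLp_div {q : Plane → Plane} {d : Plane → ℝ} (h : IsRTFlux Ω T ΓN q d)
    (hT : IsTriangulation Ω T) (hΩ : IsPolygonalDomain Ω) : MemLp d 2 (volume.restrict Ω) :=
  hT.memLp_of_piecewise hΩ fun K hK => by
    obtain ⟨m, hm⟩ := h.const K hK
    exact ⟨fun _ => m, by fun_prop, hm⟩

theorem IsRTFlux.memRT {q : Plane → Plane} {d : Plane → ℝ} (h : IsRTFlux Ω T ΓN q d)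
    (hT : IsTriangulation Ω T) (hΩ : IsPolygonalDomain Ω) : MemRT Ω T q :=
  ⟨⟨h.memLp_field hT hΩ, d, h.memLp_div hT hΩ, h.weakDiv⟩, h.field⟩

theorem IsRTFlux.add {p q : Plane → Plane} {d b : Plane → ℝ} (hp : IsRTFlux Ω T ΓN p d)
    (hq : IsRTFlux Ω T ΓN q b) (hT : IsTriangulation Ω T) (hΩ : IsPolygonalDomain Ω) :
    IsRTFlux Ω T ΓN (fun x => p x + q x) (fun x => d x + b x) where
  field K hK := by
    obtain ⟨a, c, hac⟩ := hp.field K hK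
    obtain ⟨a', c', hac'⟩ := hq.field K hK
    exact ⟨a + a', c + c', fun x hx => by rw [hac x hx, hac' x hx]; module⟩
  const K hK := by
    obtain ⟨m, hm⟩ := hp.const K hK
    obtain ⟨m', hm'⟩ := hq.const K hK
    exact ⟨m + m', fun x hx => by rw [hm x hx, hm' x hx]⟩
  weakDiv := hp.weakDiv.add hq.weakDiv (hp.memLp_field hT hΩ) (hq.memLp_field hT hΩ)
    (hp.memLp_div hT hΩ) (hq.memLp_div hT hΩ)
  normal K hK e he heK heN n hn x hx := by
    have h1 := (hp.normal K hK e he heK heN n hn x hx).add (hq.normal K hK e he heK heN n hn x hx)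
    simpa [inner_add_left] using h1

theorem IsRTFlux.const_smul {p : Plane → Plane} {d : Plane → ℝ} (hp : IsRTFlux Ω T ΓN p d)
    (r : ℝ) : IsRTFlux Ω T ΓN (fun x => r • p x) (fun x => r * d x) where
  field K hK := by
    obtain ⟨a, c, hac⟩ := hp.field K hK
    exact ⟨r • a, r * c, fun x hx => by rw [hac x hx]; module⟩
  const K hK := by
    obtain ⟨m, hm⟩ := hp.const K hK
    exact ⟨r * m, fun x hx => by rw [hm x hx]⟩
  weakDiv := hp.weakDiv.const_smul r
  normal K hK e he heK heN n hn x hx := by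
    have h1 := (hp.normal K hK e he heK heN n hn x hx).const_mul r
    simpa [inner_smul_left] using h1

theorem isRTFlux_zero : IsRTFlux Ω T ΓN (fun _ => 0) (fun _ => 0) where
  field K hK := ⟨0, 0, fun x _ => by simp⟩
  const K hK := ⟨0, fun x _ => rfl⟩
  weakDiv φ hφ := by simp
  normal K hK e he heK heN n hn x hx := by simpa using tendsto_const_nhds

theorem IsRTFlux.sum {ι : Type*} (s : Finset ι) {q : ι → Plane → Plane} {d : ι → Plane → ℝ}
    (h : ∀ i ∈ s, IsRTFlux Ω T ΓN (q i) (d i)) (hT : IsTriangulation Ω T)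
    (hΩ : IsPolygonalDomain Ω) :
    IsRTFlux Ω T ΓN (fun x => ∑ i ∈ s, q i x) (fun x => ∑ i ∈ s, d i x) := by
  classical
  induction s using Finset.induction_on with
  | empty => simpa using isRTFlux_zero
  | insert i s hi ih =>
    simp_rw [Finset.sum_insert hi]
    exact (h i (Finset.mem_insert_self i s)).add
      (ih fun j hj => h j (Finset.mem_insert_of_mem hj)) hT hΩ

theorem IsRTFlux.congr_div {p : Plane → Plane} {d b : Plane → ℝ} (hp : IsRTFlux Ω T ΓN p d)
    (hT : IsTriangulation Ω T) (hΩ : IsPolygonalDomain Ω)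
    (h : ∀ K ∈ triangles T, ∀ x ∈ openTriangle K, d x = b x) : IsRTFlux Ω T ΓN p b where
  field := hp.field
  const K hK := by
    obtain ⟨m, hm⟩ := hp.const K hK
    exact ⟨m, fun x hx => by rw [← h K hK x hx, hm x hx]⟩
  weakDiv := hp.weakDiv.congr (hT.ae_of_forall_openTriangle hΩ h)
  normal := hp.normal

/-! ### The Raviart--Thomas basis -/

/-- The area of a triangle. -/
noncomputable def area (K : Finset Plane) : ℝ := volume.real (openTriangle K)

theorem area_pos {K : Finset Plane} (hK : K ∈ triangles T) : 0 < area K :=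
  ENNReal.toReal_pos (volume_openTriangle_pos hK).ne' (volume_openTriangle_lt_top K).ne

/-- The normalized indicator function of a triangle. -/
noncomputable def unitIndicator (K : Finset Plane) : Plane → ℝ :=
  (openTriangle K).indicator fun _ => (area K)⁻¹

/-- The field on `K` with unit flux through the edge opposite to the vertex `A`. -/
noncomputable def flagField (K : Finset Plane) (A : Plane) : Plane → Plane :=
  (openTriangle K).indicator fun x => (2 * area K)⁻¹ • (x - A)

theorem unitIndicator_of_ne {K K' : Finset Plane} (hK : K ∈ triangles T) (hK' : K' ∈ triangles T)
    (hne : K' ≠ K) {x : Plane} (hx : x ∈ openTriangle K') : unitIndicator K x = 0 :=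
  Set.indicator_of_notMem (fun h => Set.disjoint_left.1 (disjoint_openTriangle hK' hK hne) hx h) _

theorem flagField_of_ne {K K' : Finset Plane} (hK : K ∈ triangles T) (hK' : K' ∈ triangles T)
    (hne : K' ≠ K) (A : Plane) {x : Plane} (hx : x ∈ openTriangle K') : flagField K A x = 0 :=
  Set.indicator_of_notMem (fun h => Set.disjoint_left.1 (disjoint_openTriangle hK' hK hne) hx h) _

theorem flagField_piecewise {K : Finset Plane} (hK : K ∈ triangles T) (A : Plane) :
    ∀ K' ∈ triangles T, ∃ (a : Plane) (c : ℝ), ∀ x ∈ openTriangle K', flagField K A x = a + c • x := by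
  intro K' hK'
  by_cases h : K' = K
  · subst h
    refine ⟨-((2 * area K')⁻¹ • A), (2 * area K')⁻¹, fun x hx => ?_⟩
    rw [flagField, Set.indicator_of_mem hx]; module
  · exact ⟨0, 0, fun x hx => by rw [flagField_of_ne hK hK' h A hx]; simp⟩

theorem unitIndicator_piecewise {K : Finset Plane} (hK : K ∈ triangles T) :
    ∀ K' ∈ triangles T, ∃ m : ℝ, ∀ x ∈ openTriangle K', unitIndicator K x = m := by
  intro K' hK'
  by_cases h : K' = K
  · subst h
    exact ⟨_, fun x hx => Set.indicator_of_mem hx _⟩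
  · exact ⟨0, fun x hx => unitIndicator_of_ne hK hK' h hx⟩

-- The field x − A is tangential to the two edges through A, so only the opposite edge contributes.
-- There the normal component is constant, and the test function 1 identifies it as the reciprocal
-- of the edge length.
open Classical in
theorem green_flag {K : Finset Plane} (hK : K ∈ triangles T) {A : Plane} (hA : A ∈ K) {φ : Plane → ℝ}
    (hφ : ContDiff ℝ 1 φ) :
    ∫ x in openTriangle K, (inner ℝ (gradient φ x) ((2 * area K)⁻¹ • (x - A)) +
        (area K)⁻¹ * φ x) =
      ((Measure.hausdorffMeasure 1 : Measure Plane).real (openEdge (K.erase A)))⁻¹ *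
        ∫ x in openEdge (K.erase A), φ x ∂(Measure.hausdorffMeasure 1 : Measure Plane) := by
  have key : ∀ ψ : Plane → ℝ, ContDiff ℝ 1 ψ →
      ∫ x in openTriangle K, (inner ℝ (gradient ψ x) ((2 * area K)⁻¹ • (x - A)) +
        (area K)⁻¹ * ψ x) = flux K A (-((2 * area K)⁻¹ • A)) ((2 * area K)⁻¹) *
        ∫ x in openEdge (K.erase A), ψ x ∂(Measure.hausdorffMeasure 1 : Measure Plane) := by
    intro ψ hψ
    have h1 := green_triangle hK hψ.continuous.continuousOn
      (((continuous_gradient hψ).continuousOn.integrableOn_compact (isCompact_hull K)).mono_set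
        interior_subset) (hasWeakGrad_of_contDiff hψ) (-((2 * area K)⁻¹ • A)) ((2 * area K)⁻¹)
    rw [Finset.sum_eq_single_of_mem A hA] at h1
    · rw [← h1]
      congr 1; ext x
      rw [show (2 * area K)⁻¹ • (x - A) = -((2 * area K)⁻¹ • A) + (2 * area K)⁻¹ • x by module]
      congr 2
      rw [mul_inv]; ring
    · intro A' hA' hne
      have hmem : A ∈ convexHull ℝ ((K.erase A' : Finset Plane) : Set Plane) :=
        subset_convexHull ℝ _ (Finset.mem_coe.2 (Finset.mem_erase.2 ⟨hne.symm, hA⟩))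
      rw [← inner_eq_flux hK hA' _ _ hmem]
      simp
  have h1 := key (fun _ => 1) contDiff_const
  have hg : ∀ x, gradient (fun _ : Plane => (1 : ℝ)) x = 0 := fun x => by simp [gradient]
  simp only [hg, inner_zero_left, zero_add, mul_one, integral_const, smul_eq_mul,
    measureReal_restrict_apply_univ] at h1
  have hK0 := (area_pos hK).ne'
  rw [key φ hφ]
  congr 1
  refine eq_inv_of_mul_eq_one_left ?_
  rw [← h1]
  exact mul_inv_cancel₀ hK0

open Classical in
theorem integral_flagField (hT : IsTriangulation Ω T) (hΩ : IsPolygonalDomain Ω) {K : Finset Plane}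
    (hK : K ∈ triangles T) {A : Plane} (hA : A ∈ K) {φ : Plane → ℝ} (hφ : IsTestFunction Ω φ) :
    (∫ x in Ω, fderiv ℝ φ x (flagField K A x)) + ∫ x in Ω, unitIndicator K x * φ x =
      ((Measure.hausdorffMeasure 1 : Measure Plane).real (openEdge (K.erase A)))⁻¹ *
        ∫ x in openEdge (K.erase A), φ x ∂(Measure.hausdorffMeasure 1 : Measure Plane) := by
  have hφ' : ContDiff ℝ 1 φ := hφ.1.of_le (by simp)
  have hsub := hT.openTriangle_subset hΩ hK
  rw [← green_flag hK hA hφ', setIntegral_eq_of_subset_of_forall_sdiff_eq_zero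
    hΩ.isOpen.measurableSet hsub, setIntegral_eq_of_subset_of_forall_sdiff_eq_zero
    hΩ.isOpen.measurableSet hsub, ← integral_add]
  · refine setIntegral_congr_fun (isOpen_openTriangle K).measurableSet fun x hx => ?_
    simp only [inner_gradient, flagField, unitIndicator, Set.indicator_of_mem hx]
  · have : Continuous fun x => fderiv ℝ φ x ((2 * area K)⁻¹ • (x - A)) :=
      hφ.continuous_fderiv.clm_apply (by fun_prop)
    refine IntegrableOn.congr_fun ((this.continuousOn.integrableOn_compact
      (isCompact_hull K)).mono_set interior_subset) (fun x hx => ?_)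
      (isOpen_openTriangle K).measurableSet
    simp only [flagField, Set.indicator_of_mem hx]
  · have : Continuous fun x => (area K)⁻¹ * φ x := hφ.continuous.const_mul _
    refine IntegrableOn.congr_fun ((this.continuousOn.integrableOn_compact
      (isCompact_hull K)).mono_set interior_subset) (fun x hx => ?_)
      (isOpen_openTriangle K).measurableSet
    simp only [unitIndicator, Set.indicator_of_mem hx]
  · intro x hx; simp [unitIndicator, Set.indicator_of_notMem hx.2]
  · intro x hx; simp [flagField, Set.indicator_of_notMem hx.2]

-- The edges of K through A carry no flux, on other triangles the field vanishes, and the hypothesis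
-- excludes the one remaining edge.
open Classical in
theorem normalTrace_flagField {K : Finset Plane} (hK : K ∈ triangles T) {A : Plane} (hA : A ∈ K)
    (h : K.erase A ∈ boundaryEdges Ω T → ¬ openEdge (K.erase A) ⊆ ΓN) :
    HasNormalTrace Ω T ΓN (flagField K A) 0 := by
  intro K' hK' e he heK heN n hn x hx
  by_cases hKK : K' = K
  · subst hKK
    have hAe : A ∈ e := by
      by_contra hAe
      obtain ⟨A', hA', rfl⟩ := exists_eq_erase hK' heK he.2.1
      obtain rfl : A = A' := by
        by_contra hne
        exact hAe (Finset.mem_erase.2 ⟨hne, hA⟩)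
      exact h he heN
    have h0 : inner ℝ ((2 * area K')⁻¹ • (x - A)) n = 0 := by
      rw [inner_smul_left, real_inner_comm, inner_sub_right, hn.inner_eq hx.1 hAe, sub_self, mul_zero]
    have hcont : Continuous fun y : Plane => inner ℝ ((2 * area K')⁻¹ • (y - A)) n := by fun_prop
    have hlim := (hcont.tendsto x).mono_left (nhdsWithin_le_nhds (s := openTriangle K'))
    rw [h0] at hlim
    refine hlim.congr' ?_
    filter_upwards [self_mem_nhdsWithin] with y hy
    rw [flagField, Set.indicator_of_mem hy]
  · refine tendsto_const_nhds.congr' ?_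
    filter_upwards [self_mem_nhdsWithin] with y hy
    rw [flagField_of_ne hK hK' hKK A hy, inner_zero_left]
    rfl

theorem memLp_flagField (hT : IsTriangulation Ω T) (hΩ : IsPolygonalDomain Ω) {K : Finset Plane}
    (hK : K ∈ triangles T) (A : Plane) : MemLp (flagField K A) 2 (volume.restrict Ω) :=
  hT.memLp_of_piecewise hΩ fun K' hK' => by
    obtain ⟨a, c, hac⟩ := flagField_piecewise hK A K' hK'
    exact ⟨fun x => a + c • x, by fun_prop, hac⟩

theorem memLp_unitIndicator (hT : IsTriangulation Ω T) (hΩ : IsPolygonalDomain Ω)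
    {K : Finset Plane} (hK : K ∈ triangles T) : MemLp (unitIndicator K) 2 (volume.restrict Ω) :=
  hT.memLp_of_piecewise hΩ fun K' hK' => by
    obtain ⟨m, hm⟩ := unitIndicator_piecewise hK K' hK'
    exact ⟨fun _ => m, by fun_prop, hm⟩

/-- The flux leaves Ω through an edge on which no normal condition is imposed. Test functions vanish
on that edge, so it does not contribute to the weak divergence. -/
theorem isRTFlux_of_dirichlet_edge (hT : IsTriangulation Ω T) (hΩ : IsPolygonalDomain Ω)
    {K e : Finset Plane} (hK : K ∈ triangles T) (heK : e ⊆ K) (he : e ∈ boundaryEdges Ω T)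
    (heN : ¬ openEdge e ⊆ ΓN) : ∃ q, IsRTFlux Ω T ΓN q (unitIndicator K) := by
  classical
  obtain ⟨A, hA, rfl⟩ := exists_eq_erase hK heK he.2.1
  refine ⟨flagField K A, flagField_piecewise hK A, unitIndicator_piecewise hK, fun φ hφ => ?_,
    normalTrace_flagField hK hA fun _ => heN⟩
  rw [eq_neg_iff_add_eq_zero, integral_flagField hT hΩ hK hA hφ,
    setIntegral_eq_zero_of_forall_eq_zero, mul_zero]
  intro x hx
  exact hφ.eq_zero fun h => hΩ.notMem_frontier h (openEdge_subset_frontier he hx)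

/-- Both fields produce the same average over the common edge. In the difference these cancel, so a
unit of mass passes from one triangle to the other. -/
theorem isRTFlux_of_adjacent (hT : IsTriangulation Ω T) (hΩ : IsPolygonalDomain Ω)
    {K K' e : Finset Plane} (hK : K ∈ triangles T) (hK' : K' ∈ triangles T) (hne : K ≠ K')
    (hcard : e.card = 2) (heK : e ⊆ K) (heK' : e ⊆ K') :
    ∃ q, IsRTFlux Ω T ΓN q (fun x => unitIndicator K x - unitIndicator K' x) := by
  classical
  have heΩ := hT.openEdge_subset hΩ hcard hK hK' hne heK heK'
  have hnb : e ∉ boundaryEdges Ω T := fun hb => by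
    obtain ⟨x, hx⟩ := openEdge_nonempty hcard
    exact hΩ.notMem_frontier (heΩ hx) (openEdge_subset_frontier hb hx)
  obtain ⟨A, hA, hAe⟩ := exists_eq_erase hK heK hcard
  obtain ⟨A', hA', hAe'⟩ := exists_eq_erase hK' heK' hcard
  refine ⟨fun x => flagField K A x - flagField K' A' x, fun L hL => ?_, fun L hL => ?_,
    fun φ hφ => ?_, fun L hL e₁ he₁ heL heN n hn x hx => ?_⟩
  · obtain ⟨a, c, hac⟩ := flagField_piecewise hK A L hL
    obtain ⟨a', c', hac'⟩ := flagField_piecewise hK' A' L hL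
    exact ⟨a - a', c - c', fun x hx => by rw [hac x hx, hac' x hx]; module⟩
  · obtain ⟨m, hm⟩ := unitIndicator_piecewise hK L hL
    obtain ⟨m', hm'⟩ := unitIndicator_piecewise hK' L hL
    exact ⟨m - m', fun x hx => by rw [hm x hx, hm' x hx]⟩
  · have h1 := integral_flagField hT hΩ hK hA hφ
    have h2 := integral_flagField hT hΩ hK' hA' hφ
    rw [← hAe] at h1
    rw [← hAe'] at h2
    have g2 := hφ.memLp_gradient (volume.restrict Ω)
    have φ2 := hφ.memLp (volume.restrict Ω)
    have e1 : ∫ x in Ω, fderiv ℝ φ x (flagField K A x - flagField K' A' x) =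
        (∫ x in Ω, fderiv ℝ φ x (flagField K A x)) - ∫ x in Ω, fderiv ℝ φ x (flagField K' A' x) := by
      simp_rw [map_sub, ← inner_gradient]
      exact integral_sub (integrable_inner_of_memLp g2 (memLp_flagField hT hΩ hK A))
        (integrable_inner_of_memLp g2 (memLp_flagField hT hΩ hK' A'))
    have e2 : ∫ x in Ω, (unitIndicator K x - unitIndicator K' x) * φ x =
        (∫ x in Ω, unitIndicator K x * φ x) - ∫ x in Ω, unitIndicator K' x * φ x := by
      simp_rw [sub_mul]
      exact integral_sub ((memLp_unitIndicator hT hΩ hK).integrable_mul φ2)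
        ((memLp_unitIndicator hT hΩ hK').integrable_mul φ2)
    rw [e1, e2]
    linarith
  · have h1 := normalTrace_flagField (Ω := Ω) (ΓN := ΓN) hK hA (fun h => absurd (hAe ▸ h) hnb)
      L hL e₁ he₁ heL heN n hn x hx
    have h2 := normalTrace_flagField (Ω := Ω) (ΓN := ΓN) hK' hA' (fun h => absurd (hAe' ▸ h) hnb)
      L hL e₁ he₁ heL heN n hn x hx
    simpa [inner_sub_left] using h1.sub h2

/-- Fluxes between adjacent triangles telescope along chains, and any two triangles are joined by a
chain of common edges because Ω is connected. -/
theorem exists_isRTFlux_sub (hT : IsTriangulation Ω T) (hΩ : IsPolygonalDomain Ω)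
    {K₀ : Finset Plane} (hK₀ : K₀ ∈ triangles T) : ∀ K ∈ triangles T,
      ∃ q, IsRTFlux Ω T ΓN q (fun x => unitIndicator K x - unitIndicator K₀ x) := by
  refine hT.forall_of_adjacent hΩ hK₀ ⟨fun _ => 0, by simpa using isRTFlux_zero⟩ ?_
  rintro K hK K' hK' hne e hcard heK heK' ⟨q, hq⟩
  obtain ⟨q', hq'⟩ := isRTFlux_of_adjacent (ΓN := ΓN) hT hΩ hK' hK hne.symm hcard heK' heK
  refine ⟨_, (hq'.add hq hT hΩ).congr_div hT hΩ fun L _ x _ => ?_⟩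
  ring

/-! ### A bounded right inverse of the divergence on X_h. -/

theorem memLp_const_smul {F : Type*} [NormedAddCommGroup F] [NormedSpace ℝ F] {μ : Measure Plane}
    {f : Plane → F} (hf : MemLp f 2 μ) (c : ℝ) : MemLp (fun x => c • f x) 2 μ :=
  hf.const_smul c

theorem l2norm_add_le {F : Type*} [NormedAddCommGroup F] {A : Set Plane} {f g : Plane → F}
    (hf : MemLp f 2 (volume.restrict A)) (hg : MemLp g 2 (volume.restrict A)) :
    l2norm A (fun x => f x + g x) ≤ l2norm A f + l2norm A g := by
  change l2norm A (f + g) ≤ _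
  rw [← norm_toLp_eq_l2norm hf, ← norm_toLp_eq_l2norm hg, ← norm_toLp_eq_l2norm (hf.add hg),
    MemLp.toLp_add]
  exact norm_add_le _ _

theorem l2norm_smul {F : Type*} [NormedAddCommGroup F] [NormedSpace ℝ F] (A : Set Plane)
    (c : ℝ) (f : Plane → F) : l2norm A (fun x => c • f x) = |c| * l2norm A f := by
  simp only [l2norm, norm_smul, mul_pow]
  rw [integral_const_mul, Real.sqrt_mul (by positivity), Real.sqrt_sq (norm_nonneg c),
    Real.norm_eq_abs]

theorem l2norm_sum_le {F : Type*} [NormedAddCommGroup F] {A : Set Plane} {ι : Type*} (s : Finset ι)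
    {f : ι → Plane → F} (hf : ∀ i ∈ s, MemLp (f i) 2 (volume.restrict A)) :
    l2norm A (fun x => ∑ i ∈ s, f i x) ≤ ∑ i ∈ s, l2norm A (f i) := by
  classical
  induction s using Finset.induction_on with
  | empty => simp [l2norm]
  | insert i s hi ih =>
    simp_rw [Finset.sum_insert hi]
    refine (l2norm_add_le (hf i (Finset.mem_insert_self i s)) (memLp_finsetSum _ fun j hj =>
      hf j (Finset.mem_insert_of_mem hj))).trans ?_
    gcongr
    exact ih fun j hj => hf j (Finset.mem_insert_of_mem hj)

theorem MemXh.memLp {g : Plane → ℝ} (h : MemXh Ω T ΓD g) (hT : IsTriangulation Ω T)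
    (hΩ : IsPolygonalDomain Ω) : MemLp g 2 (volume.restrict Ω) :=
  hT.memLp_of_piecewise hΩ fun K hK => by
    obtain ⟨m, hm⟩ := h.1 K hK
    exact ⟨fun _ => m, by fun_prop, hm⟩

theorem abs_mul_area_le {g : Plane → ℝ} (hg : MemLp g 2 (volume.restrict Ω))
    (hT : IsTriangulation Ω T) (hΩ : IsPolygonalDomain Ω)
    {K : Finset Plane} (hK : K ∈ triangles T) {m : ℝ} (hm : ∀ x ∈ openTriangle K, g x = m) :
    |m * area K| ≤ Real.sqrt (area K) * l2norm Ω g := by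
  have h1 : m ^ 2 * area K ≤ ∫ x in Ω, ‖g x‖ ^ 2 := by
    have : ∫ x in openTriangle K, ‖g x‖ ^ 2 = m ^ 2 * area K := by
      rw [setIntegral_congr_fun (g := fun _ => m ^ 2) (isOpen_openTriangle K).measurableSet
        (fun x hx => by simp [hm x hx])]
      simp [area, mul_comm]
    rw [← this]
    exact setIntegral_mono_set hg.norm.integrable_sq (Eventually.of_forall fun x => by positivity)
      (hT.openTriangle_subset hΩ hK).eventuallyLE
  have h2 := Real.sqrt_le_sqrt h1
  have hp := area_pos hK
  rw [Real.sqrt_mul (sq_nonneg m), Real.sqrt_sq_eq_abs] at h2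
  rw [abs_mul, abs_of_pos hp, l2norm]
  calc |m| * area K = Real.sqrt (area K) * (|m| * Real.sqrt (area K)) := by
        nth_rewrite 1 [← Real.mul_self_sqrt hp.le]; ring
    _ ≤ _ := by gcongr

/-- The divergence maps `RT_{h,0}` onto `X_h`, with a bounded right inverse. -/
theorem exists_bounded_isRTFlux (hT : IsTriangulation Ω T) (hΩ : IsPolygonalDomain Ω)
    (hΓ : IsBoundaryPartition Ω T ΓD ΓN) : ∃ C : ℝ, ∀ g : Plane → ℝ, MemXh Ω T ΓD g →
      ∃ q, IsRTFlux Ω T ΓN q g ∧ l2norm Ω q ≤ C * l2norm Ω g := by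
  classical
  -- All mass is collected in one reference triangle. Next to a Dirichlet edge it is discharged
  -- there; without a Dirichlet part the total mass is zero and no outlet is needed.
  have hbase : ∃ K₀ ∈ triangles T, ∃ q, IsRTFlux Ω T ΓN q (fun x => unitIndicator K₀ x) ∨
      (ΓD = ∅ ∧ IsRTFlux Ω T ΓN q (fun _ => 0)) := by
    rcases ΓD.eq_empty_or_nonempty with h | ⟨x, hx⟩
    · obtain ⟨x, hx⟩ := hΩ.isConnected.nonempty
      have hx' := subset_closure hx
      rw [hT.closure_eq] at hx'
      simp only [Set.mem_iUnion, exists_prop] at hx'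
      obtain ⟨K, hK, _⟩ := hx'
      exact ⟨K, hT.mem_tris.1 hK, _, Or.inr ⟨h, isRTFlux_zero⟩⟩
    · obtain ⟨e, he, _, heD⟩ := hΓ.no_isolated x hx
      obtain ⟨K, hK, heK⟩ := hT.exists_triangle he.1
      have heN : ¬ openEdge e ⊆ ΓN := fun h => by
        obtain ⟨y, hy⟩ := openEdge_nonempty he.2.1
        exact Set.disjoint_left.1 hΓ.disjoint (heD hy) (h hy)
      obtain ⟨q, hq⟩ := isRTFlux_of_dirichlet_edge hT hΩ hK heK he heN
      exact ⟨K, hK, q, Or.inl hq⟩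
  obtain ⟨K₀, hK₀, q₀, hq₀⟩ := hbase
  have hsub := exists_isRTFlux_sub (ΓN := ΓN) hT hΩ hK₀
  choose! q hq using hsub
  have hq₀2 : MemLp q₀ 2 (volume.restrict Ω) := by
    rcases hq₀ with h | h
    · exact h.memLp_field hT hΩ
    · exact h.2.memLp_field hT hΩ
  -- The mass m_K|K| travels along the flux of K and then along q₀, and |m_K||K| is at most √|K|
  -- times the norm of g.
  refine ⟨∑ K ∈ hT.tris, Real.sqrt (area K) * (l2norm Ω (q K) + l2norm Ω q₀), fun g hg => ?_⟩
  have hg2 := hg.memLp hT hΩ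
  have hfin : IsFiniteMeasure (volume.restrict Ω) := hT.isFiniteMeasure
  obtain ⟨hgc, hg0⟩ := hg
  choose! m hm using hgc
  have hsumint : ∫ x in Ω, g x = ∑ K ∈ hT.tris, m K * area K := by
    rw [hT.integral_eq_sum hΩ (hg2.integrable one_le_two)]
    refine Finset.sum_congr rfl fun K hK => ?_
    rw [setIntegral_congr_fun (g := fun _ => m K) (isOpen_openTriangle K).measurableSet
        (fun x hx => hm K (hT.mem_tris.1 hK) x hx)]
    simp [area, mul_comm]
  -- With χ_K the indicator normalized to integral one, g = Σ m_K|K|(χ_K − χ_{K₀}) + (Σ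
  -- m_K|K|)χ_{K₀}; the second part is supplied by q₀.
  have hmain : IsRTFlux Ω T ΓN (fun x => ∑ K ∈ hT.tris, (m K * area K) • q K x)
      (fun x => ∑ K ∈ hT.tris, (m K * area K) * (unitIndicator K x - unitIndicator K₀ x)) :=
    IsRTFlux.sum _ (fun K hK => (hq K (hT.mem_tris.1 hK)).const_smul _) hT hΩ
  have hval : ∀ K ∈ triangles T, ∀ x ∈ openTriangle K,
      ∑ L ∈ hT.tris, (m L * area L) * unitIndicator L x = g x := by
    intro K hK x hx
    rw [Finset.sum_eq_single_of_mem K (hT.mem_tris.2 hK), unitIndicator, Set.indicator_of_mem hx,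
      hm K hK x hx, mul_assoc, mul_inv_cancel₀ (area_pos hK).ne', mul_one]
    intro L hL hne
    rw [unitIndicator_of_ne (hT.mem_tris.1 hL) hK hne.symm hx, mul_zero]
  have hq₀' : ∃ d₀, IsRTFlux Ω T ΓN q₀ d₀ ∧ ∀ x, (∑ K ∈ hT.tris, m K * area K) * d₀ x =
      (∑ K ∈ hT.tris, m K * area K) * unitIndicator K₀ x := by
    rcases hq₀ with h | h
    · exact ⟨_, h, fun x => rfl⟩
    · refine ⟨_, h.2, fun x => ?_⟩
      rw [← hsumint, hg0 h.1]; simp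
  obtain ⟨d₀, hd₀, hd₀'⟩ := hq₀'
  have htot := hmain.add (hd₀.const_smul (∑ K ∈ hT.tris, m K * area K)) hT hΩ
  refine ⟨_, htot.congr_div hT hΩ fun K hK x hx => ?_, ?_⟩
  · rw [hd₀', ← hval K hK x hx, Finset.sum_mul, ← Finset.sum_add_distrib]
    refine Finset.sum_congr rfl fun L _ => by ring
  · have hqK2 : ∀ K ∈ hT.tris, MemLp (fun x => (m K * area K) • q K x) 2 (volume.restrict Ω) :=
      fun K hK => by
        have h := (hq K (hT.mem_tris.1 hK)).memLp_field hT hΩ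
        exact memLp_const_smul h (m K * area K)
    have hsum2 : MemLp (fun x => ∑ K ∈ hT.tris, (m K * area K) • q K x) 2 (volume.restrict Ω) :=
      memLp_finsetSum hT.tris hqK2
    refine (l2norm_add_le hsum2 (memLp_const_smul hq₀2 (∑ K ∈ hT.tris, m K * area K))).trans ?_
    refine (add_le_add_left (l2norm_sum_le _ hqK2) _).trans ?_
    simp_rw [l2norm_smul]
    have h1 : |∑ K ∈ hT.tris, m K * area K| * l2norm Ω q₀ ≤
        ∑ K ∈ hT.tris, |m K * area K| * l2norm Ω q₀ := by
      rw [← Finset.sum_mul]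
      exact mul_le_mul_of_nonneg_right (Finset.abs_sum_le_sum_abs _ _) (l2norm_nonneg _ _)
    refine (add_le_add_right h1 _).trans ?_
    rw [← Finset.sum_add_distrib, Finset.sum_mul]
    refine Finset.sum_le_sum fun K hK => ?_
    rw [← mul_add, mul_right_comm]
    exact mul_le_mul_of_nonneg_right (abs_mul_area_le hg2 hT hΩ (hT.mem_tris.1 hK)
      (hm K (hT.mem_tris.1 hK))) (add_nonneg (l2norm_nonneg _ _) (l2norm_nonneg _ _))

/-! ### The constant `κ_h` -/

theorem memVh_zero : MemVh Ω T ΓD 0 (H1.zero Ω) :=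
  ⟨continuousOn_const, fun _ _ => ⟨0, 0, fun x _ => by simp [H1.zero]⟩, fun x _ => rfl,
    fun _ => by simp [H1.zero]⟩

theorem l2norm_zero_sub {F : Type*} [NormedAddCommGroup F] (A : Set Plane) (f : Plane → F) :
    l2norm A (fun x => 0 - f x) = l2norm A f := by
  simp [l2norm]

/-- The bounded right inverse, paired with v = 0, bounds all the infima in `kappa` by one constant,
so that the supremum is a true one. The margin η makes attainment of the minimum unnecessary. -/
theorem exists_kappa_approx (hT : IsTriangulation Ω T) (hΩ : IsPolygonalDomain Ω)
    (hΓ : IsBoundaryPartition Ω T ΓD ΓN) {g : Plane → ℝ} (hg : MemXh Ω T ΓD g) {η : ℝ}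
    (hη : 0 < η) : ∃ (v : H1 Ω) (q : Plane → Plane), MemVh Ω T ΓD 0 v ∧ MemRT Ω T q ∧
      HasNormalTrace Ω T ΓN q 0 ∧ HasWeakDiv Ω q (fun x => - g x) ∧
      l2norm Ω (fun x => v.grad x - q x) ≤ (kappa Ω T ΓD ΓN + η) * l2norm Ω g := by
  obtain ⟨C, hC⟩ := exists_bounded_isRTFlux hT hΩ hΓ
  have hneg : ∀ g, MemXh Ω T ΓD g → ∃ q, MemRT Ω T q ∧ HasNormalTrace Ω T ΓN q 0 ∧
      HasWeakDiv Ω q (fun x => - g x) ∧ l2norm Ω q ≤ C * l2norm Ω g := by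
    intro g hg
    obtain ⟨q, hq, hqC⟩ := hC g hg
    have hq' := hq.const_smul (-1)
    refine ⟨_, hq'.memRT hT hΩ, hq'.normal, ?_, ?_⟩
    · simpa using hq'.weakDiv
    · rw [l2norm_smul]; simpa using hqC
  -- The quotients in `kappa` omit this case; here the right inverse already gives a flux of norm
  -- zero.
  by_cases h0 : l2norm Ω g = 0
  · obtain ⟨q, h1, h2, h3, h4⟩ := hneg g hg
    refine ⟨H1.zero Ω, q, memVh_zero, h1, h2, h3, ?_⟩
    change l2norm Ω (fun x => 0 - q x) ≤ _
    rw [l2norm_zero_sub, h0, mul_zero]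
    rwa [h0, mul_zero] at h4
  · let S : (Plane → ℝ) → Set ℝ := fun g => {s : ℝ | ∃ (v : H1 Ω) (q : Plane → Plane),
      MemVh Ω T ΓD 0 v ∧ MemRT Ω T q ∧ HasNormalTrace Ω T ΓN q 0 ∧
      HasWeakDiv Ω q (fun x => - g x) ∧
      s = l2norm Ω (fun x => v.grad x - q x) / l2norm Ω g}
    have hbelow : ∀ g, BddBelow (S g) := fun g => ⟨0, by
      rintro s ⟨v, q, _, _, _, _, rfl⟩
      exact div_nonneg (l2norm_nonneg _ _) (l2norm_nonneg _ _)⟩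
    have hmem : ∀ g, MemXh Ω T ΓD g → l2norm Ω g ≠ 0 → ∃ s ∈ S g, s ≤ C := by
      intro g hg h0
      obtain ⟨q, h1, h2, h3, h4⟩ := hneg g hg
      refine ⟨_, ⟨H1.zero Ω, q, memVh_zero, h1, h2, h3, rfl⟩, ?_⟩
      change l2norm Ω (fun x => 0 - q x) / _ ≤ _
      rw [l2norm_zero_sub, div_le_iff₀ (lt_of_le_of_ne (l2norm_nonneg _ _) (Ne.symm h0))]
      exact h4
    have hle : sInf (S g) ≤ kappa Ω T ΓD ΓN := by
      refine le_csSup ⟨C, ?_⟩ ⟨g, hg, h0, rfl⟩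
      rintro r ⟨g', hg', h0', rfl⟩
      obtain ⟨s, hs, hsC⟩ := hmem g' hg' h0'
      exact (csInf_le (hbelow g') hs).trans hsC
    obtain ⟨s, hs, hsC⟩ := hmem g hg h0
    obtain ⟨s', ⟨v, q, h1, h2, h3, h4, rfl⟩, hs'⟩ := exists_lt_of_csInf_lt ⟨s, hs⟩
      (show sInf (S g) < kappa Ω T ΓD ΓN + η by linarith)
    refine ⟨v, q, h1, h2, h3, h4, ?_⟩
    rw [div_lt_iff₀ (lt_of_le_of_ne (l2norm_nonneg _ _) (Ne.symm h0))] at hs'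
    exact hs'.le


/-! ### Mollification and the product rule -/

/-- The convolution of `g` with a normalized bump function. -/
noncomputable def mollify (η : ContDiffBump (0 : Plane)) (g : Plane → ℝ) (x : Plane) : ℝ :=
  ∫ t, η.normed volume (x - t) * g t

theorem mollify_eq (η : ContDiffBump (0 : Plane)) (g : Plane → ℝ) :
    mollify η g = convolution (η.normed volume) g (ContinuousLinearMap.lsmul ℝ ℝ) volume := by
  ext x
  rw [convolution_lsmul_swap]
  rfl

theorem contDiff_mollify (η : ContDiffBump (0 : Plane)) {g : Plane → ℝ}
    (hg : LocallyIntegrable g) : ContDiff ℝ ((⊤ : ℕ∞) : WithTop ℕ∞) (mollify η g) := by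
  rw [mollify_eq]
  exact η.hasCompactSupport_normed.contDiff_convolution_left _ η.contDiff_normed hg

theorem fderiv_mollify (η : ContDiffBump (0 : Plane)) {g : Plane → ℝ}
    (hg : LocallyIntegrable g) (x w : Plane) :
    fderiv ℝ (mollify η g) x w = ∫ t, fderiv ℝ (η.normed volume) (x - t) w * g t := by
  have hc := η.hasCompactSupport_normed (μ := (volume : Measure Plane))
  have hd : ContDiff ℝ 1 (η.normed (volume : Measure Plane)) := η.contDiff_normed (n := 1)
  have hcon := (hc.fderiv ℝ).convolutionExists_left
    ((ContinuousLinearMap.lsmul ℝ ℝ : ℝ →L[ℝ] ℝ →L[ℝ] ℝ).precompL Plane)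
    (hd.continuous_fderiv one_ne_zero) hg x
  have h := hc.hasFDerivAt_convolution_left (ContinuousLinearMap.lsmul ℝ ℝ : ℝ →L[ℝ] ℝ →L[ℝ] ℝ)
    hd hg x
  rw [mollify_eq, h.fderiv, convolution_def, ContinuousLinearMap.integral_apply hcon,
    ← integral_sub_left_eq_self _ _ x]
  refine integral_congr_ae (Eventually.of_forall fun t => ?_)
  simp [ContinuousLinearMap.precompL_apply]

theorem abs_mollify_le (η : ContDiffBump (0 : Plane)) {g : Plane → ℝ} {M : ℝ}
    (hg : ∀ x, |g x| ≤ M) (x : Plane) : |mollify η g x| ≤ M := by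
  have hint : Integrable fun t => η.normed volume (x - t) * M :=
    (η.integrable_normed.comp_sub_left x).mul_const M
  refine (abs_integral_le_integral_abs).trans ((integral_mono_of_nonneg
    (Eventually.of_forall fun t => abs_nonneg _) hint (Eventually.of_forall fun t => ?_)).trans ?_)
  · change |_ * _| ≤ _
    rw [abs_mul, abs_of_nonneg (η.nonneg_normed _)]
    exact mul_le_mul_of_nonneg_left (hg t) (η.nonneg_normed _)
  · rw [integral_mul_const, integral_sub_left_eq_self (fun t => η.normed volume t) volume x,
      η.integral_normed, one_mul]

theorem tendsto_mollify {η : ℕ → ContDiffBump (0 : Plane)}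
    (hη : Tendsto (fun n => (η n).rOut) atTop (𝓝 0)) {g : Plane → ℝ}
    (hg : AEStronglyMeasurable g volume) {x : Plane} (hx : ContinuousAt g x) :
    Tendsto (fun n => mollify (η n) g x) atTop (𝓝 (g x)) := by
  simp_rw [mollify_eq]
  refine ContDiffBump.convolution_tendsto_right (g := fun _ => g) (k := fun _ => x) hη
    (Eventually.of_forall fun _ => hg) ?_ tendsto_const_nhds
  exact hx.tendsto.comp tendsto_snd

theorem exists_mollifier_seq :
    ∃ η : ℕ → ContDiffBump (0 : Plane), Tendsto (fun n => (η n).rOut) atTop (𝓝 0) :=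
  ⟨fun n => ⟨1 / ((n : ℝ) + 1) / 2, 1 / ((n : ℝ) + 1), by positivity,
    half_lt_self (by positivity)⟩, tendsto_one_div_add_atTop_nhds_zero_nat⟩

/-- The derivative falls on the bump, which as a function of t is an admissible test function
because the ball lies in U. The sign from differentiating in t cancels the sign in the weak
gradient. -/
theorem HasWeakGrad.fderiv_mollify {U : Set Plane} (hU : IsOpen U) {a : Plane → ℝ}
    {A : Plane → Plane} (ha : IntegrableOn a U) (h : HasWeakGrad U a A)
    (η : ContDiffBump (0 : Plane)) {x : Plane} (hx : Metric.closedBall x η.rOut ⊆ U) (w : Plane) :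
    fderiv ℝ (mollify η (U.indicator a)) x w =
      ∫ t in U, inner ℝ (A t) w * η.normed volume (x - t) := by
  have hd : ContDiff ℝ ((⊤ : ℕ∞) : WithTop ℕ∞) (η.normed (volume : Measure Plane)) :=
    η.contDiff_normed
  have htest : IsTestFunction U fun t => η.normed volume (x - t) := by
    have hsub : tsupport (fun t => η.normed volume (x - t)) ⊆ Metric.closedBall x η.rOut := by
      refine closure_minimal (fun t ht => ?_) Metric.isClosed_closedBall
      have : x - t ∈ Function.support (η.normed volume) := ht
      rw [η.support_normed_eq, mem_ball_zero_iff, ← dist_eq_norm, dist_comm] at this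
      exact this.le
    exact ⟨hd.comp (contDiff_const.sub contDiff_id),
      (isCompact_closedBall x η.rOut).of_isClosed_subset (isClosed_tsupport _) hsub,
      hsub.trans hx⟩
  have hder : ∀ t, fderiv ℝ (fun t => η.normed volume (x - t)) t w =
      - fderiv ℝ (η.normed volume) (x - t) w := fun t => by
    have h1 := ((hd.differentiable (by simp)) (x - t)).hasFDerivAt.comp t
      ((hasFDerivAt_const x t).sub (hasFDerivAt_id t))
    have h2 : fderiv ℝ (fun t => η.normed volume (x - t)) t = _ := h1.fderiv
    rw [h2]; simp
  have h1 := h _ htest w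
  simp_rw [hder, mul_neg] at h1
  rw [integral_neg, neg_inj] at h1
  rw [LocalFEM.fderiv_mollify _ ((integrable_indicator_iff hU.measurableSet).2 ha).locallyIntegrable, ← h1,
    ← integral_indicator hU.measurableSet]
  refine integral_congr_ae (Eventually.of_forall fun t => ?_)
  by_cases ht : t ∈ U <;> simp [ht, mul_comm]

/-- The product of two continuous functions with integrable weak gradients. -/
theorem HasWeakGrad.mul {U : Set Plane} (hU : IsOpen U) {a v : Plane → ℝ} {A G : Plane → Plane}
    {M : ℝ} (ha : ContinuousOn a U) (hM : ∀ x ∈ U, |a x| ≤ M) (hv : ContinuousOn v U)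
    (hvi : IntegrableOn v U) (hai : IntegrableOn a U)
    (hA : IntegrableOn A U) (hG : IntegrableOn G U) (hWa : HasWeakGrad U a A)
    (hWv : HasWeakGrad U v G) :
    HasWeakGrad U (fun x => a x * v x) (fun x => a x • G x + v x • A x) := by
  intro ψ hψ w
  obtain ⟨η, hη⟩ := exists_mollifier_seq
  rcases U.eq_empty_or_nonempty with rfl | ⟨x₀, hx₀⟩
  · simp
  have hM0 : 0 ≤ M := (abs_nonneg _).trans (hM x₀ hx₀)
  -- Mollification acts on functions on the whole plane. The extension by zero may jump at the
  -- boundary of U, but the compact support of ψ keeps the derivative formula inside U.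
  set b := U.indicator a with hb
  have hbU : ∀ x ∈ U, b x = a x := fun x hx => Set.indicator_of_mem hx a
  have hbM : ∀ x, |b x| ≤ M := fun x => by
    by_cases hx : x ∈ U
    · rw [hbU x hx]; exact hM x hx
    · rw [hb, Set.indicator_of_notMem hx, abs_zero]; exact hM0
  have hbi : Integrable b := (integrable_indicator_iff hU.measurableSet).2 hai
  have hbc : ∀ x ∈ U, ContinuousAt b x := fun x hx =>
    ((ha.continuousAt (hU.mem_nhds hx)).congr
      ((hU.eventually_mem hx).mono fun y hy => (hbU y hy).symm))
  have hψ2 : HasCompactSupport fun x => v x * ψ x := hψ.2.1.mul_left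
  have hvψ : Continuous fun x => v x * ψ x := by
    refine continuous_iff_continuousAt.2 fun x => ?_
    by_cases hx : x ∈ U
    · exact (hv.continuousAt (hU.mem_nhds hx)).mul hψ.continuous.continuousAt
    · have : (fun _ => (0 : ℝ)) =ᶠ[𝓝 x] fun x => v x * ψ x := by
        have h1 : x ∉ tsupport ψ := fun h => hx (hψ.2.2 h)
        filter_upwards [(isClosed_tsupport ψ).isOpen_compl.mem_nhds h1] with y hy
        rw [image_eq_zero_of_notMem_tsupport hy, mul_zero]
      exact continuousAt_const.congr this
  obtain ⟨N, hN⟩ := hvψ.bounded_above_of_compact_support hψ2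
  obtain ⟨δ, hδ, hδU⟩ := hψ.2.1.isCompact.exists_cthickening_subset_open hU hψ.2.2
  have hAw : IntegrableOn (fun t => inner ℝ (A t) w) U := hA.inner_const w
  have hGw : IntegrableOn (fun t => inner ℝ (G t) w) U := hG.inner_const w
  have hdψc : Continuous fun x => fderiv ℝ ψ x w :=
    hψ.continuous_fderiv.clm_apply continuous_const
  have hdψs : HasCompactSupport fun x => fderiv ℝ ψ x w := hψ.2.1.fderiv_apply ℝ w
  have hvdψ : IntegrableOn (fun x => v x * fderiv ℝ ψ x w) U :=
    integrable_mul_of_compactSupport hvi hdψc hdψs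
  have hGψ : IntegrableOn (fun x => inner ℝ (G x) w * ψ x) U :=
    integrable_mul_of_compactSupport hGw hψ.continuous hψ.2.1
  have hmc : ∀ n, Continuous (mollify (η n) b) := fun n =>
    (contDiff_mollify (η n) hbi.locallyIntegrable).continuous
  -- The weak gradient of v is tested with ψ times the mollified a. Fubini and the symmetry of the
  -- bump move the mollifier from A to the continuous function vψ. Hence only pointwise convergence
  -- at points of continuity is needed, and A may be merely integrable.
  have hkey : ∀ᶠ n in atTop,
      (∫ x in U, v x * fderiv ℝ ψ x w * mollify (η n) b x) +
        ∫ t in U, inner ℝ (A t) w * mollify (η n) (fun x => v x * ψ x) t =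
      - ∫ x in U, inner ℝ (G x) w * ψ x * mollify (η n) b x := by
    filter_upwards [hη.eventually (gt_mem_nhds hδ)] with n hn
    have hball : ∀ x ∈ tsupport ψ, Metric.closedBall x (η n).rOut ⊆ U := fun x hx =>
      ((Metric.closedBall_subset_closedBall hn.le).trans
        (Metric.closedBall_subset_cthickening hx δ)).trans hδU
    have hcd := contDiff_mollify (η n) hbi.locallyIntegrable
    have h1 := hWv _ (hψ.mul_contDiff hcd) w
    have hder : ∀ x, v x * fderiv ℝ (fun x => ψ x * mollify (η n) b x) x w =
        v x * fderiv ℝ ψ x w * mollify (η n) b x +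
          v x * ψ x * fderiv ℝ (mollify (η n) b) x w := fun x => by
      rw [fderiv_fun_mul (hψ.differentiable x) (hcd.differentiable (by simp) x)]
      simp only [add_apply, smul_apply, smul_eq_mul]
      ring
    have hder2 : ∀ x, v x * ψ x * fderiv ℝ (mollify (η n) b) x w =
        ∫ t in U, v x * ψ x * (inner ℝ (A t) w * (η n).normed volume (x - t)) := fun x => by
      rw [integral_const_mul]
      by_cases hx : x ∈ tsupport ψ
      · rw [HasWeakGrad.fderiv_mollify hU hai hWa (η n) (hball x hx) w]
      · rw [image_eq_zero_of_notMem_tsupport hx]; simp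
    have hi1 : IntegrableOn (fun x => v x * fderiv ℝ ψ x w * mollify (η n) b x) U :=
      hvdψ.mul_bdd (hmc n).aestronglyMeasurable
        (Eventually.of_forall fun x => abs_mollify_le (η n) hbM x)
    have hi2 : IntegrableOn (fun x => v x * ψ x * fderiv ℝ (mollify (η n) b) x w) U := by
      have : Continuous fun x => v x * ψ x * fderiv ℝ (mollify (η n) b) x w :=
        hvψ.mul ((hcd.continuous_fderiv (by simp)).clm_apply continuous_const)
      exact (this.integrable_of_hasCompactSupport hψ2.mul_right).integrableOn
    simp_rw [hder] at h1
    rw [integral_add hi1 hi2] at h1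
    simp_rw [hder2] at h1
    have hprod : Integrable (Function.uncurry fun x t : Plane =>
        v x * ψ x * (inner ℝ (A t) w * (η n).normed volume (x - t)))
        ((volume.restrict U).prod (volume.restrict U)) := by
      have hp1 : Integrable (fun z : Plane × Plane => (v z.1 * ψ z.1) * inner ℝ (A z.2) w)
          ((volume.restrict U).prod (volume.restrict U)) :=
        ((hvψ.integrable_of_hasCompactSupport hψ2).integrableOn (s := U)).mul_prod hAw
      obtain ⟨B, hB⟩ := (η n).continuous_normed.bounded_above_of_compact_support
        ((η n).hasCompactSupport_normed (μ := (volume : Measure Plane)))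
      have hp2 := hp1.mul_bdd (g := fun z : Plane × Plane => (η n).normed volume (z.1 - z.2))
        ((η n).continuous_normed.comp (continuous_fst.sub continuous_snd)).aestronglyMeasurable
        (Eventually.of_forall fun z => hB _)
      exact hp2.congr (Eventually.of_forall fun z => by simp [Function.uncurry, mul_assoc])
    rw [integral_integral_swap hprod] at h1
    have h2 : ∀ t, ∫ x in U, v x * ψ x * (inner ℝ (A t) w * (η n).normed volume (x - t)) =
        inner ℝ (A t) w * mollify (η n) (fun x => v x * ψ x) t := fun t => by
      rw [setIntegral_eq_integral_of_forall_compl_eq_zero (fun x hx => by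
        rw [hψ.eq_zero hx]; simp), mollify, ← integral_const_mul]
      refine integral_congr_ae (Eventually.of_forall fun x => ?_)
      change _ * (_ * (η n).normed volume (x - t)) = _ * ((η n).normed volume (t - x) * _)
      rw [← (η n).normed_neg (μ := volume) (t - x), neg_sub]; ring
    simp_rw [h2] at h1
    rw [h1]
    simp_rw [mul_assoc]
  have hae : ∀ᵐ x ∂volume.restrict U, x ∈ U := ae_restrict_mem hU.measurableSet
  have hbnd : ∀ {F : Plane → ℝ}, IntegrableOn F U → ∀ n : ℕ, ∀ᵐ x ∂volume.restrict U,
      ‖F x * mollify (η n) b x‖ ≤ ‖F x‖ * M := fun _ n => Eventually.of_forall fun x => by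
    rw [norm_mul]
    exact mul_le_mul_of_nonneg_left (abs_mollify_le (η n) hbM x) (norm_nonneg _)
  have hconv : ∀ {F : Plane → ℝ}, IntegrableOn F U →
      Tendsto (fun n => ∫ x in U, F x * mollify (η n) b x) atTop (𝓝 (∫ x in U, F x * a x)) :=
    fun {F} hF => tendsto_integral_of_dominated_convergence (fun x => ‖F x‖ * M)
      (fun n => hF.aestronglyMeasurable.mul (hmc n).aestronglyMeasurable)
      (hF.norm.mul_const M) (hbnd hF) (hae.mono fun x hx => by
        rw [← hbU x hx]
        exact (tendsto_mollify hη hbi.aestronglyMeasurable (hbc x hx)).const_mul _)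
  have hconv3 : Tendsto (fun n => ∫ t in U, inner ℝ (A t) w * mollify (η n) (fun x => v x * ψ x) t)
      atTop (𝓝 (∫ t in U, inner ℝ (A t) w * (v t * ψ t))) :=
    tendsto_integral_of_dominated_convergence (fun t => ‖inner ℝ (A t) w‖ * N)
      (fun n => hAw.aestronglyMeasurable.mul (contDiff_mollify (η n)
        hvψ.locallyIntegrable).continuous.aestronglyMeasurable)
      (hAw.norm.mul_const N) (fun n => Eventually.of_forall fun t => by
        rw [norm_mul]
        exact mul_le_mul_of_nonneg_left (abs_mollify_le (η n) hN t) (norm_nonneg _))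
      (Eventually.of_forall fun t =>
        (tendsto_mollify hη hvψ.aestronglyMeasurable hvψ.continuousAt).const_mul _)
  have hlim := tendsto_nhds_unique (((hconv hvdψ).add hconv3).congr' hkey) (hconv hGψ).neg
  have e1 : ∫ x in U, a x * v x * fderiv ℝ ψ x w = ∫ x in U, v x * fderiv ℝ ψ x w * a x :=
    integral_congr_ae (Eventually.of_forall fun x => by ring)
  have hi1 : IntegrableOn (fun x => inner ℝ (G x) w * ψ x * a x) U :=
    hGψ.mul_bdd hai.aestronglyMeasurable (hae.mono hM)
  have hi2 : IntegrableOn (fun x => inner ℝ (A x) w * (v x * ψ x)) U :=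
    hAw.mul_bdd hvψ.aestronglyMeasurable (Eventually.of_forall hN)
  have e2 : ∫ x in U, inner ℝ (a x • G x + v x • A x) w * ψ x =
      (∫ x in U, inner ℝ (G x) w * ψ x * a x) + ∫ x in U, inner ℝ (A x) w * (v x * ψ x) := by
    rw [← integral_add hi1 hi2]
    refine integral_congr_ae (Eventually.of_forall fun x => ?_)
    simp only [inner_add_left, inner_smul_left, RCLike.conj_to_real]
    ring
  rw [e1, e2]
  linarith


/-! ### The estimate in Hilbert space -/

section Hilbert

variable {Y H : Type*} [NormedAddCommGroup Y] [InnerProductSpace ℝ Y]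
  [NormedAddCommGroup H] [InnerProductSpace ℝ H] {W Wh : Submodule ℝ (Y × H)}
  {X : Submodule ℝ Y} [X.HasOrthogonalProjection] {c : ℝ}

theorem norm_sub_starProjection_le (v : Y) {x : Y} (hx : x ∈ X) :
    ‖v - X.starProjection v‖ ≤ ‖v - x‖ := by
  have h1 : inner ℝ (v - X.starProjection v) (X.starProjection v - x) = 0 :=
    X.starProjection_inner_eq_zero v _ (X.sub_mem (X.starProjection_apply_mem v) hx)
  have h2 : v - x = (v - X.starProjection v) + (X.starProjection v - x) := by abel
  have h3 := norm_add_sq_eq_norm_sq_add_norm_sq_of_inner_eq_zero _ _ h1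
  rw [h2]
  nlinarith [norm_nonneg (v - X.starProjection v), norm_nonneg (X.starProjection v - x),
    norm_nonneg (v - X.starProjection v + (X.starProjection v - x))]

theorem norm_sq_eq_starProjection (v : Y) :
    ‖v‖ ^ 2 = ‖X.starProjection v‖ ^ 2 + ‖v - X.starProjection v‖ ^ 2 ∧
      ‖v‖ ^ 2 = inner ℝ (X.starProjection v) v + ‖v - X.starProjection v‖ ^ 2 := by
  have h1 : inner ℝ (v - X.starProjection v) (X.starProjection v) = 0 :=
    X.starProjection_inner_eq_zero v _ (X.starProjection_apply_mem v)
  have h2 : v = X.starProjection v + (v - X.starProjection v) := by abel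
  have h3 : inner ℝ (X.starProjection v) (v - X.starProjection v) = 0 := by
    rw [real_inner_comm]; exact h1
  have h4 := norm_add_sq_eq_norm_sq_add_norm_sq_of_inner_eq_zero _ _ h3
  rw [← h2] at h4
  rw [inner_sub_right, real_inner_self_eq_norm_sq] at h3
  constructor <;> nlinarith

/-- The pairing of z.1 with its projection equals the pairing of z.2 with a lifted flux, and the
rest of z.1 is controlled by the approximation property. A right inverse of the divergence on the
discrete space thus implies a Poincaré inequality. -/
theorem poincare_of_lifting (hc : 0 ≤ c) {C : ℝ} (hC : 0 ≤ C)
    (happrox : ∀ z ∈ W, ‖z.1 - X.starProjection z.1‖ ≤ c * ‖z.2‖)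
    (hbdd : ∀ x ∈ X, ∃ q : H, (∀ z ∈ W, inner ℝ q z.2 = inner ℝ x z.1) ∧ ‖q‖ ≤ C * ‖x‖)
    {z : Y × H} (hz : z ∈ W) : ‖z.1‖ ≤ (C + c) * ‖z.2‖ := by
  obtain ⟨q, hq, hqn⟩ := hbdd _ (X.starProjection_apply_mem z.1)
  obtain ⟨h1, h2⟩ := norm_sq_eq_starProjection (X := X) z.1
  rw [← hq z hz] at h2
  have h3 := real_inner_le_norm q z.2
  have h4 := happrox z hz
  have n1 : ‖X.starProjection z.1‖ ≤ ‖z.1‖ := by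
    nlinarith [norm_nonneg z.1, norm_nonneg (X.starProjection z.1),
      sq_nonneg ‖z.1 - X.starProjection z.1‖]
  have n2 : ‖z.1 - X.starProjection z.1‖ ≤ ‖z.1‖ := by
    nlinarith [norm_nonneg z.1, norm_nonneg (z.1 - X.starProjection z.1),
      sq_nonneg ‖X.starProjection z.1‖]
  have h5 : ‖q‖ * ‖z.2‖ ≤ C * ‖z.1‖ * ‖z.2‖ :=
    mul_le_mul_of_nonneg_right (hqn.trans (mul_le_mul_of_nonneg_left n1 hC)) (norm_nonneg _)
  have h6 : ‖z.1 - X.starProjection z.1‖ ^ 2 ≤ c * ‖z.2‖ * ‖z.1‖ := by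
    rw [sq]
    exact mul_le_mul h4 n2 (norm_nonneg _) (mul_nonneg hc (norm_nonneg _))
  rcases (norm_nonneg z.1).eq_or_lt with h0 | h0
  · rw [← h0]; positivity
  · refine le_of_mul_le_mul_right ?_ h0
    nlinarith

/-- The Poincaré inequality makes z ↦ z.2 antilipschitz on the complete space W. Closedness of the
range is what permits orthogonal projection onto the gradients themselves. -/
theorem isClosed_map_snd [CompleteSpace Y] [CompleteSpace H] (hW : IsClosed (W : Set (Y × H)))
    {D : ℝ} (hD : ∀ z ∈ W, ‖z.1‖ ≤ D * ‖z.2‖) :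
    IsClosed ((W.map (LinearMap.snd ℝ Y H) : Submodule ℝ H) : Set H) := by
  have : CompleteSpace W := hW.completeSpace_coe
  let L : W →L[ℝ] H := (ContinuousLinearMap.snd ℝ Y H).comp W.subtypeL
  have hanti : AntilipschitzWith (Real.toNNReal (max D 1)) L := by
    refine L.antilipschitz_of_bound fun z => ?_
    have h0 : (0 : ℝ) ≤ max D 1 := zero_le_one.trans (le_max_right _ _)
    rw [Real.coe_toNNReal _ h0]
    refine max_le ?_ ?_
    · exact (hD z z.2).trans (mul_le_mul_of_nonneg_right (le_max_left _ _) (norm_nonneg _))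
    · exact le_mul_of_one_le_left (norm_nonneg _) (le_max_right _ _)
  have h := hanti.isClosed_range L.uniformContinuous
  convert h using 1
  ext g
  simp [L]

/-- The `L²` estimate for functions with gradients orthogonal to the discrete gradients. -/
theorem norm_le_of_orthogonal {κ : ℝ}
    (happrox : ∀ z ∈ W, ‖z.1 - X.starProjection z.1‖ ≤ c * ‖z.2‖)
    (hκ : ∀ x ∈ X, ∀ η : ℝ, 0 < η → ∃ z ∈ Wh, ∃ q : H,
      (∀ z ∈ W, inner ℝ q z.2 = inner ℝ x z.1) ∧ ‖z.2 - q‖ ≤ (κ + η) * ‖x‖)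
    {z : Y × H} (hz : z ∈ W) (horth : ∀ y ∈ Wh, inner ℝ z.2 y.2 = 0) :
    ‖z.1‖ ≤ Real.sqrt (κ ^ 2 + c ^ 2) * ‖z.2‖ := by
  set a := ‖X.starProjection z.1‖
  set b := ‖z.1 - X.starProjection z.1‖
  obtain ⟨h1, h2⟩ := norm_sq_eq_starProjection (X := X) z.1
  have key : ∀ η : ℝ, 0 < η → inner ℝ (X.starProjection z.1) z.1 ≤ (κ + η) * a * ‖z.2‖ := by
    intro η hη
    obtain ⟨y, hy, q, hq, hyq⟩ := hκ _ (X.starProjection_apply_mem z.1) η hη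
    rw [← hq z hz]
    -- Orthogonality allows a discrete gradient close to the flux to be subtracted; this is where κ
    -- enters in place of the norm of the flux.
    have e : inner ℝ q z.2 = inner ℝ (q - y.2) z.2 := by
      rw [inner_sub_left, real_inner_comm z.2 y.2, horth y hy, sub_zero]
    rw [e]
    refine (real_inner_le_norm _ _).trans (mul_le_mul_of_nonneg_right ?_ (norm_nonneg _))
    rwa [norm_sub_rev]
  have key' : inner ℝ (X.starProjection z.1) z.1 ≤ κ * a * ‖z.2‖ := by
    have hlim : Tendsto (fun η : ℝ => (κ + η) * a * ‖z.2‖) (𝓝[>] 0) (𝓝 ((κ + 0) * a * ‖z.2‖)) := by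
      refine Tendsto.mono_left ?_ nhdsWithin_le_nhds
      exact ((tendsto_const_nhds.add tendsto_id).mul_const a).mul_const ‖z.2‖
    rw [add_zero] at hlim
    exact ge_of_tendsto hlim (eventually_mem_nhdsWithin.mono fun η hη => key η hη)
  have h4 := happrox z hz
  have h5 : ‖z.1‖ ^ 2 ≤ ‖z.2‖ * (κ * a + c * b) := by
    nlinarith [mul_le_mul_of_nonneg_right h4 (norm_nonneg (z.1 - X.starProjection z.1))]
  -- Cauchy–Schwarz for the pairs (κ, c) and (a, b), combined with a² + b² = ‖z.1‖².
  have h6 : κ * a + c * b ≤ Real.sqrt (κ ^ 2 + c ^ 2) * ‖z.1‖ := by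
    refine (le_abs_self _).trans (abs_le_of_sq_le_sq ?_ (by positivity))
    rw [mul_pow, Real.sq_sqrt (by positivity), h1]
    nlinarith [sq_nonneg (κ * b - c * a)]
  rcases (norm_nonneg z.1).eq_or_lt with h0 | h0
  · rw [← h0]; positivity
  · refine le_of_mul_le_mul_right ?_ h0
    nlinarith [mul_le_mul_of_nonneg_left h6 (norm_nonneg z.2)]

variable [CompleteSpace Y] [CompleteSpace H]

/-- The localized error estimate in an abstract setting: `W` consists of the pairs of test
functions and their gradients, `Wh` of the discrete ones, and `B` is the multiplication by the
square root of the weight. -/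
theorem local_estimate_of_isClosed (hW : IsClosed (W : Set (Y × H))) (hWh : Wh ≤ W) {κ C m : ℝ}
    (hc : 0 ≤ c) (hC : 0 ≤ C) (hm : 0 ≤ m)
    (happrox : ∀ z ∈ W, ‖z.1 - X.starProjection z.1‖ ≤ c * ‖z.2‖)
    (hbdd : ∀ x ∈ X, ∃ q : H, (∀ z ∈ W, inner ℝ q z.2 = inner ℝ x z.1) ∧ ‖q‖ ≤ C * ‖x‖)
    (hκ : ∀ x ∈ X, ∀ η : ℝ, 0 < η → ∃ z ∈ Wh, ∃ q : H,
      (∀ z ∈ W, inner ℝ q z.2 = inner ℝ x z.1) ∧ ‖z.2 - q‖ ≤ (κ + η) * ‖x‖)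
    {B B' : H →ₗ[ℝ] H} (hB : ∀ g, ‖B g‖ ≤ ‖g‖) (hB' : ∀ g, ‖B' g‖ ≤ ‖B g‖)
    (hweight : ∀ q : H, (∀ z ∈ W, inner ℝ q z.2 = 0) → ∀ z ∈ W,
      |inner ℝ (B q) (B z.2)| ≤ m * ‖q‖ * ‖z.1‖)
    {F : Y} (hF : ∀ x ∈ X, inner ℝ F x = 0) {p gu gh : H}
    (hp : ∀ z ∈ W, inner ℝ (gu - p) z.2 = inner ℝ F z.1) {e : Y} (he : (e, gu - gh) ∈ W)
    (horth : ∀ z ∈ Wh, inner ℝ (gu - gh) z.2 = 0) :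
    ‖B' (gu - gh)‖ ≤ Real.sqrt ((‖B (gh - p)‖ + c * ‖F‖) ^ 2 +
      2 * m * Real.sqrt (κ ^ 2 + c ^ 2) * ‖gh - p‖ ^ 2) + 2 * c * ‖F‖ := by
  set G : Submodule ℝ H := W.map (LinearMap.snd ℝ Y H) with hG
  have hGc : IsClosed (G : Set H) :=
    isClosed_map_snd hW fun z hz => poincare_of_lifting hc hC happrox hbdd hz
  have hGcomp : CompleteSpace G := hGc.completeSpace_coe
  set Gh : Submodule ℝ H := (Wh.map (LinearMap.snd ℝ Y H)).topologicalClosure with hGh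
  have hGhc : CompleteSpace Gh := (Submodule.isClosed_topologicalClosure _).completeSpace_coe
  have hGhG : Gh ≤ G := Submodule.topologicalClosure_minimal _ (Submodule.map_mono hWh) hGc
  have hGhorth : ∀ q : H, (∀ z ∈ Wh, inner ℝ q z.2 = 0) → ∀ g ∈ Gh, inner ℝ q g = 0 := by
    intro q hq g hg
    have hcl : IsClosed {g : H | inner ℝ q g = 0} :=
      isClosed_eq (continuous_const.inner continuous_id) continuous_const
    refine closure_minimal (s := ((Wh.map (LinearMap.snd ℝ Y H) : Submodule ℝ H) : Set H))
      ?_ hcl hg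
    rintro _ ⟨z, hz, rfl⟩
    exact hq z hz
  have hex : ∀ g ∈ G, ∃ v : Y, (v, g) ∈ W := by
    rintro _ ⟨z, hz, rfl⟩
    exact ⟨z.1, hz⟩
  -- This gradient represents the functional z ↦ ⟨F, z.1⟩, that is, the effect of projecting the
  -- load.
  set r := G.starProjection (gu - p) with hr
  obtain ⟨ρ, hρ⟩ := hex r (G.starProjection_apply_mem _)
  have hq : ∀ z ∈ W, inner ℝ (gu - p - r) z.2 = 0 := fun z hz =>
    G.starProjection_inner_eq_zero _ _ ⟨z, hz, rfl⟩
  -- The identity is tested with r itself; F sees only the part of ρ orthogonal to X.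
  have hrF : ‖r‖ ≤ c * ‖F‖ := by
    have h1 := hq _ hρ
    rw [inner_sub_left, hp _ hρ, real_inner_self_eq_norm_sq, sub_eq_zero] at h1
    have h2 : inner ℝ F ρ = inner ℝ F (ρ - X.starProjection ρ) := by
      rw [inner_sub_right, hF _ (X.starProjection_apply_mem ρ), sub_zero]
    have h3 := real_inner_le_norm F (ρ - X.starProjection ρ)
    have h4 := mul_le_mul_of_nonneg_left (happrox _ hρ) (norm_nonneg F)
    simp only at h1 h4
    rcases (norm_nonneg r).eq_or_lt with h0 | h0
    · rw [← h0]; positivity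
    · refine le_of_mul_le_mul_right ?_ h0
      nlinarith
  -- Subtracting r from the exact gradient and rh from the discrete one gives the error g for the
  -- projected load. It is still orthogonal to Wh, as r − rh is.
  set rh := Gh.starProjection r with hrh
  have hrhr : ‖rh‖ ≤ ‖r‖ := Gh.norm_starProjection_apply_le r
  obtain ⟨ρh, hρh⟩ := hex rh (hGhG (Gh.starProjection_apply_mem _))
  set d := gu - gh - r with hd
  set g := d + rh with hg
  set q := gu - p - r with hqdef
  have hvg : (e - ρ + ρh, g) ∈ W := W.add_mem (W.sub_mem he hρ) hρh
  have hdW : (e - ρ, d) ∈ W := W.sub_mem he hρ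
  have hgorth : ∀ y ∈ Wh, inner ℝ g y.2 = 0 := by
    intro y hy
    have h1 : inner ℝ (r - rh) y.2 = 0 := Gh.starProjection_inner_eq_zero r _
      (Submodule.le_topologicalClosure _ ⟨y, hy, rfl⟩)
    rw [show g = (gu - gh) - (r - rh) by rw [hg, hd]; abel, inner_sub_left, horth y hy, h1,
      sub_zero]
  have hgd : ‖g‖ ≤ ‖d‖ := by
    have h1 : inner ℝ g rh = 0 := hGhorth g hgorth _ (Gh.starProjection_apply_mem _)
    have h2 : ‖d‖ ^ 2 = ‖g‖ ^ 2 + ‖rh‖ ^ 2 := by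
      rw [show d = g - rh by rw [hg]; abel, norm_sub_sq_real, h1]; ring
    nlinarith [norm_nonneg g, norm_nonneg d, sq_nonneg ‖rh‖]
  -- The Prager–Synge identity: d is a gradient and q is orthogonal to all gradients.
  have hpyth : ‖q‖ ^ 2 + ‖d‖ ^ 2 = ‖gh - p‖ ^ 2 := by
    have h1 : inner ℝ q d = 0 := hq _ hdW
    have h2 := norm_sub_sq_real q d
    rw [h1, show q - d = gh - p by rw [hqdef, hd]; abel] at h2
    linarith
  have hv := norm_le_of_orthogonal happrox hκ hvg hgorth
  simp only at hv
  set S := Real.sqrt (κ ^ 2 + c ^ 2) with hS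
  have hS0 : 0 ≤ S := Real.sqrt_nonneg _
  have hw := hweight q hq _ hvg
  simp only at hw
  -- The generous bound ‖q‖‖d‖ ≤ ‖q‖² + ‖d‖² suffices for the stated constant.
  have hcross : 2 * inner ℝ (B q) (B g) ≤ 2 * m * S * ‖gh - p‖ ^ 2 := by
    have h1 : m * ‖q‖ * ‖e - ρ + ρh‖ ≤ m * ‖q‖ * (S * ‖d‖) :=
      mul_le_mul_of_nonneg_left (hv.trans (mul_le_mul_of_nonneg_left hgd hS0)) (by positivity)
    have h2 : ‖q‖ * ‖d‖ ≤ ‖gh - p‖ ^ 2 := by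
      nlinarith [sq_nonneg (‖q‖ - ‖d‖), sq_nonneg ‖q‖, sq_nonneg ‖d‖]
    have h3 := mul_le_mul_of_nonneg_left h2 (mul_nonneg hm hS0)
    have h4 := (le_abs_self _).trans hw
    nlinarith
  have hBsum : ‖B (gh - rh - p)‖ ≤ ‖B (gh - p)‖ + c * ‖F‖ := by
    rw [show gh - rh - p = (gh - p) - rh by abel, map_sub]
    exact (norm_sub_le _ _).trans (add_le_add_right (((hB rh).trans hrhr).trans hrF) _)
  -- B(q − g) is known from p, gh and rh. Expanding its square and dropping ‖B q‖² leaves only the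
  -- cross term to be paid for.
  have hBg : ‖B g‖ ^ 2 ≤ (‖B (gh - p)‖ + c * ‖F‖) ^ 2 + 2 * m * S * ‖gh - p‖ ^ 2 := by
    have h1 : B (gh - rh - p) = B q - B g := by
      rw [← map_sub]
      congr 1
      rw [hqdef, hg, hd]; abel
    have h2 := norm_sub_sq_real (B q) (B g)
    rw [← h1] at h2
    have h3 : ‖B (gh - rh - p)‖ ^ 2 ≤ (‖B (gh - p)‖ + c * ‖F‖) ^ 2 :=
      pow_le_pow_left₀ (norm_nonneg _) hBsum 2
    nlinarith [sq_nonneg ‖B q‖]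
  -- Returning to the original load costs ‖r‖ + ‖rh‖ ≤ 2‖r‖, the source of the factor 2 in the last
  -- term.
  have hfin : gu - gh = g + (r - rh) := by rw [hg, hd]; abel
  rw [hfin, map_add]
  refine (norm_add_le _ _).trans (add_le_add ((hB' g).trans (Real.le_sqrt_of_sq_le hBg)) ?_)
  refine ((hB' _).trans (hB _)).trans ((norm_sub_le _ _).trans ?_)
  linarith

/-- The localized error estimate, with hypotheses on a not necessarily closed space of pairs. -/
theorem local_estimate (hWh : Wh ≤ W) {κ C m : ℝ}
    (hc : 0 ≤ c) (hC : 0 ≤ C) (hm : 0 ≤ m)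
    (happrox : ∀ z ∈ W, ∃ x ∈ X, ‖z.1 - x‖ ≤ c * ‖z.2‖)
    (hbdd : ∀ x ∈ X, ∃ q : H, (∀ z ∈ W, inner ℝ q z.2 = inner ℝ x z.1) ∧ ‖q‖ ≤ C * ‖x‖)
    (hκ : ∀ x ∈ X, ∀ η : ℝ, 0 < η → ∃ z ∈ Wh, ∃ q : H,
      (∀ z ∈ W, inner ℝ q z.2 = inner ℝ x z.1) ∧ ‖z.2 - q‖ ≤ (κ + η) * ‖x‖)
    {B B' : H →ₗ[ℝ] H} (hB : ∀ g, ‖B g‖ ≤ ‖g‖) (hB' : ∀ g, ‖B' g‖ ≤ ‖B g‖)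
    (hweight : ∀ q : H, (∀ z ∈ W, inner ℝ q z.2 = 0) → ∀ z ∈ W,
      |inner ℝ (B q) (B z.2)| ≤ m * ‖q‖ * ‖z.1‖)
    {F : Y} (hF : ∀ x ∈ X, inner ℝ F x = 0) {p gu gh : H}
    (hp : ∀ z ∈ W, inner ℝ (gu - p) z.2 = inner ℝ F z.1) {e : Y} (he : (e, gu - gh) ∈ W)
    (horth : ∀ z ∈ Wh, inner ℝ (gu - gh) z.2 = 0) :
    ‖B' (gu - gh)‖ ≤ Real.sqrt ((‖B (gh - p)‖ + c * ‖F‖) ^ 2 +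
      2 * m * Real.sqrt (κ ^ 2 + c ^ 2) * ‖gh - p‖ ^ 2) + 2 * c * ‖F‖ := by
  have hBc : Continuous B := (B.mkContinuous 1 fun g => by simpa using hB g).continuous
  -- The hypotheses on W are closed conditions on pairs and survive passage to the closure. The
  -- approximation property is first put into closed form by means of the orthogonal projection.
  have hext : ∀ P : Y × H → Prop, IsClosed {z | P z} → (∀ z ∈ W, P z) →
      ∀ z ∈ W.topologicalClosure, P z := fun P hP h z hz =>
    closure_minimal (s := (W : Set (Y × H))) h hP hz
  have hlift : ∀ (q : H) (x : Y), (∀ z ∈ W, inner ℝ q z.2 = inner ℝ x z.1) →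
      ∀ z ∈ W.topologicalClosure, inner ℝ q z.2 = inner ℝ x z.1 := fun q x =>
    hext (fun z => inner ℝ q z.2 = inner ℝ x z.1)
      (isClosed_eq (by fun_prop) (by fun_prop))
  refine local_estimate_of_isClosed (W := W.topologicalClosure) (Wh := Wh) (X := X) (C := C)
    W.isClosed_topologicalClosure (hWh.trans W.le_topologicalClosure) hc hC hm ?_ ?_ ?_ hB hB' ?_
    hF (hlift _ _ hp) (W.le_topologicalClosure he) horth
  · refine hext _ (isClosed_le (by fun_prop) (by fun_prop)) fun z hz => ?_
    obtain ⟨x, hx, hzx⟩ := happrox z hz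
    exact (norm_sub_starProjection_le z.1 hx).trans hzx
  · intro x hx
    obtain ⟨q, hq, hqn⟩ := hbdd x hx
    exact ⟨q, hlift q x hq, hqn⟩
  · intro x hx η hη
    obtain ⟨z, hz, q, hq, hqn⟩ := hκ x hx η hη
    exact ⟨z, hz, q, hlift q x hq, hqn⟩
  · intro q hq
    refine hext _ (isClosed_le ?_ (by fun_prop)) (hweight q fun z hz =>
      hq z (W.le_topologicalClosure hz))
    exact (continuous_const.inner (hBc.comp continuous_snd)).abs

end Hilbert


variable {Ω S : Set Plane} {T : Geometry.SimplicialComplex ℝ Plane} {ΓD ΓN : Set Plane} {ε : ℝ}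

/-! ### Limits of weak gradients -/

theorem HasWeakGrad.of_tendsto {U : Set Plane} {v : ℕ → Plane → ℝ} {G : ℕ → Plane → Plane}
    {v₀ : Plane → ℝ} {G₀ : Plane → Plane} (h : ∀ n, HasWeakGrad U (v n) (G n))
    (hv : ∀ n, MemLp (v n) 2 (volume.restrict U)) (hG : ∀ n, MemLp (G n) 2 (volume.restrict U))
    (hv₀ : MemLp v₀ 2 (volume.restrict U)) (hG₀ : MemLp G₀ 2 (volume.restrict U))
    (h1 : Tendsto (fun n => l2norm U (fun x => v n x - v₀ x)) atTop (𝓝 0))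
    (h2 : Tendsto (fun n => l2norm U (fun x => G n x - G₀ x)) atTop (𝓝 0)) :
    HasWeakGrad U v₀ G₀ := by
  intro φ hφ e
  replace h1 := (tendsto_l2norm_iff fun n => (hv n).sub hv₀).1 h1
  replace h2 := (tendsto_l2norm_iff fun n => (hG n).sub hG₀).1 h2
  have l1 := tendsto_integral_mul hv hv₀ (hφ.memLp_fderiv (volume.restrict U) e) h1
  have φ2 : MemLp (fun x => φ x • e) 2 (volume.restrict U) :=
    ((ContinuousLinearMap.id ℝ ℝ).smulRight e).comp_memLp' (hφ.memLp (volume.restrict U))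
  have l2 := tendsto_integral_inner hG hG₀ φ2 h2
  have e1 : ∀ f : Plane → ℝ, ∫ x in U, f x * fderiv ℝ φ x e = ∫ x in U, fderiv ℝ φ x e * f x :=
    fun f => by simp_rw [mul_comm]
  have e2 : ∀ f : Plane → Plane, ∫ x in U, inner ℝ (f x) e * φ x =
      ∫ x in U, inner ℝ (f x) (φ x • e) := fun f => by
    simp_rw [inner_smul_right, mul_comm]
  rw [e1, e2]
  refine tendsto_nhds_unique l1 (l2.neg.congr fun n => ?_)
  rw [← e1, ← e2]
  exact (h n φ hφ e).symm

/-! ### Linear operations on traces -/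

theorem HasTrace.add (hT : IsTriangulation Ω T) (hΩ : IsPolygonalDomain Ω) {v w : H1 Ω}
    {τ σ : Plane → ℝ} (hv : HasTrace Ω v τ) (hw : HasTrace Ω w σ) :
    HasTrace Ω (v.add w) (fun x => τ x + σ x) := by
  obtain ⟨hτ2, φ, hφ, h1, h2, h3⟩ := hv
  obtain ⟨hσ2, ψ, hψ, k1, k2, k3⟩ := hw
  have hc : ∀ {φ : ℕ → H1 Ω}, (∀ n, ContinuousOn (φ n).toFun (closure Ω)) → ∀ n,
      MemLp (φ n).toFun 2 (arcLength (frontier Ω)) := fun hφ n =>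
    memLp_of_continuousOn hT.isCompact_frontier (hT.hausdorffMeasure_frontier_lt_top hΩ)
      ((hφ n).mono frontier_subset_closure) 2
  refine ⟨hτ2.add hσ2, fun n => (φ n).add (ψ n), fun n => (hφ n).add (hψ n), ?_, ?_, ?_⟩
  · refine squeeze_zero (fun n => l2norm_nonneg _ _) (fun n => ?_) (by simpa using h1.add k1)
    refine le_trans (le_of_eq ?_) (l2norm_add_le ((φ n).memLp_toFun.sub v.memLp_toFun)
      ((ψ n).memLp_toFun.sub w.memLp_toFun))
    congr 1; ext x; simp only [H1.add]; ring
  · refine squeeze_zero (fun n => l2norm_nonneg _ _) (fun n => ?_) (by simpa using h2.add k2)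
    refine le_trans (le_of_eq ?_) (l2norm_add_le ((φ n).memLp_grad.sub v.memLp_grad)
      ((ψ n).memLp_grad.sub w.memLp_grad))
    congr 1; ext1 x; simp only [H1.add]; abel
  · refine tendsto_of_tendsto_of_tendsto_of_le_of_le tendsto_const_nhds
      (by simpa using h3.add k3) (fun n => zero_le) (fun n => ?_)
    refine le_trans (le_of_eq ?_) (eLpNorm_add_le ((hc hφ n).1.sub hτ2.1)
      ((hc hψ n).1.sub hσ2.1) one_le_two)
    congr 1; ext x; simp only [H1.add, Pi.add_apply]; ring

theorem HasTrace.smul (c : ℝ) {v : H1 Ω} {τ : Plane → ℝ} (hv : HasTrace Ω v τ) :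
    HasTrace Ω (v.smul c) (fun x => c * τ x) := by
  obtain ⟨hτ2, φ, hφ, h1, h2, h3⟩ := hv
  refine ⟨hτ2.const_mul c, fun n => (φ n).smul c, fun n => continuousOn_const.mul (hφ n), ?_, ?_, ?_⟩
  · have := h1.const_mul |c|
    rw [mul_zero] at this
    refine this.congr fun n => ?_
    rw [← l2norm_smul]
    congr 1; ext x; simp only [H1.smul, smul_eq_mul]; ring
  · have := h2.const_mul |c|
    rw [mul_zero] at this
    refine this.congr fun n => ?_
    rw [← l2norm_smul]
    congr 1; ext1 x; simp only [H1.smul, smul_sub]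
  · have := ENNReal.Tendsto.const_mul (a := ‖c‖ₑ) h3 (Or.inr enorm_ne_top)
    rw [mul_zero] at this
    refine this.congr fun n => ?_
    rw [← eLpNorm_const_smul]
    congr 1; ext x; simp only [H1.smul, smul_eq_mul, Pi.smul_apply]; ring

theorem hasTrace_of_continuousOn (hT : IsTriangulation Ω T) (hΩ : IsPolygonalDomain Ω) {v : H1 Ω}
    (hv : ContinuousOn v.toFun (closure Ω)) : HasTrace Ω v v.toFun :=
  ⟨memLp_of_continuousOn hT.isCompact_frontier (hT.hausdorffMeasure_frontier_lt_top hΩ)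
      (hv.mono frontier_subset_closure) 2, fun _ => v, fun _ => hv, by simp [l2norm],
    by simp [l2norm], by simp⟩

theorem MemVh.memV (hT : IsTriangulation Ω T) (hΩ : IsPolygonalDomain Ω)
    (hΓ : IsBoundaryPartition Ω T ΓD ΓN) {g : Plane → ℝ} {v : H1 Ω} (hv : MemVh Ω T ΓD g v) :
    MemV Ω ΓD g v :=
  ⟨v.toFun, hasTrace_of_continuousOn hT hΩ hv.1, fun _ =>
    (ae_restrict_mem (hΓ.measurableSet_left hT hΩ)).mono hv.2.2.1, hv.2.2.2⟩

theorem MemV.add (hT : IsTriangulation Ω T) (hΩ : IsPolygonalDomain Ω) {g g' : Plane → ℝ}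
    {v w : H1 Ω} (hv : MemV Ω ΓD g v) (hw : MemV Ω ΓD g' w) :
    MemV Ω ΓD (fun x => g x + g' x) (v.add w) := by
  have : IsFiniteMeasure (volume.restrict Ω) := hT.isFiniteMeasure
  obtain ⟨τ, h1, h2, h3⟩ := hv
  obtain ⟨σ, k1, k2, k3⟩ := hw
  refine ⟨_, h1.add hT hΩ k1, fun h => (h2 h).add (k2 h), fun h => ?_⟩
  have := integral_add (v.memLp_toFun.integrable one_le_two) (w.memLp_toFun.integrable one_le_two)
  rw [h3 h, k3 h, add_zero] at this
  exact this

theorem MemV.smul (c : ℝ) {g : Plane → ℝ} {v : H1 Ω} (hv : MemV Ω ΓD g v) :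
    MemV Ω ΓD (fun x => c * g x) (v.smul c) := by
  obtain ⟨τ, h1, h2, h3⟩ := hv
  refine ⟨_, h1.smul c, fun h => (h2 h).mono fun x hx => by simp only [hx], fun h => ?_⟩
  simp [H1.smul, integral_const_mul, h3 h]

theorem MemV.sub_mem (hT : IsTriangulation Ω T) (hΩ : IsPolygonalDomain Ω) {g : Plane → ℝ}
    {v w : H1 Ω} (hv : MemV Ω ΓD g v) (hw : MemV Ω ΓD g w) :
    MemV Ω ΓD 0 (v.add (w.smul (-1))) := by
  have h := hv.add hT hΩ (hw.smul (-1))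
  convert h using 1
  ext x; simp

theorem MemV.ae_eq_zero {v : H1 Ω} (hv : MemV Ω ΓD 0 v) :
    ∃ τ, HasTrace Ω v τ ∧ τ =ᵐ[arcLength ΓD] 0 := by
  obtain ⟨τ, h1, h2, _⟩ := hv
  refine ⟨τ, h1, ?_⟩
  rcases ΓD.eq_empty_or_nonempty with h | h
  · rw [h, arcLength, Measure.restrict_empty]
    change ∀ᶠ x in ae (0 : Measure Plane), _
    rw [ae_zero]
    exact eventually_bot
  · exact h2 h

/-- Subtraction of the mean value. -/
theorem exists_memV_of_hasTrace (hT : IsTriangulation Ω T) (hΩ : IsPolygonalDomain Ω) {v : H1 Ω}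
    {τ : Plane → ℝ} (hτ : HasTrace Ω v τ) (hD : ΓD.Nonempty → τ =ᵐ[arcLength ΓD] 0) :
    ∃ w : H1 Ω, MemV Ω ΓD 0 w ∧ w.grad = v.grad := by
  have hfin : IsFiniteMeasure (volume.restrict Ω) := hT.isFiniteMeasure
  rcases ΓD.eq_empty_or_nonempty with h | h
  · set k : H1 Ω := H1.ofContDiff Ω hT.isBounded (fun _ => - ⨍ x in Ω, v.toFun x) contDiff_const
    have hk : HasTrace Ω k k.toFun := hasTrace_of_continuousOn hT hΩ continuousOn_const
    refine ⟨v.add k, ⟨_, hτ.add hT hΩ hk, fun h' => ?_, fun _ => ?_⟩, ?_⟩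
    · exact absurd h h'.ne_empty
    · have h1 := integral_add (v.memLp_toFun.integrable one_le_two)
        (k.memLp_toFun.integrable one_le_two)
      have h2 : ∫ x in Ω, k.toFun x = - ∫ x in Ω, v.toFun x := by
        change ∫ x in Ω, (- ⨍ x in Ω, v.toFun x) = _
        rw [integral_const, smul_eq_mul, mul_neg, ← smul_eq_mul, measure_smul_average]
      rw [h2, add_neg_cancel] at h1
      exact h1
    · ext1 x
      have : gradient (fun _ : Plane => - ⨍ x in Ω, v.toFun x) x = 0 := by simp [gradient]
      change v.grad x + gradient (fun _ : Plane => - ⨍ x in Ω, v.toFun x) x = _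
      rw [this, add_zero]
  · exact ⟨v, ⟨τ, hτ, hD, fun h' => absurd h' h.ne_empty⟩, rfl⟩

/-! ### Multiplication with the weight -/

/-- The factor √2 compares the Euclidean length of the gradient with the larger of its two
components. -/
theorem WeightFunction.norm_grad_le (α : WeightFunction Ω S ε) :
    ∀ᵐ x ∂volume.restrict Ω, ‖α.grad x‖ ≤ Real.sqrt 2 * α.gradSup := by
  have hi : ∀ i : Fin 2, ∀ᵐ x ∂volume.restrict Ω,
      |α.grad x i| ≤ (eLpNorm (fun x => α.grad x i) ⊤ (volume.restrict Ω)).toReal := by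
    intro i
    have hm : MemLp (fun x => α.grad x i) ⊤ (volume.restrict Ω) :=
      (EuclideanSpace.proj i : Plane →L[ℝ] ℝ).comp_memLp' α.memLp_grad
    have h := ae_le_eLpNormEssSup (f := fun x => α.grad x i) (μ := volume.restrict Ω)
    rw [← eLpNorm_exponent_top] at h
    filter_upwards [h] with x hx
    have := ENNReal.toReal_mono hm.2.ne hx
    simpa using this
  filter_upwards [hi 0, hi 1] with x h0 h1
  have h0' : |α.grad x 0| ≤ α.gradSup := h0.trans (le_max_left _ _)
  have h1' : |α.grad x 1| ≤ α.gradSup := h1.trans (le_max_right _ _)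
  have hs : 0 ≤ α.gradSup := (abs_nonneg _).trans h0'
  rw [EuclideanSpace.norm_eq, Fin.sum_univ_two]
  refine Real.sqrt_le_iff.2 ⟨by positivity, ?_⟩
  rw [mul_pow, Real.sq_sqrt zero_le_two, Real.norm_eq_abs, Real.norm_eq_abs]
  nlinarith [pow_le_pow_left₀ (abs_nonneg _) h0' 2, pow_le_pow_left₀ (abs_nonneg _) h1' 2]

theorem WeightFunction.gradSup_nonneg (α : WeightFunction Ω S ε) : 0 ≤ α.gradSup :=
  ENNReal.toReal_nonneg.trans (le_max_left _ _)

/-- The bounds are assumed only on Ω; continuity carries them to the boundary, where they are needed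
for products with traces. -/
theorem WeightFunction.abs_le_one (α : WeightFunction Ω S ε) :
    ∀ x ∈ closure Ω, |α.toFun x| ≤ 1 := by
  have h := α.continuousOn.image_closure.trans (closure_minimal (s := α.toFun '' Ω)
    (t := Set.Icc 0 1) (by rintro _ ⟨x, hx, rfl⟩; exact ⟨α.nonneg x hx, α.le_one x hx⟩)
    isClosed_Icc)
  intro x hx
  have := h ⟨x, hx, rfl⟩
  rw [abs_of_nonneg this.1]; exact this.2

theorem l2norm_le_of_ae_le {F E : Type*} [NormedAddCommGroup F] [NormedAddCommGroup E]
    {A : Set Plane} {f : Plane → F} {g : Plane → E} (hg : MemLp g 2 (volume.restrict A)) {c : ℝ} (hc : 0 ≤ c)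
    (h : ∀ᵐ x ∂volume.restrict A, ‖f x‖ ≤ c * ‖g x‖) : l2norm A f ≤ c * l2norm A g := by
  rw [l2norm, l2norm]
  refine Real.sqrt_le_iff.2 ⟨by positivity, ?_⟩
  rw [mul_pow, Real.sq_sqrt (by positivity), ← integral_const_mul]
  refine integral_mono_of_nonneg (Eventually.of_forall fun x => by positivity)
    (hg.integrable_norm_pow two_ne_zero |>.const_mul _) (h.mono fun x hx => ?_)
  change ‖f x‖ ^ 2 ≤ c ^ 2 * ‖g x‖ ^ 2
  rw [← mul_pow]
  exact pow_le_pow_left₀ (norm_nonneg _) hx 2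

/-- The product rule is available for functions continuous in Ω, hence for the approximants that
define the trace of v. Since α and ∇α are bounded, the products converge in H¹ and on the boundary,
which gives the weak gradient and the trace together. -/
theorem WeightFunction.exists_mul (α : WeightFunction Ω S ε) (hT : IsTriangulation Ω T)
    (hΩ : IsPolygonalDomain Ω) {v : H1 Ω} {τ : Plane → ℝ} (hτ : HasTrace Ω v τ) :
    ∃ w : H1 Ω, w.grad = (fun x => α.toFun x • v.grad x + v.toFun x • α.grad x) ∧
      HasTrace Ω w (fun x => α.toFun x * τ x) := by
  have hfin : IsFiniteMeasure (volume.restrict Ω) := hT.isFiniteMeasure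
  have hΩm := hΩ.isOpen.measurableSet
  have hα1 : ∀ᵐ x ∂volume.restrict Ω, ‖α.toFun x‖ ≤ 1 :=
    (ae_restrict_mem hΩm).mono fun x hx => α.abs_le_one x (subset_closure hx)
  have hαm : AEStronglyMeasurable α.toFun (volume.restrict Ω) :=
    (α.continuousOn.mono subset_closure).aestronglyMeasurable hΩm
  set M := Real.sqrt 2 * α.gradSup
  have hM0 : 0 ≤ M := mul_nonneg (Real.sqrt_nonneg _) α.gradSup_nonneg
  have hMα := α.norm_grad_le
  have m1 : ∀ v : H1 Ω, MemLp (fun x => α.toFun x * v.toFun x) 2 (volume.restrict Ω) := fun v =>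
    v.memLp_toFun.of_le (hαm.mul v.memLp_toFun.1) (hα1.mono fun x hx => by
      rw [norm_mul]; exact mul_le_of_le_one_left (norm_nonneg _) hx)
  have m2 : ∀ v : H1 Ω, MemLp (fun x => α.toFun x • v.grad x) 2 (volume.restrict Ω) := fun v =>
    v.memLp_grad.of_le (hαm.smul v.memLp_grad.1) (hα1.mono fun x hx => by
      rw [norm_smul]; exact mul_le_of_le_one_left (norm_nonneg _) hx)
  have m3 : ∀ v : H1 Ω, MemLp (fun x => v.toFun x • α.grad x) 2 (volume.restrict Ω) := fun v =>
    (v.memLp_toFun.const_mul M).of_le (v.memLp_toFun.1.smul α.memLp_grad.1)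
      (hMα.mono fun x hx => by
        rw [norm_smul, norm_mul, mul_comm, Real.norm_of_nonneg hM0]
        exact mul_le_mul_of_nonneg_right hx (norm_nonneg _))
  obtain ⟨hτ2, φ, hφ, h1, h2, h3⟩ := hτ
  have hwg : ∀ n, HasWeakGrad Ω (fun x => α.toFun x * (φ n).toFun x)
      (fun x => α.toFun x • (φ n).grad x + (φ n).toFun x • α.grad x) := fun n =>
    HasWeakGrad.mul (M := 1) hΩ.isOpen (α.continuousOn.mono subset_closure)
      (fun x hx => α.abs_le_one x (subset_closure hx)) ((hφ n).mono subset_closure)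
      ((φ n).memLp_toFun.integrable one_le_two) ((MemLp.of_bound hαm 1 hα1).integrable le_top)
      (α.memLp_grad.integrable le_top) ((φ n).memLp_grad.integrable one_le_two)
      α.hasWeakGrad (φ n).hasWeakGrad
  have l1 : Tendsto (fun n => l2norm Ω (fun x => α.toFun x * (φ n).toFun x -
      α.toFun x * v.toFun x)) atTop (𝓝 0) := by
    refine squeeze_zero (fun n => l2norm_nonneg _ _) (fun n => ?_) h1
    rw [← one_mul (l2norm Ω fun x => (φ n).toFun x - v.toFun x)]
    refine l2norm_le_of_ae_le ((φ n).memLp_toFun.sub v.memLp_toFun) zero_le_one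
      (hα1.mono fun x hx => ?_)
    rw [← mul_sub, norm_mul]
    exact mul_le_mul_of_nonneg_right hx (norm_nonneg _)
  have l2 : Tendsto (fun n => l2norm Ω (fun x =>
      (α.toFun x • (φ n).grad x + (φ n).toFun x • α.grad x) -
        (α.toFun x • v.grad x + v.toFun x • α.grad x))) atTop (𝓝 0) := by
    have hlim := h2.add (h1.const_mul M)
    rw [mul_zero, add_zero] at hlim
    refine squeeze_zero (fun n => l2norm_nonneg _ _) (fun n => ?_) hlim
    have k1 : l2norm Ω (fun x => α.toFun x • (φ n).grad x - α.toFun x • v.grad x) ≤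
        l2norm Ω (fun x => (φ n).grad x - v.grad x) := by
      rw [← one_mul (l2norm Ω fun x => (φ n).grad x - v.grad x)]
      refine l2norm_le_of_ae_le ((φ n).memLp_grad.sub v.memLp_grad) zero_le_one
        (hα1.mono fun x hx => ?_)
      rw [← smul_sub, norm_smul]
      exact mul_le_mul_of_nonneg_right hx (norm_nonneg _)
    have k2 : l2norm Ω (fun x => (φ n).toFun x • α.grad x - v.toFun x • α.grad x) ≤
        M * l2norm Ω (fun x => (φ n).toFun x - v.toFun x) := by
      refine l2norm_le_of_ae_le ((φ n).memLp_toFun.sub v.memLp_toFun) hM0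
        (hMα.mono fun x hx => ?_)
      rw [← sub_smul, norm_smul, mul_comm]
      exact mul_le_mul_of_nonneg_right hx (norm_nonneg _)
    refine le_trans (le_of_eq ?_) ((l2norm_add_le ((m2 (φ n)).sub (m2 v))
      ((m3 (φ n)).sub (m3 v))).trans (add_le_add k1 k2))
    congr 1; ext1 x; simp only [Pi.sub_apply]; abel
  let P : ∀ n, H1 Ω := fun n => ⟨_, _, m1 (φ n), (m2 (φ n)).add (m3 (φ n)), hwg n⟩
  let w : H1 Ω := ⟨_, _, m1 v, (m2 v).add (m3 v), HasWeakGrad.of_tendsto hwg (fun n => m1 (φ n))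
    (fun n => (m2 (φ n)).add (m3 (φ n))) (m1 v) ((m2 v).add (m3 v)) l1 l2⟩
  have hα1' : ∀ᵐ x ∂arcLength (frontier Ω), ‖α.toFun x‖ ≤ 1 :=
    (ae_restrict_mem isClosed_frontier.measurableSet).mono fun x hx =>
      α.abs_le_one x (frontier_subset_closure hx)
  have hαm' : AEStronglyMeasurable α.toFun (arcLength (frontier Ω)) :=
    (α.continuousOn.mono frontier_subset_closure).aestronglyMeasurable
      isClosed_frontier.measurableSet
  refine ⟨w, rfl, hτ2.of_le (hαm'.mul hτ2.1) (hα1'.mono fun x hx => by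
    rw [norm_mul]; exact mul_le_of_le_one_left (norm_nonneg _) hx), P,
    fun n => α.continuousOn.mul (hφ n), l1, l2, ?_⟩
  refine tendsto_of_tendsto_of_tendsto_of_le_of_le tendsto_const_nhds h3 (fun n => zero_le)
    (fun n => eLpNorm_mono_ae (hα1'.mono fun x hx => ?_))
  change ‖α.toFun x * (φ n).toFun x - α.toFun x * τ x‖ ≤ _
  rw [← mul_sub, norm_mul]
  exact mul_le_of_le_one_left (norm_nonneg _) hx

/-- The product of a test function and the weight is a test function, up to a constant. -/
theorem WeightFunction.exists_memV (α : WeightFunction Ω S ε) (hT : IsTriangulation Ω T)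
    (hΩ : IsPolygonalDomain Ω) {v : H1 Ω} (hv : MemV Ω ΓD 0 v) :
    ∃ w : H1 Ω, MemV Ω ΓD 0 w ∧
      w.grad = fun x => α.toFun x • v.grad x + v.toFun x • α.grad x := by
  obtain ⟨τ, hτ, hτD, _⟩ := hv
  obtain ⟨w, hw, hwτ⟩ := α.exists_mul hT hΩ hτ
  obtain ⟨w', hw', hgrad⟩ := exists_memV_of_hasTrace (ΓD := ΓD) hT hΩ hwτ fun h =>
    (hτD h).mono fun x hx => by simp [hx]
  exact ⟨w', hw', hgrad.trans hw⟩


variable {Ω : Set Plane} {T : Geometry.SimplicialComplex ℝ Plane} {ΓD ΓN : Set Plane}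

/-! ### The constants `h` and `C₀` -/

theorem IsTriangulation.exists_mem_triangles (hT : IsTriangulation Ω T)
    (hΩ : IsPolygonalDomain Ω) : ∃ K, K ∈ triangles T := by
  obtain ⟨x, hx⟩ := hΩ.isConnected.nonempty
  have hx' := subset_closure hx
  rw [hT.closure_eq] at hx'
  simp only [Set.mem_iUnion, exists_prop] at hx'
  obtain ⟨K, hK, _⟩ := hx'
  exact ⟨K, hT.mem_tris.1 hK⟩

theorem IsTriangulation.finite_triangles (hT : IsTriangulation Ω T) : (triangles T).Finite :=
  hT.finite.subset fun _ h => h.1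

theorem IsTriangulation.meshSize_pos (hT : IsTriangulation Ω T) (hΩ : IsPolygonalDomain Ω) :
    0 < meshSize T := by
  obtain ⟨K, hK⟩ := hT.exists_mem_triangles hΩ
  have h1 : 0 < Metric.diam (K : Set Plane) := by
    refine (Metric.diam_pos ?_ K.finite_toSet.isBounded)
    have : 1 < K.card := by rw [hK.2]; norm_num
    exact Finset.one_lt_card_iff_nontrivial.1 this
  exact h1.trans_le (le_csSup (hT.finite_triangles.image _).bddAbove ⟨K, hK, rfl⟩)

theorem IsTriangulation.le_globalC0 (hT : IsTriangulation Ω T) (hΩ : IsPolygonalDomain Ω)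
    (C0K : Finset Plane → ℝ) {K : Finset Plane} (hK : K ∈ triangles T) :
    C0K K ≤ globalC0 T C0K * meshSize T := by
  rw [← div_le_iff₀ (hT.meshSize_pos hΩ)]
  exact le_csSup (hT.finite_triangles.image _).bddAbove ⟨K, hK, rfl⟩

/-- The inequality is tested with a coordinate function, whose gradient has positive norm. -/
theorem IsProjectionConstant.nonneg {K : Finset Plane} (hK : K ∈ triangles T) {c : ℝ}
    (hc : IsProjectionConstant K c) : 0 ≤ c := by
  have hbdd : Bornology.IsBounded (openTriangle K) :=
    (isCompact_hull K).isBounded.subset interior_subset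
  have hd : ContDiff ℝ 1 fun x : Plane => x 0 :=
    (EuclideanSpace.proj 0 : Plane →L[ℝ] ℝ).contDiff
  have h := hc (H1.ofContDiff _ hbdd _ hd)
  have hg : 0 < l2norm (openTriangle K) (H1.ofContDiff _ hbdd _ hd).grad := by
    refine Real.sqrt_pos.2 ?_
    have hgr : ∀ x, ‖gradient (fun x : Plane => x 0) x‖ ^ 2 =
        ‖(EuclideanSpace.proj 0 : Plane →L[ℝ] ℝ)‖ ^ 2 := fun x => by
      rw [gradient, LinearIsometryEquiv.norm_map, (hasFDerivAt_coord 0 x).fderiv]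
    change 0 < ∫ x in openTriangle K, ‖gradient (fun x : Plane => x 0) x‖ ^ 2
    simp_rw [hgr]
    rw [integral_const, measureReal_restrict_apply_univ]
    have hne : (EuclideanSpace.proj 0 : Plane →L[ℝ] ℝ) ≠ 0 := fun h0 => by
      have := congrArg (fun L : Plane →L[ℝ] ℝ => L (EuclideanSpace.single 0 1)) h0
      simp at this
    have h3 : 0 < ‖(EuclideanSpace.proj 0 : Plane →L[ℝ] ℝ)‖ := norm_pos_iff.2 hne
    exact mul_pos (area_pos hK) (pow_pos h3 2)
  exact nonneg_of_mul_nonneg_left ((l2norm_nonneg _ _).trans h) hg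

/-! ### Piecewise constant functions -/

/-- The function with value `m K` on the open triangle `K`. -/
noncomputable def IsTriangulation.stepFun (hT : IsTriangulation Ω T) (m : hT.tris → ℝ)
    (x : Plane) : ℝ :=
  ∑ K : hT.tris, (openTriangle (K : Finset Plane)).indicator (fun _ => m K) x

theorem IsTriangulation.stepFun_eq (hT : IsTriangulation Ω T) (m : hT.tris → ℝ) (K : hT.tris)
    {x : Plane} (hx : x ∈ openTriangle (K : Finset Plane)) : hT.stepFun m x = m K := by
  rw [IsTriangulation.stepFun, Finset.sum_eq_single_of_mem K (Finset.mem_univ K),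
    Set.indicator_of_mem hx]
  intro L _ hne
  refine Set.indicator_of_notMem (fun hL => ?_) _
  exact Set.disjoint_left.1 (disjoint_openTriangle (hT.mem_tris.1 L.2) (hT.mem_tris.1 K.2)
    fun h => hne (Subtype.ext h)) hL hx

theorem IsTriangulation.memLp_stepFun (hT : IsTriangulation Ω T) (hΩ : IsPolygonalDomain Ω)
    (m : hT.tris → ℝ) : MemLp (hT.stepFun m) 2 (volume.restrict Ω) :=
  hT.memLp_of_piecewise hΩ fun K hK => ⟨fun _ => m ⟨K, hT.mem_tris.2 hK⟩, continuous_const,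
    fun _ hx => hT.stepFun_eq m ⟨K, hT.mem_tris.2 hK⟩ hx⟩

theorem IsTriangulation.integral_stepFun (hT : IsTriangulation Ω T) (hΩ : IsPolygonalDomain Ω)
    (m : hT.tris → ℝ) : ∫ x in Ω, hT.stepFun m x = ∑ K : hT.tris, m K * area K := by
  have : IsFiniteMeasure (volume.restrict Ω) := hT.isFiniteMeasure
  rw [hT.integral_eq_sum hΩ ((hT.memLp_stepFun hΩ m).integrable one_le_two), ← Finset.sum_coe_sort]
  refine Finset.sum_congr rfl fun K _ => ?_
  rw [setIntegral_congr_fun (g := fun _ => m K) (isOpen_openTriangle _).measurableSet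
    (fun x hx => hT.stepFun_eq m K hx)]
  simp [area, mul_comm]

theorem IsTriangulation.memXh_stepFun (hT : IsTriangulation Ω T) (hΩ : IsPolygonalDomain Ω)
    {m : hT.tris → ℝ} (hm : ΓD = ∅ → ∑ K : hT.tris, m K * area K = 0) :
    MemXh Ω T ΓD (hT.stepFun m) :=
  ⟨fun K hK => ⟨_, fun _ hx => hT.stepFun_eq m ⟨K, hT.mem_tris.2 hK⟩ hx⟩,
    fun h => (hT.integral_stepFun hΩ m).trans (hm h)⟩

/-- Restriction to a smaller set. -/
noncomputable def H1.restrict {U V : Set Plane} (hV : MeasurableSet V) (hUV : U ⊆ V) (v : H1 V) :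
    H1 U where
  toFun := v.toFun
  grad := v.grad
  memLp_toFun := v.memLp_toFun.mono_measure (Measure.restrict_mono hUV le_rfl)
  memLp_grad := v.memLp_grad.mono_measure (Measure.restrict_mono hUV le_rfl)
  hasWeakGrad := v.hasWeakGrad.mono hV hUV

/-- The step function takes the cell averages of v, so squared local estimates add up. It has the
same integral as v, hence mean zero when this is required. -/
theorem IsTriangulation.exists_stepFun_approx (hT : IsTriangulation Ω T)
    (hΩ : IsPolygonalDomain Ω) {C0K : Finset Plane → ℝ}
    (hC0K : ∀ K ∈ triangles T, IsProjectionConstant K (C0K K)) {c : ℝ}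
    (hc : ∀ K ∈ triangles T, C0K K ≤ c) {v : H1 Ω} (hv : ΓD = ∅ → ∫ x in Ω, v.toFun x = 0) :
    ∃ m : hT.tris → ℝ, (ΓD = ∅ → ∑ K : hT.tris, m K * area K = 0) ∧
      l2norm Ω (fun x => v.toFun x - hT.stepFun m x) ≤ c * l2norm Ω v.grad := by
  have hfin : IsFiniteMeasure (volume.restrict Ω) := hT.isFiniteMeasure
  obtain ⟨K₀, hK₀⟩ := hT.exists_mem_triangles hΩ
  have hc0 : 0 ≤ c := (hC0K K₀ hK₀).nonneg hK₀ |>.trans (hc K₀ hK₀)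
  set m : hT.tris → ℝ := fun K => ⨍ y in openTriangle (K : Finset Plane), v.toFun y with hm
  have hd2 : MemLp (fun x => v.toFun x - hT.stepFun m x) 2 (volume.restrict Ω) :=
    v.memLp_toFun.sub (hT.memLp_stepFun hΩ m)
  refine ⟨m, fun h => ?_, ?_⟩
  · rw [← hv h, hT.integral_eq_sum hΩ (v.memLp_toFun.integrable one_le_two),
      ← Finset.sum_coe_sort hT.tris (fun K => ∫ x in openTriangle K, v.toFun x)]
    refine Finset.sum_congr rfl fun K _ => ?_
    have : IsFiniteMeasure (volume.restrict (openTriangle (K : Finset Plane))) :=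
      ⟨by rw [Measure.restrict_apply_univ]; exact volume_openTriangle_lt_top _⟩
    have h1 := measure_smul_average (volume.restrict (openTriangle (K : Finset Plane))) v.toFun
    rw [measureReal_restrict_apply_univ, smul_eq_mul, mul_comm] at h1
    exact h1
  · rw [l2norm, l2norm]
    refine Real.sqrt_le_iff.2 ⟨by positivity, ?_⟩
    rw [mul_pow, Real.sq_sqrt (by positivity),
      hT.integral_eq_sum hΩ (hd2.integrable_norm_pow two_ne_zero),
      hT.integral_eq_sum hΩ (v.memLp_grad.integrable_norm_pow two_ne_zero), Finset.mul_sum]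
    refine Finset.sum_le_sum fun K hK => ?_
    have hK' := hT.mem_tris.1 hK
    have h1 := hC0K K hK' (v.restrict hΩ.isOpen.measurableSet (hT.openTriangle_subset hΩ hK'))
    have h2 : ∫ x in openTriangle K, ‖v.toFun x - hT.stepFun m x‖ ^ 2 =
        l2norm (openTriangle K)
          (fun x => v.toFun x - ⨍ y in openTriangle K, v.toFun y) ^ 2 := by
      rw [l2norm, Real.sq_sqrt (by positivity)]
      refine setIntegral_congr_fun (isOpen_openTriangle K).measurableSet fun x hx => ?_
      rw [hT.stepFun_eq m ⟨K, hK⟩ hx]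
    have h3 : ∫ x in openTriangle K, ‖v.grad x‖ ^ 2 = l2norm (openTriangle K) v.grad ^ 2 := by
      rw [l2norm, Real.sq_sqrt (by positivity)]
    rw [h2, h3, ← mul_pow]
    refine pow_le_pow_left₀ (l2norm_nonneg _ _) (h1.trans ?_) 2
    exact mul_le_mul_of_nonneg_right (hc K hK') (l2norm_nonneg _ _)

/-! ### Green's formula for Raviart--Thomas fields -/

/-- The weak divergence is piecewise constant, so it must equal the divergence 2c_K computed on each
triangle. This puts the field in the scope of the piecewise Green formula. -/
theorem MemRT.green (hT : IsTriangulation Ω T) (hΩ : IsPolygonalDomain Ω)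
    (hΓ : IsBoundaryPartition Ω T ΓD ΓN) {q : Plane → Plane} (hq : MemRT Ω T q) {d : Plane → ℝ}
    (hd : MemXh Ω T ΓD d) (hdiv : HasWeakDiv Ω q (fun x => - d x)) {g : Plane → ℝ}
    (hg : HasNormalTrace Ω T ΓN q g) (v : H1 Ω) {τ : Plane → ℝ} (hτ : HasTrace Ω v τ)
    (hτD : τ =ᵐ[arcLength ΓD] 0) :
    ∫ x in Ω, inner ℝ (q x) (v.grad x) =
      (∫ x in Ω, d x * v.toFun x) + ∫ x, g x * τ x ∂(arcLength ΓN) := by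
  choose! a c hac using hq.2
  choose! m hm using hd.1
  have hm' : ∀ K ∈ triangles T, ∀ x ∈ openTriangle K, - d x = - m K := fun K hK x hx => by
    rw [hm K hK x hx]
  have h : IsPiecewiseRT T q (fun x => - d x) a c := ⟨hac, fun K hK x hx => by
    rw [hm' K hK x hx]
    exact div_eq_of_hasWeakDiv (m := fun K => - m K) hT hΩ hac hm' hdiv hK⟩
  have h1 := h.green_mixed hT hΩ hΓ hdiv hg v hτ hτD
  simp_rw [neg_neg, real_inner_comm] at h1
  exact h1


variable {Ω S : Set Plane} {T : Geometry.SimplicialComplex ℝ Plane} {ΓD ΓN : Set Plane} {ε : ℝ}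

/-! ### Function spaces as subspaces of `L²` -/

theorem inner_toLp {F : Type*} [NormedAddCommGroup F] [InnerProductSpace ℝ F] {μ : Measure Plane}
    {f g : Plane → F} (hf : MemLp f 2 μ) (hg : MemLp g 2 μ) :
    inner ℝ (hf.toLp f) (hg.toLp g) = ∫ x, inner ℝ (f x) (g x) ∂μ := by
  rw [L2.inner_def]
  refine integral_congr_ae ?_
  filter_upwards [hf.coeFn_toLp, hg.coeFn_toLp] with x h1 h2
  rw [h1, h2]

theorem memLp_smul_of_le_one {F : Type*} [NormedAddCommGroup F] [NormedSpace ℝ F]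
    {μ : Measure Plane} {w : Plane → ℝ} (hw : AEStronglyMeasurable w μ)
    (h1 : ∀ᵐ x ∂μ, ‖w x‖ ≤ 1) {g : Plane → F} (hg : MemLp g 2 μ) :
    MemLp (fun x => w x • g x) 2 μ :=
  hg.of_le (hw.smul hg.1) (h1.mono fun x hx => by
    rw [norm_smul]; exact mul_le_of_le_one_left (norm_nonneg _) hx)

/-- Multiplication by a function that is bounded by `1`. -/
noncomputable def mulLp {F : Type*} [NormedAddCommGroup F] [NormedSpace ℝ F] {μ : Measure Plane}
    {w : Plane → ℝ} (hw : AEStronglyMeasurable w μ) (h1 : ∀ᵐ x ∂μ, ‖w x‖ ≤ 1) :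
    Lp F 2 μ →ₗ[ℝ] Lp F 2 μ :=
  { toFun := fun g => (memLp_smul_of_le_one hw h1 (Lp.memLp g)).toLp _
    map_add' := fun f g => by
      rw [← MemLp.toLp_add]
      refine MemLp.toLp_congr _ _ ((Lp.coeFn_add f g).mono fun x hx => ?_)
      simp only [hx, Pi.add_apply, smul_add]
    map_smul' := fun c g => by
      rw [RingHom.id_apply, ← MemLp.toLp_const_smul]
      refine MemLp.toLp_congr _ _ ((Lp.coeFn_smul c g).mono fun x hx => ?_)
      simp only [hx, Pi.smul_apply, smul_comm c] }

theorem coeFn_mulLp {F : Type*} [NormedAddCommGroup F] [NormedSpace ℝ F] {μ : Measure Plane}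
    {w : Plane → ℝ} (hw : AEStronglyMeasurable w μ) (h1 : ∀ᵐ x ∂μ, ‖w x‖ ≤ 1) (g : Lp F 2 μ) :
    mulLp hw h1 g =ᵐ[μ] fun x => w x • g x :=
  (memLp_smul_of_le_one hw h1 (Lp.memLp g)).coeFn_toLp

theorem norm_mulLp_toLp {F : Type*} [NormedAddCommGroup F] [NormedSpace ℝ F] {A : Set Plane}
    {w : Plane → ℝ} (hw : AEStronglyMeasurable w (volume.restrict A))
    (h1 : ∀ᵐ x ∂volume.restrict A, ‖w x‖ ≤ 1) {g : Plane → F}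
    (hg : MemLp g 2 (volume.restrict A)) :
    ‖mulLp hw h1 (hg.toLp g)‖ = l2norm A (fun x => w x • g x) := by
  rw [← l2norm_congr (g := mulLp hw h1 (hg.toLp g)), ← norm_toLp_eq_l2norm (Lp.memLp _),
    Lp.toLp_coeFn]
  filter_upwards [coeFn_mulLp hw h1 (hg.toLp g), hg.coeFn_toLp] with x h2 h3
  rw [h2, h3]

/-- The pairs of a test function and its gradient. -/
noncomputable def testPairs (hT : IsTriangulation Ω T) (hΩ : IsPolygonalDomain Ω)
    (ΓD : Set Plane) :
    Submodule ℝ (Lp ℝ 2 (volume.restrict Ω) × Lp Plane 2 (volume.restrict Ω)) where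
  carrier := {z | ∃ v : H1 Ω, MemV Ω ΓD 0 v ∧ z = (v.memLp_toFun.toLp _, v.memLp_grad.toLp _)}
  add_mem' := by
    rintro _ _ ⟨v, hv, rfl⟩ ⟨w, hw, rfl⟩
    refine ⟨v.add w, ?_, rfl⟩
    convert hv.add hT hΩ hw using 1
    ext x; simp
  zero_mem' := by
    refine ⟨H1.zero Ω, ?_, rfl⟩
    exact ⟨(H1.zero Ω).toFun, hasTrace_of_continuousOn hT hΩ continuousOn_const,
      fun _ => ae_eq_rfl, fun _ => by simp [H1.zero]⟩
  smul_mem' := by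
    rintro c _ ⟨v, hv, rfl⟩
    refine ⟨v.smul c, ?_, rfl⟩
    convert hv.smul c using 1
    ext x; simp

/-- The classes of piecewise constant functions. -/
noncomputable def stepClass (hT : IsTriangulation Ω T) (hΩ : IsPolygonalDomain Ω) :
    (hT.tris → ℝ) →ₗ[ℝ] Lp ℝ 2 (volume.restrict Ω) where
  toFun m := (hT.memLp_stepFun hΩ m).toLp _
  map_add' m m' := by
    rw [← MemLp.toLp_add]
    refine MemLp.toLp_congr _ _ (Eventually.of_forall fun x => ?_)
    simp only [IsTriangulation.stepFun, Pi.add_apply, ← Finset.sum_add_distrib]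
    refine Finset.sum_congr rfl fun K _ => ?_
    by_cases hx : x ∈ openTriangle (K : Finset Plane) <;> simp [hx]
  map_smul' c m := by
    rw [RingHom.id_apply, ← MemLp.toLp_const_smul]
    refine MemLp.toLp_congr _ _ (Eventually.of_forall fun x => ?_)
    simp only [IsTriangulation.stepFun, Pi.smul_apply, Finset.smul_sum]
    refine Finset.sum_congr rfl fun K _ => ?_
    by_cases hx : x ∈ openTriangle (K : Finset Plane) <;> simp [hx]

/-- The space `X_h` as a subspace of `L²(Ω)`. -/
noncomputable def discreteClass (hT : IsTriangulation Ω T) (hΩ : IsPolygonalDomain Ω)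
    (ΓD : Set Plane) : Submodule ℝ (Lp ℝ 2 (volume.restrict Ω)) :=
  Submodule.map (stepClass hT hΩ)
    { carrier := {m | ΓD = ∅ → ∑ K : hT.tris, m K * area K = 0}
      add_mem' := fun {m m'} h h' hD => by
        simp only [Pi.add_apply, add_mul, Finset.sum_add_distrib, h hD, h' hD, add_zero]
      zero_mem' := fun _ => by simp
      smul_mem' := fun c m h hD => by
        simp only [Pi.smul_apply, smul_eq_mul, mul_assoc, ← Finset.mul_sum, h hD, mul_zero] }

theorem exists_of_mem_discreteClass (hT : IsTriangulation Ω T) (hΩ : IsPolygonalDomain Ω)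
    {x : Lp ℝ 2 (volume.restrict Ω)} (hx : x ∈ discreteClass hT hΩ ΓD) :
    ∃ (g : Plane → ℝ) (hg : MemXh Ω T ΓD g), x = (hg.memLp hT hΩ).toLp g := by
  obtain ⟨m, hm, rfl⟩ := hx
  exact ⟨_, hT.memXh_stepFun hΩ hm, rfl⟩

/-! ### The main estimate -/

theorem WeightFunction.aestronglyMeasurable_sqrt (α : WeightFunction Ω S ε)
    (hΩ : IsPolygonalDomain Ω) :
    AEStronglyMeasurable (fun x => Real.sqrt (α.toFun x)) (volume.restrict Ω) :=
  (Real.continuous_sqrt.comp_continuousOn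
    (α.continuousOn.mono subset_closure)).aestronglyMeasurable hΩ.isOpen.measurableSet

theorem WeightFunction.sqrt_le_one (α : WeightFunction Ω S ε) (hΩ : IsPolygonalDomain Ω) :
    ∀ᵐ x ∂volume.restrict Ω, ‖Real.sqrt (α.toFun x)‖ ≤ 1 :=
  (ae_restrict_mem hΩ.isOpen.measurableSet).mono fun x hx => by
    rw [Real.norm_of_nonneg (Real.sqrt_nonneg _)]
    exact Real.sqrt_le_one.2 (α.le_one x hx)

theorem WeightFunction.weightedNorm_eq (α : WeightFunction Ω S ε) (hΩ : IsPolygonalDomain Ω)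
    (g : Plane → Plane) : l2norm Ω (fun x => Real.sqrt (α.toFun x) • g x) =
      weightedNorm (extendedDomain Ω S ε) α.toFun g := by
  rw [l2norm, weightedNorm]
  congr 1
  have hsub : extendedDomain Ω S ε ⊆ Ω := Set.inter_subset_left
  rw [← setIntegral_eq_of_subset_of_forall_sdiff_eq_zero hΩ.isOpen.measurableSet hsub
    (fun x hx => by rw [α.eq_zero x hx, zero_mul])]
  refine setIntegral_congr_fun hΩ.isOpen.measurableSet fun x hx => ?_
  simp only [norm_smul, mul_pow, Real.norm_of_nonneg (Real.sqrt_nonneg _),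
    Real.sq_sqrt (α.nonneg x hx)]

/-- The commutator estimate for the multiplication with the weight. -/
theorem WeightFunction.abs_inner_le (α : WeightFunction Ω S ε) (hT : IsTriangulation Ω T)
    (hΩ : IsPolygonalDomain Ω) {q : Lp Plane 2 (volume.restrict Ω)}
    (hq : ∀ z ∈ testPairs hT hΩ ΓD, inner ℝ q z.2 = 0)
    {z : Lp ℝ 2 (volume.restrict Ω) × Lp Plane 2 (volume.restrict Ω)}
    (hz : z ∈ testPairs hT hΩ ΓD) :
    |inner ℝ (mulLp (α.aestronglyMeasurable_sqrt hΩ) (α.sqrt_le_one hΩ) q)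
      (mulLp (α.aestronglyMeasurable_sqrt hΩ) (α.sqrt_le_one hΩ) z.2)| ≤
      Real.sqrt 2 * α.gradSup * ‖q‖ * ‖z.1‖ := by
  obtain ⟨v, hv, rfl⟩ := hz
  obtain ⟨w, hw, hgrad⟩ := α.exists_memV hT hΩ hv
  have h0 := hq _ ⟨w, hw, rfl⟩
  set M := Real.sqrt 2 * α.gradSup
  have hM0 : 0 ≤ M := mul_nonneg (Real.sqrt_nonneg _) α.gradSup_nonneg
  have hm : MemLp (fun x => v.toFun x • α.grad x) 2 (volume.restrict Ω) :=
    (v.memLp_toFun.const_mul M).of_le (v.memLp_toFun.1.smul α.memLp_grad.1)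
      (α.norm_grad_le.mono fun x hx => by
        rw [norm_smul, norm_mul, mul_comm, Real.norm_of_nonneg hM0]
        exact mul_le_mul_of_nonneg_right hx (norm_nonneg _))
  set B : Lp Plane 2 (volume.restrict Ω) →ₗ[ℝ] Lp Plane 2 (volume.restrict Ω) :=
    mulLp (α.aestronglyMeasurable_sqrt hΩ) (α.sqrt_le_one hΩ) with hB
  -- The two square roots combine to α, and α∇v = ∇(αv) − v∇α, where q annihilates the gradient
  -- ∇(αv).
  have h1 : inner ℝ (B q) (B (v.memLp_grad.toLp v.grad)) =
      inner ℝ q (w.memLp_grad.toLp w.grad) - inner ℝ q (hm.toLp _) := by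
    rw [← inner_sub_right, ← MemLp.toLp_sub, L2.inner_def, L2.inner_def]
    refine integral_congr_ae ?_
    filter_upwards [coeFn_mulLp (α.aestronglyMeasurable_sqrt hΩ) (α.sqrt_le_one hΩ) q,
      coeFn_mulLp (α.aestronglyMeasurable_sqrt hΩ) (α.sqrt_le_one hΩ)
        (v.memLp_grad.toLp v.grad), v.memLp_grad.coeFn_toLp,
      (w.memLp_grad.sub hm).coeFn_toLp, ae_restrict_mem hΩ.isOpen.measurableSet]
      with x k1 k2 k3 k4 hx
    rw [hB, k1, k2, k3, k4, hgrad]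
    simp only [Pi.sub_apply, add_sub_cancel_right, inner_smul_left, inner_smul_right,
      RCLike.conj_to_real]
    rw [← mul_assoc, Real.mul_self_sqrt (α.nonneg x hx)]
  have h2 : ‖hm.toLp _‖ ≤ M * ‖v.memLp_toFun.toLp v.toFun‖ := by
    rw [norm_toLp_eq_l2norm, norm_toLp_eq_l2norm]
    refine l2norm_le_of_ae_le v.memLp_toFun hM0 (α.norm_grad_le.mono fun x hx => ?_)
    rw [norm_smul, mul_comm]
    exact mul_le_mul_of_nonneg_right hx (norm_nonneg _)
  change |inner ℝ (B q) (B (v.memLp_grad.toLp v.grad))| ≤ _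
  rw [h1, h0, zero_sub, abs_neg]
  refine (abs_real_inner_le_norm _ _).trans
    ((mul_le_mul_of_nonneg_left h2 (norm_nonneg q)).trans (le_of_eq ?_))
  ring

end LocalFEM

/-! ### Assembly of the estimate in L²(Ω). -/

theorem theorem4p6
    (Ω : Set Plane) (hΩ : IsPolygonalDomain Ω)
    (T : Geometry.SimplicialComplex ℝ Plane) (hT : IsTriangulation Ω T)
    (ΓD ΓN : Set Plane) (hΓ : IsBoundaryPartition Ω T ΓD ΓN)
    (gD gN : Plane → ℝ) (hgD : IsPiecewiseLinearOn Ω T ΓD gD)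
    (hgN : IsPiecewiseConstantOn Ω T ΓN gN)
    (f : Plane → ℝ) (hf : MemLp f 2 (volume.restrict Ω))
    (C0K : Finset Plane → ℝ) (hC0K : ∀ K ∈ triangles T, IsProjectionConstant K (C0K K))
    (S : Set Plane) (hS : MeasurableSet S) (hSΩ : S ⊆ Ω)
    (ε : ℝ) (hε : 0 < ε) (α : WeightFunction Ω S ε)
    (u : H1 Ω) (hu : IsWeakSolution Ω ΓD ΓN f gD gN u)
    (uh : H1 Ω) (huh : IsFEMSolution Ω T ΓD ΓN f gD gN uh)
    (πf : Plane → ℝ) (hπf : IsProjection Ω T ΓD f πf)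
    (ph : Plane → Plane) (hph : MemRT Ω T ph)
    (hdiv : HasWeakDiv Ω ph (fun x => - πf x))
    (hnormal : HasNormalTrace Ω T ΓN ph gN) :
    l2norm S (fun x => u.grad x - uh.grad x) ≤
      Real.sqrt (errorE1 T C0K α f πf uh ph ^ 2 + errorE2 T ΓD ΓN C0K α uh ph ^ 2) +
        2 * (globalC0 T C0K * meshSize T) * l2norm Ω (fun x => f x - πf x) := by
  have hπ2 := hπf.1.memLp hT hΩ
  have hF2 : MemLp (fun x => f x - πf x) 2 (volume.restrict Ω) := hf.sub hπ2
  have hp2 : MemLp ph 2 (volume.restrict Ω) := hph.1.1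
  set c := globalC0 T C0K * meshSize T with hc
  have hcK : ∀ K ∈ triangles T, C0K K ≤ c := fun K hK => hT.le_globalC0 hΩ C0K hK
  obtain ⟨K₀, hK₀⟩ := hT.exists_mem_triangles hΩ
  have hc0 : 0 ≤ c := ((hC0K K₀ hK₀).nonneg hK₀).trans (hcK K₀ hK₀)
  obtain ⟨C, hC⟩ := exists_bounded_isRTFlux hT hΩ hΓ
  set gu := u.memLp_grad.toLp u.grad
  set gh := uh.memLp_grad.toLp uh.grad
  set W := testPairs hT hΩ ΓD
  -- All test pairs whose gradient is orthogonal to the error are admitted. By Galerkin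
  -- orthogonality these include the discrete functions, and the linear structure and the required
  -- orthogonality come for free.
  let Wh : Submodule ℝ (Lp ℝ 2 (volume.restrict Ω) × Lp Plane 2 (volume.restrict Ω)) :=
    W ⊓ LinearMap.ker ((innerSL ℝ (gu - gh)).toLinearMap ∘ₗ LinearMap.snd ℝ _ _)
  set X := discreteClass hT hΩ ΓD
  -- As an image of a space of coefficient vectors, X is finite dimensional and hence admits an
  -- orthogonal projection.
  have hXfin : FiniteDimensional ℝ X := by
    unfold X discreteClass; infer_instance
  have hXc : CompleteSpace X := FiniteDimensional.complete ℝ X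
  -- The boundary term of Green's formula vanishes: the normal component is zero on ΓN, and traces
  -- of test functions are zero on ΓD.
  have hlift : ∀ {q : Plane → Plane} {g : Plane → ℝ} (hg : MemXh Ω T ΓD g) (hq : MemRT Ω T q),
      HasNormalTrace Ω T ΓN q 0 → HasWeakDiv Ω q (fun x => - g x) → ∀ z ∈ W,
      inner ℝ (hq.1.1.toLp q) z.2 = inner ℝ ((hg.memLp hT hΩ).toLp g) z.1 := by
    rintro q g hg hq hn hd _ ⟨v, hv, rfl⟩
    obtain ⟨τ, hτ, hτD⟩ := hv.ae_eq_zero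
    rw [inner_toLp, inner_toLp, hq.green hT hΩ hΓ hg hd hn v hτ hτD]
    simp [mul_comm]
  have hgal : ∀ v : H1 Ω, MemVh Ω T ΓD 0 v →
      (v.memLp_toFun.toLp v.toFun, v.memLp_grad.toLp v.grad) ∈ Wh := by
    intro v hv
    refine ⟨⟨v, hv.memV hT hΩ hΓ, rfl⟩, ?_⟩
    change inner ℝ (gu - gh) (v.memLp_grad.toLp v.grad) = 0
    rw [inner_sub_left, inner_toLp, inner_toLp, huh.2 v hv,
      hu.2 v (hv.memV hT hΩ hΓ) _ (hasTrace_of_continuousOn hT hΩ hv.1), sub_self]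
  have hSm : AEStronglyMeasurable (S.indicator fun _ => (1 : ℝ)) (volume.restrict Ω) :=
    (stronglyMeasurable_const.indicator hS).aestronglyMeasurable
  have hS1 : ∀ x, ‖S.indicator (fun _ => (1 : ℝ)) x‖ ≤ 1 := fun x => by
    by_cases hx : x ∈ S <;> simp [hx]
  -- `B` multiplies by √α and `B'` by the indicator of S, which is at most √α because α = 1 on S.
  -- The right inverse comes with a constant of unknown sign, hence |C|.
  have key := local_estimate (W := W) (Wh := Wh) (X := X) (c := c) (κ := kappa Ω T ΓD ΓN)
    (C := |C|) (m := Real.sqrt 2 * α.gradSup)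
    (B := mulLp (α.aestronglyMeasurable_sqrt hΩ) (α.sqrt_le_one hΩ))
    (B' := mulLp hSm (Eventually.of_forall hS1))
    (F := hF2.toLp _) (p := hp2.toLp ph) (gu := gu) (gh := gh)
    (e := (u.add (uh.smul (-1))).memLp_toFun.toLp _)
    inf_le_left hc0 (abs_nonneg C) (mul_nonneg (Real.sqrt_nonneg _) α.gradSup_nonneg)
    ?_ ?_ ?_ ?_ ?_ (fun q hq z hz => α.abs_inner_le hT hΩ hq hz) ?_ ?_ ?_ (fun z hz => hz.2)
  · rw [← MemLp.toLp_sub, ← MemLp.toLp_sub, norm_mulLp_toLp, norm_mulLp_toLp,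
      norm_toLp_eq_l2norm, norm_toLp_eq_l2norm, α.weightedNorm_eq hΩ] at key
    have e1 : l2norm Ω (fun x => S.indicator (fun _ => (1 : ℝ)) x • (u.grad - uh.grad) x) =
        l2norm S (fun x => u.grad x - uh.grad x) := by
      rw [l2norm, l2norm]
      congr 1
      rw [setIntegral_eq_of_subset_of_forall_sdiff_eq_zero hΩ.isOpen.measurableSet hSΩ]
      · exact setIntegral_congr_fun hS fun x hx => by simp [hx]
      · intro x hx
        simp [hx.2]
    rw [e1] at key
    -- The factor 2√2 is 2m, with m = √2‖∇α‖_∞ from the commutator estimate.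
    have e2 : errorE2 T ΓD ΓN C0K α uh ph ^ 2 = 2 * (Real.sqrt 2 * α.gradSup) *
        Real.sqrt (kappa Ω T ΓD ΓN ^ 2 + c ^ 2) * l2norm Ω (uh.grad - ph) ^ 2 := by
      have hpos : 0 ≤ constC Ω T ΓD ΓN C0K := Real.sqrt_nonneg _
      have hgs := α.gradSup_nonneg
      rw [errorE2, mul_pow, Real.sq_sqrt (by positivity), constC, ← hc]
      change _ * l2norm Ω (uh.grad - ph) ^ 2 = _
      ring
    rw [e2, errorE1, ← hc]
    exact key
  · rintro _ ⟨v, hv, rfl⟩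
    obtain ⟨_, _, _, hv0⟩ := hv
    obtain ⟨m, hm, hvm⟩ := hT.exists_stepFun_approx hΩ hC0K hcK hv0
    refine ⟨stepClass hT hΩ m, ⟨m, hm, rfl⟩, ?_⟩
    change ‖v.memLp_toFun.toLp v.toFun - (hT.memLp_stepFun hΩ m).toLp _‖ ≤
      c * ‖v.memLp_grad.toLp v.grad‖
    rw [← MemLp.toLp_sub, norm_toLp_eq_l2norm, norm_toLp_eq_l2norm]
    exact hvm
  · intro x hx
    obtain ⟨g, hg, rfl⟩ := exists_of_mem_discreteClass hT hΩ hx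
    obtain ⟨q, hq, hqC⟩ := hC g hg
    -- The right inverse solves div q = g, whereas the lifting uses div q = −g.
    have hq' := hq.const_smul (-1)
    refine ⟨_, hlift hg (hq'.memRT hT hΩ) hq'.normal (by simpa using hq'.weakDiv), ?_⟩
    rw [norm_toLp_eq_l2norm, norm_toLp_eq_l2norm, l2norm_smul]
    simp only [abs_neg, abs_one, one_mul]
    exact hqC.trans (mul_le_mul_of_nonneg_right (le_abs_self C) (l2norm_nonneg _ _))
  · intro x hx η hη
    obtain ⟨g, hg, rfl⟩ := exists_of_mem_discreteClass hT hΩ hx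
    obtain ⟨v, q, hv, hq, hn, hd, hle⟩ := exists_kappa_approx hT hΩ hΓ hg hη
    refine ⟨_, hgal v hv, _, hlift hg hq hn hd, ?_⟩
    change ‖v.memLp_grad.toLp v.grad - hq.1.1.toLp q‖ ≤ _
    rw [← MemLp.toLp_sub, norm_toLp_eq_l2norm, norm_toLp_eq_l2norm]
    exact hle
  · intro g
    refine Lp.norm_le_norm_of_ae_le ?_
    filter_upwards [coeFn_mulLp (α.aestronglyMeasurable_sqrt hΩ) (α.sqrt_le_one hΩ) g,
      α.sqrt_le_one hΩ] with x h1 h2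
    rw [h1, norm_smul]
    exact mul_le_of_le_one_left (norm_nonneg _) h2
  · intro g
    refine Lp.norm_le_norm_of_ae_le ?_
    filter_upwards [coeFn_mulLp (α.aestronglyMeasurable_sqrt hΩ) (α.sqrt_le_one hΩ) g,
      coeFn_mulLp hSm (Eventually.of_forall hS1) g] with x h1 h2
    rw [h1, h2]
    by_cases hx : x ∈ S
    · simp [hx, α.eq_one x hx]
    · simp only [Set.indicator_of_notMem hx, zero_smul, norm_zero]
      positivity
  · intro x hx
    obtain ⟨g, hg, rfl⟩ := exists_of_mem_discreteClass hT hΩ hx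
    rw [inner_toLp]
    simpa [mul_comm] using hπf.2 g hg
  · rintro _ ⟨v, hv, rfl⟩
    obtain ⟨τ, hτ, hτD⟩ := hv.ae_eq_zero
    change inner ℝ (gu - hp2.toLp ph) (v.memLp_grad.toLp v.grad) =
      inner ℝ (hF2.toLp _) (v.memLp_toFun.toLp v.toFun)
    rw [inner_sub_left, inner_toLp, inner_toLp, inner_toLp, hu.2 v hv τ hτ,
      hph.green hT hΩ hΓ hπf.1 hdiv hnormal v hτ hτD]
    have h1 := integral_sub (hf.integrable_mul v.memLp_toFun) (hπ2.integrable_mul v.memLp_toFun)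
    simp only [Pi.mul_apply, ← sub_mul] at h1
    simp only [RCLike.inner_apply, conj_trivial, mul_comm (v.toFun _)]
    rw [h1]
    ring
  · refine ⟨_, hu.1.sub_mem hT hΩ (huh.1.memV hT hΩ hΓ), ?_⟩
    refine Prod.ext rfl ?_
    change gu - gh = _
    rw [← MemLp.toLp_sub]
    refine MemLp.toLp_congr _ (u.add (uh.smul (-1))).memLp_grad (Eventually.of_forall fun x => ?_)
    simp [H1.add, H1.smul, sub_eq_add_neg]
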